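/- **Setting.** Let $f:\mathbb R\to\mathbb R$ be Lipschitz with $f(0)=0$ and differentiable at $0$; put $a(v)=f(v)/v$ for $v\neq0$, $a(0)=f'(0)$, and $$V(v_l,v_r)=\min_{[v_l,v_r]}a\ \text{ if } v_l\le v_r,\qquad V(v_l,v_r)=\max_{[v_r,v_l]}a\ \text{ if } v_r\le v_l .$$ Let $u_0\in BV\cap L^1(\mathbb R)$ be nonnegative, $T>0$, $N\ge1$, $x_0^1<\dots<x_0^N$, and set $v_0^i=\frac{1}{x_0^{i+1}-x_0^i}\int_{x_0^i}^{x_0^{i+1}}u_0\,dx$ for $1\le i<N$, $v_0^0=v_0^N=0$, $v_0=\sum_{i=1}^{N-1}v_0^i\chi_{(x_0^i,x_0^{i+1})}$. **The scheme.** A run of the particle path scheme on $[0,T]$ consists of times $0=t_0<t_1<\dots<t_J=T$, index sets $\{1,\dots,N\}=\mathcal I_0\supset\mathcal I_1\supset\dots\supset\mathcal I_{J-1}$, with $\mathcal I_j=\{\pi_j(1)<\dots<\pi_j(N_j)\}$ and $\pi_j(0)=0$, continuous positions $x^i_t$ and local densities $v^i_t$ with $v^0_t=v^N_t=0$, starting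 from $x_0^i,v_0^i$, such that for each $j<J$: * for $t\in[t_j,t_{j+1})$ one has $x_t^{\pi_j(1)}<\dots<x_t^{\pi_j(N_j)}$, and for $t\in(t_j,t_{j+1})$ and $1\le i\le N_j$ one has $\dot x_t^{\pi_j(i)}=V\bigl(v_t^{\pi_j(i-1)},v_t^{\pi_j(i)}\bigr)$; * $v_t^{\pi_j(i)}=\dfrac{x_{t_j}^{\pi_j(i+1)}-x_{t_j}^{\pi_j(i)}}{x_t^{\pi_j(i+1)}-x_t^{\pi_j(i)}}\,v_{t_j}^{\pi_j(i)}$ for $t\in[t_j,t_{j+1}]$ and $1\le i<N_j$ (for a cell that has collapsed at $t_{j+1}$ the value there plays no role); * if $j+1<J$, then at $t_{j+1}$ at least two particles of $\mathcal I_j$ coincide, and $\mathcal I_{j+1}$ is obtained from $\mathcal I_j$ by deleting every particle that coincides with its right neighbour. For $t\in[t_j,t_{j+1})$ (and $t=T$ if $j=J-1$) let $v(x,t)=\sum_{i=1}^{N_j-1}v_t^{\pi_j(i)}\chi_{(x_t^{\pi_j(i)},x_t^{\pi_j(i+1)})}(x)$, and let $x\mapsto A(x,t)$ be the piecewise linear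 interpolation of the values $V(v_t^{\pi_j(i-1)},v_t^{\pi_j(i)})$ at the nodes $x_t^{\pi_j(i)}$, $1\le i\le N_j$, extended by constants to the left of the first and to the right of the last node. **Proposition.** For every run of the scheme the following holds. 1. The ODE $\dot x_t=A(x_t,t)$ for a.e. $t\in(s,T)$, $x_s=x$, generates a unique forward Lipschitz flow $X=X_t(x,s)$: for every $x\in\mathbb R$ and $s\in[0,T]$, $t\mapsto X_t(x,s)$ is the unique absolutely continuous solution on $[s,T]$; it is continuously differentiable on $(s,T)\cap(t_j,t_{j+1})$ for each $j<J$; $(x,s,t)\mapsto X_t(x,s)$ is jointly Lipschitz on $\{x\in\mathbb R,\ 0\le s\le t\le T\}$; and $X_s(x,s)=x$, $X_t(X_r(x,s),r)=X_t(x,s)$ for $0\le s\le r\le t\le T$. 2. For every $k\in\mathbb R$, $v_k=v-k$ is, up to null sets, the unique weak solution of $$\partial_tv_k+\partial_x(Av_k)=-k\,\partial_xA,\qquad v_k(0)=v_0-k .$$ Here a weak solution of $\partial_tu+\partial_x(bu)=h$, $u(0)=\bar u$, with $b\in L^\infty(\mathbb R\times(0,T))$, $h\in L^\infty((0,T);L^1(\mathbb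 R))$, $\bar u\in L^\infty(\mathbb R)$, is a function $u\in L^\infty(\mathbb R\times(0,T))$ with $$\int_0^T\!\!\int_{\mathbb R}(\partial_t\varphi+b\,\partial_x\varphi)u\,dx\,dt+\int_0^T\!\!\int_{\mathbb R}\varphi h\,dx\,dt+\int_{\mathbb R}\bar u(x)\varphi(x,0)\,dx=0\qquad\text{for all }\varphi\in C_c^\infty(\mathbb R\times[0,T));$$ that $A$, $-k\,\partial_xA$ and $v_0-k$ belong to these spaces is part of the claim. 3. For all $k\in\mathbb R$ and $0\le s\le t\le T$, $v_k(t)=X_t(s)_\#v_k(s)-k\int_s^tX_t(r)_\#(\partial_xA(r))\,dr$, that is, for all $\theta\in C_c(\mathbb R)$, $$\int_{\mathbb R}\theta(x)v_k(x,t)\,dx=\int_{\mathbb R}\theta(X_t(x,s))v_k(x,s)\,dx-k\int_s^t\!\int_{\mathbb R}\theta(X_t(x,r))\,\partial_xA(x,r)\,dx\,dr .$$ -/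

import Mathlib

open MeasureTheory Set

/-- The velocity `a(v) = f(v) / v` belonging to the flux `f`, with `a(0) = f'(0)`. -/
noncomputable def fluxVelocity (f : ℝ → ℝ) (v : ℝ) : ℝ :=
  if v = 0 then deriv f 0 else f v / v

/-- The particle velocity `V(v_l, v_r)`: the minimum of `a` over `[v_l, v_r]` if `v_l ≤ v_r`, and the
maximum of `a` over `[v_r, v_l]` otherwise. (The function `a` is continuous for the fluxes
considered, so that the infimum and the supremum are attained.) -/
noncomputable def particleVelocity (f : ℝ → ℝ) (vl vr : ℝ) : ℝ :=
  if vl ≤ vr then sInf (fluxVelocity f '' Icc vl vr) else sSup (fluxVelocity f '' Icc vr vl)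

/-- Essential bounded variation on the real line: some almost everywhere equal representative has
bounded variation. -/
def EssBoundedVariation (u : ℝ → ℝ) : Prop :=
  ∃ w : ℝ → ℝ, u =ᵐ[volume] w ∧ BoundedVariationOn w univ

/-- The initial local density of cell `i`, the mean value of `u₀` over `(x₀ⁱ, x₀ⁱ⁺¹)`. -/
noncomputable def initialDensity (u₀ : ℝ → ℝ) (x₀ : ℕ → ℝ) (i : ℕ) : ℝ :=
  (∫ y in (x₀ i)..(x₀ (i + 1)), u₀ y) / (x₀ (i + 1) - x₀ i)

/-- The piecewise constant approximation `v₀` of the initial function `u₀` by the particles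
`x₀¹ < ⋯ < x₀ᴺ`; it vanishes on the two unbounded cells. -/
noncomputable def initialApprox (u₀ : ℝ → ℝ) (N : ℕ) (x₀ : ℕ → ℝ) (x : ℝ) : ℝ :=
  ∑ i ∈ Finset.Ico 1 N,
    (Ioo (x₀ i) (x₀ (i + 1))).indicator (fun _ => initialDensity u₀ x₀ i) x

/-- Raw data of a run of the particle path scheme: the time interval is split at the collision
times into `stages` intervals `[time j, time (j+1)]`, `j < stages`. During stage `j` there are
`count j` particles, and the `i`-th of them from the left, `1 ≤ i ≤ count j`, is the original
particle with number `idx j i`. The position at time `t` of the original particle `i` is `pos i t`,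
and the local density to its right is `dens i t`; the values of `pos i` and `dens i` after the
deletion of particle `i` play no role. -/
structure ParticleData where
  stages : ℕ
  time : ℕ → ℝ
  count : ℕ → ℕ
  idx : ℕ → ℕ → ℕ
  pos : ℕ → ℝ → ℝ
  dens : ℕ → ℝ → ℝ

namespace ParticleData

variable (S : ParticleData)

/-- Position at time `t` of the `i`-th particle (from the left) of stage `j`. -/
def node (j i : ℕ) (t : ℝ) : ℝ := S.pos (S.idx j i) t

/-- Local density at time `t` to the right of the `i`-th particle of stage `j`. For `i = 0` it is the
density to the left of all particles. -/
def cellDens (j i : ℕ) (t : ℝ) : ℝ := S.dens (S.idx j i) t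

/-- Prescribed velocity at time `t` of the `i`-th particle of stage `j`. -/
noncomputable def nodeVel (f : ℝ → ℝ) (j i : ℕ) (t : ℝ) : ℝ :=
  particleVelocity f (S.cellDens j (i - 1) t) (S.cellDens j i t)

/-- The stage to which time `t` belongs: `j` for `time j ≤ t < time (j+1)`, and the last stage at the
final time. -/
noncomputable def stageAt (t : ℝ) : ℕ :=
  Nat.findGreatest (fun j => S.time j ≤ t) (S.stages - 1)

/-- The approximate solution `v(x, t)`, piecewise constant in `x`, with the local densities as values
on the cells between neighbouring particles, and zero on the two unbounded cells. -/
noncomputable def approx (x t : ℝ) : ℝ :=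
  ∑ i ∈ Finset.Ico 1 (S.count (S.stageAt t)),
    (Ioo (S.node (S.stageAt t) i t) (S.node (S.stageAt t) (i + 1) t)).indicator
      (fun _ => S.cellDens (S.stageAt t) i t) x

/-- The linear interpolation of the velocities of the particles `i` and `i+1` of stage `j`. -/
noncomputable def interpVel (f : ℝ → ℝ) (j i : ℕ) (x t : ℝ) : ℝ :=
  (S.node j (i + 1) t - x) / (S.node j (i + 1) t - S.node j i t) * S.nodeVel f j i t +
    (x - S.node j i t) / (S.node j (i + 1) t - S.node j i t) * S.nodeVel f j (i + 1) t

/-- The velocity field `A(x, t)`: the piecewise linear interpolation of the particle velocities, with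
the particle positions as nodes, constant to the left of the first and to the right of the
last particle. -/
noncomputable def velocity (f : ℝ → ℝ) (x t : ℝ) : ℝ :=
  if x < S.node (S.stageAt t) 1 t then S.nodeVel f (S.stageAt t) 1 t
  else if S.node (S.stageAt t) (S.count (S.stageAt t)) t ≤ x then
    S.nodeVel f (S.stageAt t) (S.count (S.stageAt t)) t
  else
    ∑ i ∈ Finset.Ico 1 (S.count (S.stageAt t)),
      (Ico (S.node (S.stageAt t) i t) (S.node (S.stageAt t) (i + 1) t)).indicator
        (fun y => S.interpVel f (S.stageAt t) i y t) x

/-- The spatial derivative `∂ₓA(x, t)` (it exists except at the finitely many particle positions). -/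
noncomputable def velocityDeriv (f : ℝ → ℝ) (x t : ℝ) : ℝ :=
  deriv (fun y => S.velocity f y t) x

end ParticleData

/-- `S` is a run on `[0, T]` of the particle path scheme with flux `f`, initial function `u₀` and
initial particles `x₀¹ < ⋯ < x₀ᴺ`. -/
structure IsParticlePathScheme (f u₀ : ℝ → ℝ) (N : ℕ) (x₀ : ℕ → ℝ) (T : ℝ) (S : ParticleData) :
    Prop where
  stages_pos : 0 < S.stages
  time_zero : S.time 0 = 0
  time_last : S.time S.stages = T
  time_lt : ∀ j < S.stages, S.time j < S.time (j + 1)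
  count_zero : S.count 0 = N
  idx_zero : ∀ i ≤ N, S.idx 0 i = i
  pos_init : ∀ i ∈ Icc 1 N, S.pos i 0 = x₀ i
  dens_init : ∀ i ∈ Ico 1 N, S.dens i 0 = initialDensity u₀ x₀ i
  /-- The local densities on the two unbounded cells vanish. -/
  dens_left : ∀ t ∈ Icc 0 T, S.dens 0 t = 0
  dens_right : ∀ t ∈ Icc 0 T, S.dens N t = 0
  /-- Within a stage the particles keep their strict order, so that the first collision in the stage
  is not before its end. -/
  ordered : ∀ j < S.stages, ∀ t ∈ Ico (S.time j) (S.time (j + 1)),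
    ∀ i ∈ Ico 1 (S.count j), S.node j i t < S.node j (i + 1) t
  /-- Particle positions are continuous up to the end points of the stage. -/
  pos_cont : ∀ j < S.stages, ∀ i ∈ Icc 1 (S.count j),
    ContinuousOn (S.node j i) (Icc (S.time j) (S.time (j + 1)))
  /-- The particle ODE. -/
  pos_ode : ∀ j < S.stages, ∀ i ∈ Icc 1 (S.count j), ∀ t ∈ Ioo (S.time j) (S.time (j + 1)),
    HasDerivAt (S.node j i) (S.nodeVel f j i t) t
  /-- The law of the local densities, started at the beginning of the stage. (For a cell that has
  collapsed at the end of the stage the value there is immaterial.) -/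
  dens_law : ∀ j < S.stages, ∀ i ∈ Ico 1 (S.count j), ∀ t ∈ Icc (S.time j) (S.time (j + 1)),
    S.cellDens j i t =
      (S.node j (i + 1) (S.time j) - S.node j i (S.time j)) /
        (S.node j (i + 1) t - S.node j i t) * S.cellDens j i (S.time j)
  /-- Every stage but the last one ends with a collision. -/
  collision : ∀ j, j + 1 < S.stages →
    ∃ i ∈ Ico 1 (S.count j), S.node j i (S.time (j + 1)) = S.node j (i + 1) (S.time (j + 1))
  /-- In a collision all colliding particles except the rightmost one are deleted, together with the
  densities to their right, and `idx (j+1)` enumerates the remaining ones increasingly. -/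
  survivors : ∀ j, j + 1 < S.stages →
    S.idx (j + 1) '' Icc 1 (S.count (j + 1)) =
      S.idx j '' {i | i ∈ Icc 1 (S.count j) ∧
        (i < S.count j → S.node j i (S.time (j + 1)) ≠ S.node j (i + 1) (S.time (j + 1)))}
  idx_mono : ∀ j, j + 1 < S.stages → StrictMonoOn (S.idx (j + 1)) (Icc 1 (S.count (j + 1)))
  idx_left : ∀ j, j + 1 < S.stages → S.idx (j + 1) 0 = 0

/-- `γ` is an absolutely continuous solution of `γ'(t) = b(γ(t), t)` for a.e. `t ∈ (s, T)`,
`γ(s) = x`. -/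
def IsODESolution (b : ℝ → ℝ → ℝ) (T s x : ℝ) (γ : ℝ → ℝ) : Prop :=
  γ s = x ∧ AbsolutelyContinuousOnInterval γ s T ∧
    ∀ᵐ t, t ∈ Ioo s T → HasDerivAt γ (b (γ t) t) t

/-- `X t x s` is a forward Lipschitz flow on `[0, T]` of the ODE with right-hand side `b`: the position
at time `t` of the unique solution which is at `x` at time `s`. -/
structure IsForwardLipschitzFlow (b : ℝ → ℝ → ℝ) (T : ℝ) (X : ℝ → ℝ → ℝ → ℝ) : Prop where
  solution : ∀ x, ∀ s ∈ Icc 0 T, IsODESolution b T s x (fun t => X t x s)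
  unique : ∀ x, ∀ s ∈ Icc 0 T, ∀ γ, IsODESolution b T s x γ → EqOn γ (fun t => X t x s) (Icc s T)
  lipschitz : ∃ K, LipschitzOnWith K (fun p : ℝ × ℝ × ℝ => X p.2.2 p.1 p.2.1)
    {p | 0 ≤ p.2.1 ∧ p.2.1 ≤ p.2.2 ∧ p.2.2 ≤ T}
  refl : ∀ x, ∀ s ∈ Icc 0 T, X s x s = x
  semigroup : ∀ x s r t, 0 ≤ s → s ≤ r → r ≤ t → t ≤ T → X t (X r x s) r = X t x s

/-- Lebesgue measure on the space-time strip of all `(x, t)` with `0 < t < T`. -/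
noncomputable def stripMeasure (T : ℝ) : Measure (ℝ × ℝ) := volume.restrict (univ ×ˢ Ioo 0 T)

/-- Test functions in `C_c^∞(ℝ × [0, T))`: restrictions of smooth functions with compact support in
`ℝ × (-∞, T)`. -/
structure IsTestFunction (T : ℝ) (φ : ℝ → ℝ → ℝ) : Prop where
  smooth : ContDiff ℝ (⊤ : ℕ∞) (Function.uncurry φ)
  compact : HasCompactSupport (Function.uncurry φ)
  support : tsupport (Function.uncurry φ) ⊆ {p | p.2 < T}

/-- `u ∈ L^∞(ℝ × (0, T))` is a weak solution of `∂ₜu + ∂ₓ(b u) = h`, `u(0) = u₀`, where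
`b ∈ L^∞(ℝ × (0, T))`, `h ∈ L^∞((0, T); L¹(ℝ))` and `u₀ ∈ L^∞(ℝ)`. -/
structure IsWeakSolution (b h : ℝ → ℝ → ℝ) (u₀ : ℝ → ℝ) (T : ℝ) (u : ℝ → ℝ → ℝ) : Prop where
  velocity_mem : MemLp (Function.uncurry b) ⊤ (stripMeasure T)
  source_meas : AEStronglyMeasurable (Function.uncurry h) (stripMeasure T)
  source_bound : ∃ C : ℝ, ∀ᵐ t, t ∈ Ioo 0 T →
    Integrable (fun x => h x t) ∧ ∫ x, |h x t| ≤ C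
  init_mem : MemLp u₀ ⊤ volume
  sol_mem : MemLp (Function.uncurry u) ⊤ (stripMeasure T)
  weak : ∀ φ, IsTestFunction T φ →
    (∫ t in (0 : ℝ)..T, ∫ x,
        (deriv (fun τ => φ x τ) t + b x t * deriv (fun y => φ y t) x) * u x t) +
      (∫ t in (0 : ℝ)..T, ∫ x, φ x t * h x t) + ∫ x, u₀ x * φ x 0 = 0

/-!
The scheme is turned into a system of `N` coalescing Lipschitz paths `y 0 ≤ ⋯ ≤ y (N - 1)` on `[0, T]`
(`PathSystem`): a particle that is absorbed continues along the path of the particle absorbing it.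
On every cell between neighbouring paths the mass is conserved, so that the approximate solution is
the piecewise constant function with values mass / length (`pathDensity`), and the velocity field
interpolates the velocities of the paths (`pathField`).

The one analytic input is the growth bound `(gap)' ≤ C * gap` for the gaps between neighbouring
paths (`IsParticlePathScheme.gap_growth`). A cell whose density is maximal does not shrink, because
the velocities `V` of its two end points are separated by the velocity `a` of the cell; this gives
the maximum principle `IsParticlePathScheme.cellDens_le`. Hence a cell with positive mass has a
length bounded below, never collapses, and satisfies the growth bound trivially. A cell without mass
may collapse, but its end points are separated by `a 0`, so that its length is nonincreasing.

For a path system everything is explicit. The flow is the piecewise affine map carrying cells to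
cells, and translations outside of them (`pathFlow`); the growth bound makes it Lipschitz forward in
time, and makes the field one-sided Lipschitz, whence uniqueness for the ODE by Grönwall's inequality
(`PathSystem.isForwardLipschitzFlow`). The pushforward formula `PathSystem.pushforward` is a change
of variables in each cell: for every earlier time `r`, the mean value of `θ ∘ X_t(·, r)` over the cell
at time `r` is the mean value of `θ` over the cell at time `t` (`cellMean`). The weak formulation
`PathSystem.weak_formulation` follows by integrating in time the derivative of the integral of a
test function over each cell.

Weak solutions are unique by duality (`PathSystem.eq_zero_of_weak`): for a smooth, compactly
supported `g` the function `ψ(x, t) = ∫_T^t g(X_r(x, t), r) dr` is Lipschitz and solves the adjoint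
equation `∂ₜψ + b ∂ₓψ = g` almost everywhere, and it is approximated by smooth test functions.
-/

open scoped NNReal Topology

/-! ### Piecewise linear functions -/

/-- The truncation of `z` to `[0, h]`. -/
noncomputable def trunc (h z : ℝ) : ℝ := max 0 (min z h)

lemma trunc_nonneg (h z : ℝ) : 0 ≤ trunc h z := le_max_left _ _

lemma trunc_le {h : ℝ} (hh : 0 ≤ h) (z : ℝ) : trunc h z ≤ h := max_le hh (min_le_right _ _)

lemma trunc_of_nonpos {h z : ℝ} (hz : z ≤ 0) : trunc h z = 0 :=
  max_eq_left ((min_le_left _ _).trans hz)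

lemma trunc_of_ge {h z : ℝ} (hh : 0 ≤ h) (hz : h ≤ z) : trunc h z = h := by
  rw [trunc, min_eq_right hz, max_eq_right hh]

lemma trunc_of_mem {h z : ℝ} (h0 : 0 ≤ z) (h1 : z ≤ h) : trunc h z = z := by
  rw [trunc, min_eq_left h1, max_eq_right h0]

lemma trunc_mono (h : ℝ) : Monotone (trunc h) := fun _ _ hz =>
  max_le_max le_rfl (min_le_min hz le_rfl)

lemma trunc_sub_le (h : ℝ) {z z' : ℝ} (hz : z ≤ z') : trunc h z' - trunc h z ≤ z' - z := by
  unfold trunc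
  rcases max_cases 0 (min z' h) with h1 | h1 <;> rcases max_cases 0 (min z h) with h2 | h2 <;>
    rcases min_cases z' h with h3 | h3 <;> rcases min_cases z h with h4 | h4 <;> linarith

lemma abs_trunc_sub_le (h z z' : ℝ) : |trunc h z - trunc h z'| ≤ |z - z'| := by
  rcases le_total z z' with hz | hz
  · rw [abs_sub_comm, abs_sub_comm z, abs_of_nonneg (sub_nonneg.2 (trunc_mono h hz)),
      abs_of_nonneg (sub_nonneg.2 hz)]
    exact trunc_sub_le h hz
  · rw [abs_of_nonneg (sub_nonneg.2 (trunc_mono h hz)), abs_of_nonneg (sub_nonneg.2 hz)]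
    exact trunc_sub_le h hz

/-- The piecewise linear function with values `z 0, …, z n` at the nodes `p 0 ≤ ⋯ ≤ p n`, and with
slope `σ` to the left of the first and to the right of the last node. Cells of length zero are
allowed: they contribute nothing, since `trunc 0 = 0`. -/
noncomputable def pwLinear (n : ℕ) (p z : ℕ → ℝ) (σ x : ℝ) : ℝ :=
  z 0 + σ * (min (x - p 0) 0 + max (x - p n) 0) +
    ∑ k ∈ Finset.range n, (z (k + 1) - z k) / (p (k + 1) - p k) * trunc (p (k + 1) - p k) (x - p k)

/-- The nodes `p 0, …, p n` are in increasing order, possibly with coincidences. -/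
def NodesOrdered (n : ℕ) (p : ℕ → ℝ) : Prop := ∀ k < n, p k ≤ p (k + 1)

/-- Whenever two neighbouring nodes `p k`, `p (k + 1)` coincide, so do `q k` and `q (k + 1)`. -/
def CollapseCompat (n : ℕ) (p q : ℕ → ℝ) : Prop := ∀ k < n, p k = p (k + 1) → q k = q (k + 1)

lemma NodesOrdered.le {n : ℕ} {p : ℕ → ℝ} (hp : NodesOrdered n p) {i j : ℕ} (hij : i ≤ j)
    (hj : j ≤ n) : p i ≤ p j := by
  induction j, hij using Nat.le_induction with
  | base => exact le_rfl
  | succ j _ ih => exact (ih (by omega)).trans (hp j (by omega))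

/-- Every point lies in one of the two unbounded cells or in one of the bounded ones. -/
lemma exists_cell (n : ℕ) (p : ℕ → ℝ) (x : ℝ) :
    x ≤ p 0 ∨ p n ≤ x ∨ ∃ k < n, p k ≤ x ∧ x ≤ p (k + 1) := by
  induction n with
  | zero => rcases le_total x (p 0) with h | h <;> tauto
  | succ n ih =>
    rcases ih with h | h | ⟨k, hk, h⟩
    · exact .inl h
    · rcases le_total x (p (n + 1)) with h' | h'
      · exact .inr (.inr ⟨n, by omega, h, h'⟩)
      · exact .inr (.inl h')
    · exact .inr (.inr ⟨k, by omega, h⟩)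

lemma sum_trunc_of_ge {n : ℕ} {p z : ℕ → ℝ} (hp : NodesOrdered n p) (hz : CollapseCompat n p z)
    {x : ℝ} {j : ℕ} (hj : j ≤ n) (hx : p j ≤ x) :
    ∑ k ∈ Finset.range j,
      (z (k + 1) - z k) / (p (k + 1) - p k) * trunc (p (k + 1) - p k) (x - p k) = z j - z 0 := by
  rw [← Finset.sum_range_sub]
  refine Finset.sum_congr rfl fun k hk => ?_
  have hk' := Finset.mem_range.1 hk
  have h1 := hp k (by omega)
  have h2 := (hp.le (show k + 1 ≤ j by omega) hj).trans hx
  rw [trunc_of_ge (by linarith) (by linarith)]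
  rcases eq_or_ne (p k) (p (k + 1)) with h | h
  · rw [hz k (by omega) h]; simp
  · exact div_mul_cancel₀ _ (sub_ne_zero.2 h.symm)

lemma sum_trunc_of_le {n : ℕ} {p z : ℕ → ℝ} (hp : NodesOrdered n p)
    {x : ℝ} {j : ℕ} (hx : x ≤ p j) :
    ∑ k ∈ Finset.Ico j n,
      (z (k + 1) - z k) / (p (k + 1) - p k) * trunc (p (k + 1) - p k) (x - p k) = 0 := by
  refine Finset.sum_eq_zero fun k hk => ?_
  have hk' := Finset.mem_Ico.1 hk
  have := hp.le hk'.1 hk'.2.le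
  rw [trunc_of_nonpos (by linarith), mul_zero]

lemma pwLinear_left {n : ℕ} {p z : ℕ → ℝ} (hp : NodesOrdered n p) (σ : ℝ) {x : ℝ} (hx : x ≤ p 0) :
    pwLinear n p z σ x = z 0 + σ * (x - p 0) := by
  have h := sum_trunc_of_le (z := z) hp hx
  rw [← Finset.range_eq_Ico] at h
  have hn := hp.le (Nat.zero_le n) le_rfl
  rw [pwLinear, h, min_eq_left (by linarith), max_eq_right (by linarith)]
  ring

lemma pwLinear_right {n : ℕ} {p z : ℕ → ℝ} (hp : NodesOrdered n p) (hz : CollapseCompat n p z)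
    (σ : ℝ) {x : ℝ} (hx : p n ≤ x) :
    pwLinear n p z σ x = z n + σ * (x - p n) := by
  have h := sum_trunc_of_ge hp hz le_rfl hx
  have hn := hp.le (Nat.zero_le n) le_rfl
  rw [pwLinear, h, min_eq_right (by linarith), max_eq_left (by linarith)]
  ring

lemma pwLinear_cell {n : ℕ} {p z : ℕ → ℝ} (hp : NodesOrdered n p) (hz : CollapseCompat n p z)
    (σ : ℝ) {x : ℝ} {i : ℕ} (hi : i < n) (h0 : p i ≤ x) (h1 : x ≤ p (i + 1)) :
    pwLinear n p z σ x = z i + (z (i + 1) - z i) / (p (i + 1) - p i) * (x - p i) := by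
  have e1 := sum_trunc_of_ge hp hz hi.le h0
  have e2 := sum_trunc_of_le (z := z) hp h1
  have hn := hp.le (Nat.zero_le i) hi.le
  have hn' := hp.le (show i + 1 ≤ n from hi) le_rfl
  rw [pwLinear, ← Finset.sum_range_add_sum_Ico _ (show i + 1 ≤ n from hi), e2,
    Finset.sum_range_succ, e1, min_eq_right (by linarith), max_eq_right (by linarith),
    trunc_of_mem (by linarith) (by linarith)]
  ring

lemma CollapseCompat.refl (n : ℕ) (p : ℕ → ℝ) : CollapseCompat n p p := fun _ _ h => h

lemma pwLinear_self {n : ℕ} {p : ℕ → ℝ} (hp : NodesOrdered n p) (x : ℝ) :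
    pwLinear n p p 1 x = x := by
  rcases exists_cell n p x with h | h | ⟨k, hk, h0, h1⟩
  · rw [pwLinear_left hp 1 h]; ring
  · rw [pwLinear_right hp (.refl _ _) 1 h]; ring
  · rw [pwLinear_cell hp (.refl _ _) 1 hk h0 h1]
    rcases eq_or_ne (p (k + 1) - p k) 0 with h | h
    · rw [h]; simp; linarith
    · rw [div_self h]; ring

lemma ratio_mem {a b x : ℝ} (h0 : a ≤ x) (h1 : x ≤ b) : (x - a) / (b - a) ∈ Icc (0 : ℝ) 1 :=
  ⟨div_nonneg (by linarith) (by linarith), div_le_one_of_le₀ (by linarith) (by linarith)⟩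

lemma pwLinear_cell_mem {n : ℕ} {p q : ℕ → ℝ} (hp : NodesOrdered n p) (hq : NodesOrdered n q)
    (hpq : CollapseCompat n p q) (σ : ℝ) {x : ℝ} {i : ℕ} (hi : i < n) (h0 : p i ≤ x)
    (h1 : x ≤ p (i + 1)) : pwLinear n p q σ x ∈ Icc (q i) (q (i + 1)) := by
  rw [pwLinear_cell hp hpq σ hi h0 h1]
  obtain ⟨r0, r1⟩ := ratio_mem h0 h1
  have hq' := hq i hi
  have e : (q (i + 1) - q i) / (p (i + 1) - p i) * (x - p i) =
      (q (i + 1) - q i) * ((x - p i) / (p (i + 1) - p i)) := by ring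
  rw [e]
  constructor <;> nlinarith

/-- Composition of piecewise linear functions with matching nodes. It yields both the semigroup
property of the flow (`σ = 1`) and the differential equation (`σ = 0`). -/
lemma pwLinear_comp {n : ℕ} {p q r : ℕ → ℝ} (hp : NodesOrdered n p) (hq : NodesOrdered n q)
    (hpq : CollapseCompat n p q) (hqr : CollapseCompat n q r) (σ x : ℝ) :
    pwLinear n q r σ (pwLinear n p q 1 x) = pwLinear n p r σ x := by
  have hpr : CollapseCompat n p r := fun k hk h => hqr k hk (hpq k hk h)
  rcases exists_cell n p x with h | h | ⟨k, hk, h0, h1⟩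
  · rw [pwLinear_left hp 1 h, pwLinear_left hp σ h, pwLinear_left hq σ (by linarith)]; ring
  · rw [pwLinear_right hp hpq 1 h, pwLinear_right hp hpr σ h,
      pwLinear_right hq hqr σ (by linarith)]
    ring
  · have hm := pwLinear_cell_mem hp hq hpq 1 hk h0 h1
    rw [pwLinear_cell hq hqr σ hk hm.1 hm.2, pwLinear_cell hp hpr σ hk h0 h1,
      pwLinear_cell hp hpq 1 hk h0 h1]
    rcases eq_or_ne (q k) (q (k + 1)) with h | h
    · rw [hqr k hk h]; simp
    · have : q (k + 1) - q k ≠ 0 := sub_ne_zero.2 h.symm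
      rw [add_sub_cancel_left, ← mul_assoc, div_mul_div_cancel₀ this]

lemma abs_pwLinear_sub_le {n : ℕ} {p z : ℕ → ℝ} {σ B : ℝ}
    (hB : ∀ k < n, |(z (k + 1) - z k) / (p (k + 1) - p k)| ≤ B) (x x' : ℝ) :
    |pwLinear n p z σ x - pwLinear n p z σ x'| ≤ (2 * |σ| + n * B) * |x - x'| := by
  have e1 : |min (x - p 0) 0 - min (x' - p 0) 0| ≤ |x - x'| := by
    simpa using abs_inf_sub_inf_le_abs (x - p 0) (x' - p 0) 0
  have e2 : |max (x - p n) 0 - max (x' - p n) 0| ≤ |x - x'| := by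
    simpa using abs_sup_sub_sup_le_abs (x - p n) (x' - p n) 0
  have e3 : ∑ k ∈ Finset.range n, |(z (k + 1) - z k) / (p (k + 1) - p k) *
      (trunc (p (k + 1) - p k) (x - p k) - trunc (p (k + 1) - p k) (x' - p k))| ≤
      ∑ k ∈ Finset.range n, B * |x - x'| := by
    refine Finset.sum_le_sum fun k hk => ?_
    have hk' := hB k (Finset.mem_range.1 hk)
    rw [abs_mul]
    refine mul_le_mul hk' ?_ (abs_nonneg _) ((abs_nonneg _).trans hk')
    simpa using abs_trunc_sub_le (p (k + 1) - p k) (x - p k) (x' - p k)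
  rw [Finset.sum_const, Finset.card_range, nsmul_eq_mul] at e3
  have e : pwLinear n p z σ x - pwLinear n p z σ x' =
      σ * ((min (x - p 0) 0 - min (x' - p 0) 0) + (max (x - p n) 0 - max (x' - p n) 0)) +
      ∑ k ∈ Finset.range n, (z (k + 1) - z k) / (p (k + 1) - p k) *
      (trunc (p (k + 1) - p k) (x - p k) - trunc (p (k + 1) - p k) (x' - p k)) := by
    simp only [pwLinear, mul_sub, Finset.sum_sub_distrib]; ring
  rw [e]
  refine (abs_add_le _ _).trans ?_
  have e4 := Finset.abs_sum_le_sum_abs (fun k => (z (k + 1) - z k) / (p (k + 1) - p k) *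
      (trunc (p (k + 1) - p k) (x - p k) - trunc (p (k + 1) - p k) (x' - p k))) (Finset.range n)
  rw [abs_mul]
  have e5 := abs_add_le (min (x - p 0) 0 - min (x' - p 0) 0) (max (x - p n) 0 - max (x' - p n) 0)
  have e6 := mul_le_mul_of_nonneg_left (e5.trans (add_le_add e1 e2)) (abs_nonneg σ)
  nlinarith

/-- An upper bound for the slopes is a one-sided Lipschitz bound. -/
lemma pwLinear_sub_le {n : ℕ} {p z : ℕ → ℝ} {B : ℝ} (hB0 : 0 ≤ B)
    (hB : ∀ k < n, (z (k + 1) - z k) / (p (k + 1) - p k) ≤ B) {x x' : ℝ} (hx : x ≤ x') :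
    pwLinear n p z 0 x' - pwLinear n p z 0 x ≤ n * B * (x' - x) := by
  have e3 : ∑ k ∈ Finset.range n, (z (k + 1) - z k) / (p (k + 1) - p k) *
      (trunc (p (k + 1) - p k) (x' - p k) - trunc (p (k + 1) - p k) (x - p k)) ≤
      ∑ k ∈ Finset.range n, B * (x' - x) := by
    refine Finset.sum_le_sum fun k hk => ?_
    have hk' := hB k (Finset.mem_range.1 hk)
    have h0 := sub_nonneg.2 (trunc_mono (p (k + 1) - p k) (sub_le_sub_right hx (p k)))
    have h1 := trunc_sub_le (p (k + 1) - p k) (sub_le_sub_right hx (p k))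
    rw [sub_sub_sub_cancel_right] at h1
    exact (mul_le_mul_of_nonneg_right hk' h0).trans (mul_le_mul_of_nonneg_left h1 hB0)
  rw [Finset.sum_const, Finset.card_range, nsmul_eq_mul] at e3
  have e : pwLinear n p z 0 x' - pwLinear n p z 0 x =
      ∑ k ∈ Finset.range n, (z (k + 1) - z k) / (p (k + 1) - p k) *
      (trunc (p (k + 1) - p k) (x' - p k) - trunc (p (k + 1) - p k) (x - p k)) := by
    simp only [pwLinear, mul_sub, Finset.sum_sub_distrib]; ring
  rw [e]; linarith

lemma div_mul_trunc_mem {h : ℝ} (hh : 0 ≤ h) (z : ℝ) : trunc h z / h ∈ Icc (0 : ℝ) 1 :=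
  ⟨div_nonneg (trunc_nonneg _ _) hh, div_le_one_of_le₀ (trunc_le hh _) hh⟩

/-- The difference quotients in the values: `pwLinear` depends linearly on `z`, with coefficients in
`[0, 1]`. -/
lemma abs_pwLinear_sub_values_le {n : ℕ} {p z z' : ℕ → ℝ} (hp : NodesOrdered n p) {σ δ : ℝ}
    (hδ : ∀ k ≤ n, |z k - z' k| ≤ δ) (x : ℝ) :
    |pwLinear n p z σ x - pwLinear n p z' σ x| ≤ (1 + 2 * n) * δ := by
  have e3 : ∑ k ∈ Finset.range n, |((z (k + 1) - z' (k + 1)) - (z k - z' k)) *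
      (trunc (p (k + 1) - p k) (x - p k) / (p (k + 1) - p k))| ≤
      ∑ k ∈ Finset.range n, 2 * δ := by
    refine Finset.sum_le_sum fun k hk => ?_
    have hk' := Finset.mem_range.1 hk
    obtain ⟨m0, m1⟩ := div_mul_trunc_mem (sub_nonneg.2 (hp k hk')) (x - p k)
    have a1 := hδ (k + 1) hk'
    have a0 := hδ k hk'.le
    have a2 := abs_sub (z (k + 1) - z' (k + 1)) (z k - z' k)
    rw [abs_mul, abs_of_nonneg m0]
    have a3 := abs_nonneg (z (k + 1) - z' (k + 1) - (z k - z' k))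
    nlinarith
  rw [Finset.sum_const, Finset.card_range, nsmul_eq_mul] at e3
  have e : pwLinear n p z σ x - pwLinear n p z' σ x = (z 0 - z' 0) +
      ∑ k ∈ Finset.range n, ((z (k + 1) - z' (k + 1)) - (z k - z' k)) *
      (trunc (p (k + 1) - p k) (x - p k) / (p (k + 1) - p k)) := by
    have : ∀ k, ((z (k + 1) - z' (k + 1)) - (z k - z' k)) *
      (trunc (p (k + 1) - p k) (x - p k) / (p (k + 1) - p k)) =
      (z (k + 1) - z k) / (p (k + 1) - p k) * trunc (p (k + 1) - p k) (x - p k) -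
      (z' (k + 1) - z' k) / (p (k + 1) - p k) * trunc (p (k + 1) - p k) (x - p k) := by
      intro k; ring
    simp only [pwLinear, this, Finset.sum_sub_distrib]; ring
  rw [e]
  have h1 := Finset.abs_sum_le_sum_abs (fun k => ((z (k + 1) - z' (k + 1)) - (z k - z' k)) *
      (trunc (p (k + 1) - p k) (x - p k) / (p (k + 1) - p k))) (Finset.range n)
  have h2 := abs_add_le (z 0 - z' 0) (∑ k ∈ Finset.range n,
    ((z (k + 1) - z' (k + 1)) - (z k - z' k)) *
      (trunc (p (k + 1) - p k) (x - p k) / (p (k + 1) - p k)))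
  have h3 := hδ 0 (Nat.zero_le n)
  nlinarith

lemma abs_pwLinear_zero_le {n : ℕ} {p z : ℕ → ℝ} (hp : NodesOrdered n p) {B : ℝ}
    (hB : ∀ k ≤ n, |z k| ≤ B) (x : ℝ) : |pwLinear n p z 0 x| ≤ (1 + 2 * n) * B := by
  have := abs_pwLinear_sub_values_le (z' := fun _ => 0) (σ := 0) hp (by simpa using hB) x
  simpa [pwLinear] using this

/-- Differentiation with respect to the values of a piecewise linear function. -/
lemma hasDerivAt_pwLinear {n : ℕ} {p : ℕ → ℝ} {z : ℕ → ℝ → ℝ} {z' : ℕ → ℝ} {t : ℝ}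
    (hz : ∀ k ≤ n, HasDerivAt (z k) (z' k) t) (σ x : ℝ) :
    HasDerivAt (fun τ => pwLinear n p (fun k => z k τ) σ x) (pwLinear n p z' 0 x) t := by
  have h := HasDerivAt.fun_sum (u := Finset.range n) (fun k hk =>
    (((hz (k + 1) (Finset.mem_range.1 hk)).sub (hz k (Finset.mem_range.1 hk).le)).div_const
      (p (k + 1) - p k)).mul_const (trunc (p (k + 1) - p k) (x - p k)))
  have h0 := ((hz 0 (Nat.zero_le n)).add_const
    (σ * (min (x - p 0) 0 + max (x - p n) 0))).add h
  refine (h0.congr_deriv ?_)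
  simp [pwLinear]

/-! ### Grönwall's inequality for absolutely continuous functions -/

lemma AbsolutelyContinuousOnInterval.le_exp_mul {e : ℝ → ℝ} {s t K : ℝ} (hst : s ≤ t)
    (he : AbsolutelyContinuousOnInterval e s t)
    (hd : ∀ᵐ r, r ∈ Ioo s t → ∃ e', HasDerivAt e e' r ∧ e' ≤ K * e r) :
    e t ≤ Real.exp (K * (t - s)) * e s := by
  have hexp : AbsolutelyContinuousOnInterval (fun r => Real.exp (-(K * r))) s t := by
    refine ContDiffOn.absolutelyContinuousOnInterval (ContDiff.contDiffOn ?_)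
    fun_prop
  have h := (hexp.fun_mul he).integral_deriv_eq_sub
  have hle : (∫ r in s..t, deriv (fun r => Real.exp (-(K * r)) * e r) r) ≤ 0 := by
    rw [intervalIntegral.integral_of_le hst, ← integral_Ioc_eq_integral_Ioo.symm]
    refine integral_nonpos_of_ae ?_
    refine (ae_restrict_iff' measurableSet_Ioo).2 ?_
    filter_upwards [hd] with r hr hrm
    obtain ⟨e', h1, h2⟩ := hr hrm
    have h3 : HasDerivAt (fun r => Real.exp (-(K * r)))
        (Real.exp (-(K * r)) * -(K * 1)) r :=
      (((hasDerivAt_id r).const_mul K).neg).exp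
    rw [(h3.fun_mul h1).deriv]
    have := Real.exp_pos (-(K * r))
    simp only [Pi.zero_apply]
    nlinarith
  rw [h] at hle
  have h5 : Real.exp (-(K * t)) * e t ≤ Real.exp (-(K * s)) * e s := by linarith
  have h6 := mul_le_mul_of_nonneg_left h5 (Real.exp_pos (K * t)).le
  rw [← mul_assoc, ← mul_assoc, ← Real.exp_add, ← Real.exp_add, add_neg_cancel, Real.exp_zero,
    one_mul] at h6
  rwa [show K * (t - s) = K * t + -(K * s) by ring]

/-! ### Systems of coalescing paths and their flow -/

/-- Ordered Lipschitz paths `y 0 ≤ ⋯ ≤ y n`, stationary outside of the time interval `[0, T]`, whose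
gaps grow at most exponentially. In particular paths which meet stay together. A particle that has
been absorbed by its right neighbour is represented by a path that follows this neighbour, so that
the number of paths is the same at all times. The set `E` contains the exceptional times at which the
paths need not be differentiable. -/
structure PathSystem (n : ℕ) (y : ℕ → ℝ → ℝ) (E : Set ℝ) (T : ℝ) (L : ℝ≥0) (C : ℝ) : Prop where
  pos : 0 < T
  lip : ∀ i ≤ n, LipschitzWith L (y i)
  ord : ∀ t, NodesOrdered n (fun i => y i t)
  const_left : ∀ i ≤ n, ∀ t ≤ 0, y i t = y i 0
  const_right : ∀ i ≤ n, ∀ t, T ≤ t → y i t = y i T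
  finite : E.Finite
  diff : ∀ i ≤ n, ∀ t ∉ E, DifferentiableAt ℝ (y i) t
  growth_nonneg : 0 ≤ C
  growth : ∀ i < n, ∀ t ∉ E, deriv (y (i + 1)) t - deriv (y i) t ≤ C * (y (i + 1) t - y i t)

/-- The flow transporting each cell between neighbouring paths affinely, and the unbounded cells by
translation: the position at time `t` of the point which is at `x` at time `s`. -/
noncomputable def pathFlow (n : ℕ) (y : ℕ → ℝ → ℝ) (t x s : ℝ) : ℝ :=
  pwLinear n (fun i => y i s) (fun i => y i t) 1 x

/-- The velocity field interpolating the velocities of the paths. -/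
noncomputable def pathField (n : ℕ) (y : ℕ → ℝ → ℝ) (x t : ℝ) : ℝ :=
  pwLinear n (fun i => y i t) (fun i => deriv (y i) t) 0 x

namespace PathSystem

variable {n : ℕ} {y : ℕ → ℝ → ℝ} {E : Set ℝ} {T : ℝ} {L : ℝ≥0} {C : ℝ}

lemma continuous_path (h : PathSystem n y E T L C) {i : ℕ} (hi : i ≤ n) : Continuous (y i) :=
  (h.lip i hi).continuous

lemma abs_sub_le (h : PathSystem n y E T L C) {i : ℕ} (hi : i ≤ n) (s t : ℝ) :
    |y i s - y i t| ≤ L * |s - t| := by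
  simpa [Real.dist_eq] using (h.lip i hi).dist_le_mul s t

lemma abs_deriv_le (h : PathSystem n y E T L C) {i : ℕ} (hi : i ≤ n) (t : ℝ) :
    |deriv (y i) t| ≤ L := by
  simpa using norm_deriv_le_of_lipschitz (x₀ := t) (h.lip i hi)

lemma ae_notMem (h : PathSystem n y E T L C) : ∀ᵐ t : ℝ, t ∉ E :=
  h.finite.countable.ae_notMem volume

lemma gap_nonneg (h : PathSystem n y E T L C) {i : ℕ} (hi : i < n) (t : ℝ) :
    0 ≤ y (i + 1) t - y i t := sub_nonneg.2 (h.ord t i hi)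

lemma hasDerivAt_gap (h : PathSystem n y E T L C) {i : ℕ} (hi : i < n) {t : ℝ} (ht : t ∉ E) :
    HasDerivAt (fun r => y (i + 1) r - y i r) (deriv (y (i + 1)) t - deriv (y i) t) t :=
  (h.diff (i + 1) hi t ht).hasDerivAt.fun_sub (h.diff i hi.le t ht).hasDerivAt

lemma gap_lipschitz (h : PathSystem n y E T L C) {i : ℕ} (hi : i < n) :
    LipschitzWith (L + L) (fun r => y (i + 1) r - y i r) :=
  (h.lip (i + 1) hi).sub (h.lip i hi.le)

/-- At a coincidence the gap has a minimum, so that the velocities coincide as well. -/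
lemma collapseCompat_deriv (h : PathSystem n y E T L C) {t : ℝ} (ht : t ∉ E) :
    CollapseCompat n (fun i => y i t) (fun i => deriv (y i) t) := by
  intro k hk hkk
  have hmin : IsLocalMin (fun r => y (k + 1) r - y k r) t :=
    Filter.Eventually.of_forall fun r => by
      have := h.gap_nonneg hk r
      simp only at hkk ⊢
      linarith
  have := hmin.hasDerivAt_eq_zero (h.hasDerivAt_gap hk ht)
  simp only; linarith

/-- The division is harmless for collapsed cells: there the numerator vanishes as well. -/
lemma gap_deriv_eq (h : PathSystem n y E T L C) {t : ℝ} (ht : t ∉ E) {i : ℕ} (hi : i < n) :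
    (deriv (y (i + 1)) t - deriv (y i) t) / (y (i + 1) t - y i t) * (y (i + 1) t - y i t) =
      deriv (y (i + 1)) t - deriv (y i) t := by
  rcases eq_or_ne (y i t) (y (i + 1) t) with h1 | h1
  · have := h.collapseCompat_deriv ht i hi h1
    simp only at this
    rw [this]; simp
  · exact div_mul_cancel₀ _ (sub_ne_zero.2 h1.symm)

lemma gap_le_aux (h : PathSystem n y E T L C) {i : ℕ} (hi : i < n) {s t : ℝ} (hst : s ≤ t) :
    y (i + 1) t - y i t ≤ Real.exp (C * (t - s)) * (y (i + 1) s - y i s) := by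
  refine AbsolutelyContinuousOnInterval.le_exp_mul
    (e := fun r => y (i + 1) r - y i r) hst
    (h.gap_lipschitz hi).lipschitzOnWith.absolutelyContinuousOnInterval ?_
  filter_upwards [h.ae_notMem] with r hr _
  exact ⟨_, h.hasDerivAt_gap hi hr, h.growth i hi r hr⟩

lemma path_clamp (h : PathSystem n y E T L C) {i : ℕ} (hi : i ≤ n) (t : ℝ) :
    y i t = y i (max 0 (min t T)) := by
  rcases le_total t 0 with h0 | h0
  · rw [max_eq_left ((min_le_left _ _).trans h0), h.const_left i hi t h0]
  · rcases le_total t T with h1 | h1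
    · rw [min_eq_left h1, max_eq_right h0]
    · rw [min_eq_right h1, max_eq_right h.pos.le, h.const_right i hi t h1]

/-- The growth bound in integrated form. It holds for all times since the paths are constant outside of
`[0, T]`. -/
lemma gap_le (h : PathSystem n y E T L C) {i : ℕ} (hi : i < n) {s t : ℝ} (hst : s ≤ t) :
    y (i + 1) t - y i t ≤ Real.exp (C * T) * (y (i + 1) s - y i s) := by
  have hc := h.growth_nonneg
  rw [h.path_clamp hi t, h.path_clamp hi s, h.path_clamp hi.le t, h.path_clamp hi.le s]
  have hm : max 0 (min s T) ≤ max 0 (min t T) := max_le_max le_rfl (min_le_min hst le_rfl)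
  refine (h.gap_le_aux hi hm).trans (mul_le_mul_of_nonneg_right (Real.exp_le_exp.2 ?_)
    (h.gap_nonneg hi _))
  have h1 : max 0 (min t T) ≤ T := max_le h.pos.le (min_le_right _ _)
  have h2 : 0 ≤ max 0 (min s T) := le_max_left _ _
  exact mul_le_mul_of_nonneg_left (by linarith) hc

/-- Paths that have met stay together. -/
lemma collapseCompat (h : PathSystem n y E T L C) {s t : ℝ} (hst : s ≤ t) :
    CollapseCompat n (fun i => y i s) (fun i => y i t) := by
  intro k hk hkk
  have h1 := h.gap_le hk hst
  have h2 := h.gap_nonneg hk t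
  simp only at hkk ⊢
  rw [hkk, sub_self, mul_zero] at h1
  linarith

lemma slope_flow_le (h : PathSystem n y E T L C) {s t : ℝ} (hst : s ≤ t) {k : ℕ} (hk : k < n) :
    |(y (k + 1) t - y k t) / (y (k + 1) s - y k s)| ≤ Real.exp (C * T) := by
  rw [abs_of_nonneg (div_nonneg (h.gap_nonneg hk t) (h.gap_nonneg hk s))]
  exact div_le_of_le_mul₀ (h.gap_nonneg hk s) (Real.exp_pos _).le (h.gap_le hk hst)

lemma slope_field_le (h : PathSystem n y E T L C) {t : ℝ} (ht : t ∉ E) {k : ℕ} (hk : k < n) :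
    (deriv (y (k + 1)) t - deriv (y k) t) / (y (k + 1) t - y k t) ≤ C :=
  div_le_of_le_mul₀ (h.gap_nonneg hk t) h.growth_nonneg (h.growth k hk t ht)

lemma flow_self (h : PathSystem n y E T L C) (x s : ℝ) : pathFlow n y s x s = x :=
  pwLinear_self (h.ord s) x

lemma flow_comp (h : PathSystem n y E T L C) {s r t : ℝ} (hsr : s ≤ r) (hrt : r ≤ t) (x : ℝ) :
    pathFlow n y t (pathFlow n y r x s) r = pathFlow n y t x s :=
  pwLinear_comp (h.ord s) (h.ord r) (h.collapseCompat hsr) (h.collapseCompat hrt) 1 x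

lemma hasDerivAt_flow' (h : PathSystem n y E T L C) (x s : ℝ) {t : ℝ} (ht : t ∉ E) :
    HasDerivAt (fun t => pathFlow n y t x s)
      (pwLinear n (fun i => y i s) (fun i => deriv (y i) t) 0 x) t :=
  hasDerivAt_pwLinear (z := y) (fun k hk => (h.diff k hk t ht).hasDerivAt) 1 x

lemma hasDerivAt_flow (h : PathSystem n y E T L C) (x : ℝ) {s t : ℝ} (hst : s ≤ t) (ht : t ∉ E) :
    HasDerivAt (fun t => pathFlow n y t x s) (pathField n y (pathFlow n y t x s) t) t := by
  refine (h.hasDerivAt_flow' x s ht).congr_deriv ?_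
  exact (pwLinear_comp (h.ord s) (h.ord t) (h.collapseCompat hst)
    (h.collapseCompat_deriv ht) 0 x).symm

lemma abs_flow_sub_time_le (h : PathSystem n y E T L C) (x s t t' : ℝ) :
    |pathFlow n y t x s - pathFlow n y t' x s| ≤ (1 + 2 * n) * (L * |t - t'|) :=
  abs_pwLinear_sub_values_le (h.ord s) (fun _ hk => h.abs_sub_le hk t t') x

lemma abs_flow_sub_self_le (h : PathSystem n y E T L C) (x s t : ℝ) :
    |pathFlow n y t x s - x| ≤ (1 + 2 * n) * (L * |t - s|) := by
  have := h.abs_flow_sub_time_le x s t s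
  rwa [h.flow_self] at this

lemma abs_flow_sub_le (h : PathSystem n y E T L C) {s t : ℝ} (hst : s ≤ t) (x x' : ℝ) :
    |pathFlow n y t x s - pathFlow n y t x' s| ≤ (2 + n * Real.exp (C * T)) * |x - x'| := by
  have := abs_pwLinear_sub_le (σ := 1) (z := fun i => y i t) (p := fun i => y i s)
    (fun _ hk => h.slope_flow_le hst hk) x x'
  simpa [pathFlow] using this

lemma continuous_flow_time (h : PathSystem n y E T L C) (x s : ℝ) :
    Continuous (fun t => pathFlow n y t x s) := by
  refine (LipschitzWith.of_dist_le_mul (K := (1 + 2 * n) * L) fun t t' => ?_).continuous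
  have := h.abs_flow_sub_time_le x s t t'
  simp only [Real.dist_eq]
  push_cast
  linarith

lemma continuous_flow_space (h : PathSystem n y E T L C) {s t : ℝ} (hst : s ≤ t) :
    Continuous (fun x => pathFlow n y t x s) := by
  refine (LipschitzWith.of_dist_le_mul
    (K := 2 + n * (Real.exp (C * T)).toNNReal) fun t t' => ?_).continuous
  have := h.abs_flow_sub_le hst t t'
  simp only [Real.dist_eq]
  push_cast
  rwa [Real.coe_toNNReal _ (Real.exp_pos _).le]

/-- Joint Lipschitz continuity of the flow. -/
lemma abs_flow_sub_le_joint (h : PathSystem n y E T L C) {x s t x' s' t' : ℝ} (hst : s ≤ t)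
    (hst' : s' ≤ t') :
    |pathFlow n y t x s - pathFlow n y t' x' s'| ≤
      (2 * ((1 + 2 * n) * L)) * |t - t'| + (2 + n * Real.exp (C * T)) * |x - x'| +
        (2 + n * Real.exp (C * T)) * ((1 + 2 * n) * L) * |s - s'| := by
  set D := 2 + n * Real.exp (C * T) with hD
  have hD0 : 0 ≤ D := by have := (Real.exp_pos (C * T)).le; positivity
  -- the dependence on the starting time, for a common end time
  have key : ∀ {a b τ : ℝ} (z : ℝ), a ≤ b → b ≤ τ →
      |pathFlow n y τ z a - pathFlow n y τ z b| ≤ D * ((1 + 2 * n) * L) * |a - b| := by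
    intro a b τ z hab hbτ
    rw [← h.flow_comp hab hbτ z]
    refine (h.abs_flow_sub_le hbτ _ _).trans ?_
    have := h.abs_flow_sub_self_le z a b
    rw [abs_sub_comm b a] at this
    rw [← hD, mul_assoc]
    refine mul_le_mul_of_nonneg_left (this.trans ?_) hD0
    rw [mul_assoc]
  have key' : ∀ {a b τ : ℝ} (z : ℝ), a ≤ τ → b ≤ τ →
      |pathFlow n y τ z a - pathFlow n y τ z b| ≤ D * ((1 + 2 * n) * L) * |a - b| := by
    intro a b τ z ha hb
    rcases le_total a b with hab | hab
    · exact key z hab hb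
    · rw [abs_sub_comm, abs_sub_comm a b]; exact key z hab ha
  set m := max t t' with hm
  have m1 : t ≤ m := le_max_left _ _
  have m2 : t' ≤ m := le_max_right _ _
  have a1 := h.abs_flow_sub_time_le x s t m
  have a2 := key' x (hst.trans m1) (hst'.trans m2)
  have a3 := h.abs_flow_sub_le (hst'.trans m2) x x'
  have a4 := h.abs_flow_sub_time_le x' s' m t'
  have b1 : |t - m| ≤ |t - t'| := by
    rcases max_cases t t' with ⟨e, _⟩ | ⟨e, _⟩
    · rw [hm, e]; simp
    · rw [hm, e]
  have b2 : |m - t'| ≤ |t - t'| := by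
    rcases max_cases t t' with ⟨e, _⟩ | ⟨e, _⟩
    · rw [hm, e]
    · rw [hm, e]; simp
  have c0 : (0 : ℝ) ≤ (1 + 2 * n) * L := by positivity
  have c1 := mul_le_mul_of_nonneg_left b1 c0
  have c2 := mul_le_mul_of_nonneg_left b2 c0
  have d1 := _root_.abs_sub_le (pathFlow n y t x s) (pathFlow n y m x s) (pathFlow n y t' x' s')
  have d2 := _root_.abs_sub_le (pathFlow n y m x s) (pathFlow n y m x s') (pathFlow n y t' x' s')
  have d3 := _root_.abs_sub_le (pathFlow n y m x s') (pathFlow n y m x' s') (pathFlow n y t' x' s')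
  rw [← mul_assoc] at a1 a4
  linarith

/-- The field is one-sided Lipschitz from above. -/
lemma field_oneSided (h : PathSystem n y E T L C) {t : ℝ} (ht : t ∉ E) (x x' : ℝ) :
    (pathField n y x t - pathField n y x' t) * (x - x') ≤ n * C * (x - x') ^ 2 := by
  have key : ∀ {x x' : ℝ}, x' ≤ x →
      (pathField n y x t - pathField n y x' t) * (x - x') ≤ n * C * (x - x') ^ 2 := by
    intro x x' hx
    have h1 : pathField n y x t - pathField n y x' t ≤ n * C * (x - x') :=
      pwLinear_sub_le h.growth_nonneg (fun _ hk => h.slope_field_le ht hk) hx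
    have h2 := mul_le_mul_of_nonneg_right h1 (sub_nonneg.2 hx)
    linarith
  rcases le_total x' x with hx | hx
  · exact key hx
  · have := key hx
    nlinarith

lemma abs_field_le (h : PathSystem n y E T L C) (x t : ℝ) :
    |pathField n y x t| ≤ (1 + 2 * n) * L :=
  abs_pwLinear_zero_le (h.ord t) (fun _ hk => h.abs_deriv_le hk t) x

/-- Two absolutely continuous solutions with the same initial value coincide. -/
lemma ode_unique (h : PathSystem n y E T L C) {b : ℝ → ℝ → ℝ}
    (hb : ∀ t ∈ Ioo 0 T, t ∉ E → ∀ x, b x t = pathField n y x t)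
    {s x : ℝ} (hs : s ∈ Icc 0 T) {γ γ' : ℝ → ℝ} (hγ : IsODESolution b T s x γ)
    (hγ' : IsODESolution b T s x γ') : EqOn γ γ' (Icc s T) := by
  intro t ht
  have hsub : uIcc s t ⊆ uIcc s T := by
    rw [uIcc_of_le ht.1, uIcc_of_le hs.2]; exact Icc_subset_Icc le_rfl ht.2
  have hδ := (hγ.2.1.mono hsub).fun_sub (hγ'.2.1.mono hsub)
  have hle := AbsolutelyContinuousOnInterval.le_exp_mul (K := 2 * (n * C)) ht.1 (hδ.fun_mul hδ) (by
    filter_upwards [hγ.2.2, hγ'.2.2, h.ae_notMem] with r h1 h2 hr hrm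
    have hrs : r ∈ Ioo s T := ⟨hrm.1, hrm.2.trans_le ht.2⟩
    have d := (h1 hrs).fun_sub (h2 hrs)
    refine ⟨_, d.fun_mul d, ?_⟩
    have hr0 : r ∈ Ioo 0 T := ⟨hs.1.trans_lt hrs.1, hrs.2⟩
    rw [hb r hr0 hr, hb r hr0 hr]
    have := h.field_oneSided hr (γ r) (γ' r)
    nlinarith)
  simp only [hγ.1, hγ'.1, sub_self, mul_zero] at hle
  have : (γ t - γ' t) = 0 := by nlinarith
  linarith

lemma isODESolution_flow (h : PathSystem n y E T L C) {b : ℝ → ℝ → ℝ}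
    (hb : ∀ t ∈ Ioo 0 T, t ∉ E → ∀ x, b x t = pathField n y x t) (x : ℝ) {s : ℝ}
    (hs : s ∈ Icc 0 T) : IsODESolution b T s x (fun t => pathFlow n y t x s) := by
  refine ⟨h.flow_self x s, ?_, ?_⟩
  · refine LipschitzOnWith.absolutelyContinuousOnInterval (K := (1 + 2 * n) * L)
      (LipschitzOnWith.of_dist_le_mul fun t _ t' _ => ?_)
    have := h.abs_flow_sub_time_le x s t t'
    simp only [Real.dist_eq]
    push_cast
    linarith
  · filter_upwards [h.ae_notMem] with t ht htm
    rw [hb t ⟨hs.1.trans_lt htm.1, htm.2⟩ ht]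
    exact h.hasDerivAt_flow x htm.1.le ht

theorem isForwardLipschitzFlow (h : PathSystem n y E T L C) {b : ℝ → ℝ → ℝ}
    (hb : ∀ t ∈ Ioo 0 T, t ∉ E → ∀ x, b x t = pathField n y x t) :
    IsForwardLipschitzFlow b T (pathFlow n y) where
  solution x s hs := h.isODESolution_flow hb x hs
  unique x s hs γ hγ := h.ode_unique hb hs hγ (h.isODESolution_flow hb x hs)
  lipschitz := by
    set K : ℝ := (2 * ((1 + 2 * n) * L)) + (2 + n * Real.exp (C * T)) +
        (2 + n * Real.exp (C * T)) * ((1 + 2 * n) * L) with hK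
    have he := (Real.exp_pos (C * T)).le
    have hK0 : 0 ≤ K := by positivity
    refine ⟨K.toNNReal, LipschitzOnWith.of_dist_le_mul ?_⟩
    rintro ⟨x, s, t⟩ ⟨_, h1, _⟩ ⟨x', s', t'⟩ ⟨_, h2, _⟩
    have hd := h.abs_flow_sub_le_joint (x := x) (x' := x') h1 h2
    simp only at hd
    simp only [Real.dist_eq, Prod.dist_eq, Real.coe_toNNReal _ hK0]
    set d := max |x - x'| (max |s - s'| |t - t'|)
    have d1 : |x - x'| ≤ d := le_max_left _ _
    have d2 : |s - s'| ≤ d := (le_max_left _ _).trans (le_max_right _ _)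
    have d3 : |t - t'| ≤ d := (le_max_right _ _).trans (le_max_right _ _)
    refine hd.trans ?_
    have c0 : (0 : ℝ) ≤ (1 + 2 * n) * L := by positivity
    have c1 : 0 ≤ 2 + n * Real.exp (C * T) := by positivity
    have e1 := mul_le_mul_of_nonneg_left d3 (mul_nonneg zero_le_two c0)
    have e2 := mul_le_mul_of_nonneg_left d1 c1
    have e3 := mul_le_mul_of_nonneg_left d2 (mul_nonneg c1 c0)
    rw [hK, add_mul, add_mul]
    linarith
  refl x s _ := h.flow_self x s
  semigroup x s r t _ hsr hrt _ := h.flow_comp hsr hrt x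

lemma contDiffOn_flow (h : PathSystem n y E T L C) (x s : ℝ) {a b : ℝ}
    (hE : ∀ t ∈ Ioo a b, t ∉ E) (hc : ∀ i ≤ n, ContinuousOn (deriv (y i)) (Ioo a b)) :
    ContDiffOn ℝ 1 (fun t => pathFlow n y t x s) (Ioo a b) := by
  rw [contDiffOn_one_iff_derivWithin (isOpen_Ioo.uniqueDiffOn)]
  refine ⟨fun t ht => (h.hasDerivAt_flow' x s (hE t ht)).differentiableAt.differentiableWithinAt,
    ?_⟩
  have hcont : ContinuousOn
      (fun t => pwLinear n (fun i => y i s) (fun i => deriv (y i) t) 0 x) (Ioo a b) := by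
    unfold pwLinear
    refine ((hc 0 (Nat.zero_le n)).add continuousOn_const).add
      (continuousOn_finsetSum _ fun k hk => ?_)
    have hk' := Finset.mem_range.1 hk
    exact (((hc (k + 1) hk').sub (hc k hk'.le)).div_const _).mul continuousOn_const
  refine hcont.congr fun t ht => ?_
  rw [derivWithin_of_isOpen isOpen_Ioo ht]
  exact (h.hasDerivAt_flow' x s (hE t ht)).deriv

end PathSystem

/-! ### Integrals over the cells -/

/-- The step function with value `c i` on the cell `(p i, p (i + 1))`, `i < n`, and zero elsewhere. -/
noncomputable def stepFun (n : ℕ) (p c : ℕ → ℝ) (x : ℝ) : ℝ :=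
  ∑ i ∈ Finset.range n, (Ioo (p i) (p (i + 1))).indicator (fun _ => c i) x

lemma indicator_Ioo_mul_integrable {g : ℝ → ℝ} (hg : Continuous g) (a b c : ℝ) :
    Integrable (fun x => g x * (Ioo a b).indicator (fun _ => c) x) := by
  have h1 : IntegrableOn (fun x => g x * c) (Ioo a b) :=
    ((hg.mul continuous_const).integrableOn_Icc (a := a) (b := b)).mono_set Ioo_subset_Icc_self
  refine (h1.integrable_indicator measurableSet_Ioo).congr (.of_forall fun x => ?_)
  by_cases hx : x ∈ Ioo a b <;> simp [hx]

lemma integrable_mul_stepFun {g : ℝ → ℝ} (hg : Continuous g) (n : ℕ) (p c : ℕ → ℝ) :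
    Integrable (fun x => g x * stepFun n p c x) := by
  simp only [stepFun, Finset.mul_sum]
  exact integrable_finsetSum _ fun i _ => indicator_Ioo_mul_integrable hg _ _ _

lemma integral_mul_stepFun {g : ℝ → ℝ} (hg : Continuous g) {n : ℕ} {p : ℕ → ℝ}
    (hp : NodesOrdered n p) (c : ℕ → ℝ) :
    ∫ x, g x * stepFun n p c x = ∑ i ∈ Finset.range n, c i * ∫ x in p i..p (i + 1), g x := by
  simp only [stepFun, Finset.mul_sum]
  rw [integral_finsetSum _ fun i _ => indicator_Ioo_mul_integrable hg _ _ _]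
  refine Finset.sum_congr rfl fun i hi => ?_
  rw [intervalIntegral.integral_of_le (hp i (Finset.mem_range.1 hi)), ← integral_const_mul,
    integral_Ioc_eq_integral_Ioo, ← integral_indicator measurableSet_Ioo]
  refine integral_congr_ae (.of_forall fun x => ?_)
  by_cases hx : x ∈ Ioo (p i) (p (i + 1)) <;> simp [hx, mul_comm]

lemma integrable_stepFun (n : ℕ) (p c : ℕ → ℝ) : Integrable (stepFun n p c) := by
  simpa using integrable_mul_stepFun (g := fun _ => 1) continuous_const n p c

lemma abs_stepFun_le (n : ℕ) (p c : ℕ → ℝ) (x : ℝ) :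
    |stepFun n p c x| ≤ stepFun n p (fun i => |c i|) x := by
  refine (Finset.abs_sum_le_sum_abs _ _).trans (Finset.sum_le_sum fun i _ => ?_)
  by_cases hx : x ∈ Ioo (p i) (p (i + 1)) <;> simp [hx]

lemma stepFun_le {n : ℕ} {p c : ℕ → ℝ} {M : ℝ} (hM : 0 ≤ M) (hc : ∀ i < n, c i ≤ M) (x : ℝ) :
    stepFun n p c x ≤ n * M := by
  have : ∀ i ∈ Finset.range n, (Ioo (p i) (p (i + 1))).indicator (fun _ => c i) x ≤ M := by
    intro i hi
    by_cases hx : x ∈ Ioo (p i) (p (i + 1))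
    · simpa [hx] using hc i (Finset.mem_range.1 hi)
    · simpa [hx] using hM
  simpa [stepFun] using Finset.sum_le_card_nsmul _ _ _ this

lemma integral_stepFun {n : ℕ} {p : ℕ → ℝ} (hp : NodesOrdered n p) (c : ℕ → ℝ) :
    ∫ x, stepFun n p c x = ∑ i ∈ Finset.range n, c i * (p (i + 1) - p i) := by
  have := integral_mul_stepFun (g := fun _ => 1) continuous_const hp c
  simpa using this

lemma integral_eq_sum_cells {g : ℝ → ℝ} (hg : Integrable g) (n : ℕ) (p : ℕ → ℝ) :
    ∫ x, g x = (∫ x in Iic (p 0), g x) + (∑ i ∈ Finset.range n, ∫ x in p i..p (i + 1), g x) +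
      ∫ x in Ioi (p n), g x := by
  rw [intervalIntegral.sum_integral_adjacent_intervals fun k _ => hg.intervalIntegrable,
    ← intervalIntegral.integral_Iic_sub_Iic hg.integrableOn hg.integrableOn, add_sub_cancel,
    intervalIntegral.integral_Iic_add_Ioi hg.integrableOn hg.integrableOn]

/-- Parametrization of a cell by the unit interval. A piecewise linear function which maps cells to cells
preserves this parametrization. -/
lemma integral_cell_comp {n : ℕ} {p q : ℕ → ℝ} (hp : NodesOrdered n p)
    (hpq : CollapseCompat n p q) (σ : ℝ) {i : ℕ} (hi : i < n) (θ : ℝ → ℝ → ℝ) :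
    ∫ x in p i..p (i + 1), θ x (pwLinear n p q σ x) =
      (p (i + 1) - p i) * ∫ l in (0 : ℝ)..1,
        θ (p i + (p (i + 1) - p i) * l) (q i + (q (i + 1) - q i) * l) := by
  have h1 := intervalIntegral.mul_integral_comp_add_mul (a := 0) (b := 1)
    (f := fun x => θ x (pwLinear n p q σ x)) (c := p (i + 1) - p i) (d := p i)
  rw [mul_zero, add_zero, mul_one, add_sub_cancel] at h1
  rw [← h1]
  rcases eq_or_ne (p (i + 1) - p i) 0 with h0 | h0
  · simp [h0]
  congr 1
  refine intervalIntegral.integral_congr fun l hl => ?_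
  rw [uIcc_of_le zero_le_one] at hl
  have hg := hp i hi
  rw [pwLinear_cell hp hpq σ hi (by nlinarith [hl.1]) (by nlinarith [hl.2])]
  congr 1
  rw [add_sub_cancel_left]
  field_simp

lemma setIntegral_Iic_comp_add (θ : ℝ → ℝ) (a c : ℝ) :
    ∫ x in Iic a, θ (x + c) = ∫ x in Iic (a + c), θ x := by
  rw [← integral_indicator measurableSet_Iic, ← integral_indicator measurableSet_Iic,
    ← integral_add_right_eq_self ((Iic (a + c)).indicator θ) c]
  congr 1 with x
  simp [indicator]

lemma setIntegral_Ioi_comp_add (θ : ℝ → ℝ) (a c : ℝ) :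
    ∫ x in Ioi a, θ (x + c) = ∫ x in Ioi (a + c), θ x := by
  rw [← integral_indicator measurableSet_Ioi, ← integral_indicator measurableSet_Ioi,
    ← integral_add_right_eq_self ((Ioi (a + c)).indicator θ) c]
  congr 1 with x
  simp [indicator]

lemma integral_comp_pwLinear {n : ℕ} {p q : ℕ → ℝ} (hp : NodesOrdered n p)
    (hpq : CollapseCompat n p q) {θ : ℝ → ℝ} (hθ : Integrable fun x => θ (pwLinear n p q 1 x)) :
    ∫ x, θ (pwLinear n p q 1 x) = (∫ x in Iic (q 0), θ x) +
      (∑ i ∈ Finset.range n, (p (i + 1) - p i) *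
        ∫ l in (0 : ℝ)..1, θ (q i + (q (i + 1) - q i) * l)) + ∫ x in Ioi (q n), θ x := by
  rw [integral_eq_sum_cells hθ n p]
  refine congrArg₂ (· + ·) (congrArg₂ (· + ·) ?_ ?_) ?_
  · rw [show q 0 = p 0 + (q 0 - p 0) by ring, ← setIntegral_Iic_comp_add]
    refine setIntegral_congr_fun measurableSet_Iic fun x hx => ?_
    rw [pwLinear_left hp 1 hx]
    congr 1; ring
  · exact Finset.sum_congr rfl fun i hi =>
      integral_cell_comp hp hpq 1 (Finset.mem_range.1 hi) (fun _ z => θ z)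
  · rw [show q n = p n + (q n - p n) by ring, ← setIntegral_Ioi_comp_add]
    refine setIntegral_congr_fun measurableSet_Ioi fun x hx => ?_
    rw [pwLinear_right hp hpq 1 (le_of_lt hx)]
    congr 1; ring

/-! ### The spatial derivative of the velocity field -/

lemma hasDerivAt_trunc {h p x : ℝ} (hh : 0 ≤ h) (h0 : x ≠ p) (h1 : x ≠ p + h) :
    HasDerivAt (fun x => trunc h (x - p)) ((Ioo p (p + h)).indicator (fun _ => 1) x) x := by
  rcases lt_or_gt_of_ne h0 with h0 | h0
  · rw [indicator_of_notMem (fun hx => by linarith [hx.1])]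
    refine (hasDerivAt_const x (0 : ℝ)).congr_of_eventuallyEq ?_
    filter_upwards [Iio_mem_nhds h0] with z hz
    exact trunc_of_nonpos (by linarith [mem_Iio.1 hz])
  · rcases lt_or_gt_of_ne h1 with h1 | h1
    · rw [indicator_of_mem (show x ∈ Ioo p (p + h) from ⟨h0, h1⟩)]
      refine ((hasDerivAt_id x).sub_const p).congr_of_eventuallyEq ?_
      filter_upwards [Ioo_mem_nhds h0 h1] with z hz
      exact trunc_of_mem (by linarith [hz.1]) (by linarith [hz.2])
    · rw [indicator_of_notMem (fun hx => by linarith [hx.2])]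
      refine (hasDerivAt_const x h).congr_of_eventuallyEq ?_
      filter_upwards [Ioi_mem_nhds h1] with z hz
      exact trunc_of_ge hh (by linarith [mem_Ioi.1 hz])

lemma hasDerivAt_pwLinear_space {n : ℕ} {p : ℕ → ℝ} (hp : NodesOrdered n p) (z : ℕ → ℝ) {x : ℝ}
    (hx : ∀ i ≤ n, x ≠ p i) :
    HasDerivAt (pwLinear n p z 0)
      (stepFun n p (fun k => (z (k + 1) - z k) / (p (k + 1) - p k)) x) x := by
  have h := HasDerivAt.fun_sum (u := Finset.range n) (fun k hk =>
    (hasDerivAt_trunc (sub_nonneg.2 (hp k (Finset.mem_range.1 hk)))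
      (hx k (Finset.mem_range.1 hk).le)
      (by rw [add_sub_cancel]; exact hx (k + 1) (Finset.mem_range.1 hk))).const_mul
      ((z (k + 1) - z k) / (p (k + 1) - p k)))
  have h0 := h.const_add (z 0)
  have e : pwLinear n p z 0 = fun x => z 0 + ∑ k ∈ Finset.range n,
      (z (k + 1) - z k) / (p (k + 1) - p k) * trunc (p (k + 1) - p k) (x - p k) := by
    ext x; simp [pwLinear]
  rw [e]
  refine h0.congr_deriv (Finset.sum_congr rfl fun k _ => ?_)
  rw [add_sub_cancel]
  by_cases hm : x ∈ Ioo (p k) (p (k + 1)) <;> simp [hm]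

lemma ae_notMem_nodes (n : ℕ) (p : ℕ → ℝ) : ∀ᵐ x : ℝ, ∀ i ≤ n, x ≠ p i := by
  have h : ∀ᵐ x : ℝ, x ∉ p '' Iic n :=
    ((finite_Iic n).image p).countable.ae_notMem volume
  filter_upwards [h] with x hx i hi he
  exact hx ⟨i, hi, he.symm⟩

/-! ### Transport of the densities by the flow -/

/-- The density with mass `m i` on the cell between the paths `i` and `i + 1`. -/
noncomputable def pathDensity (n : ℕ) (y : ℕ → ℝ → ℝ) (m : ℕ → ℝ) (x t : ℝ) : ℝ :=
  stepFun n (fun i => y i t) (fun i => m i / (y (i + 1) t - y i t)) x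

/-- The almost everywhere derivative of `pathField` in space. -/
noncomputable def pathFieldDeriv (n : ℕ) (y : ℕ → ℝ → ℝ) (x t : ℝ) : ℝ :=
  stepFun n (fun i => y i t)
    (fun i => (deriv (y (i + 1)) t - deriv (y i) t) / (y (i + 1) t - y i t)) x

/-- The mean value of `θ` over the cell between the paths `i` and `i + 1` at time `t`. -/
noncomputable def cellMean (y : ℕ → ℝ → ℝ) (i : ℕ) (θ : ℝ → ℝ) (t : ℝ) : ℝ :=
  ∫ l in (0 : ℝ)..1, θ (y i t + (y (i + 1) t - y i t) * l)

namespace PathSystem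

variable {n : ℕ} {y : ℕ → ℝ → ℝ} {E : Set ℝ} {T : ℝ} {L : ℝ≥0} {C : ℝ}

lemma deriv_field_ae (h : PathSystem n y E T L C) {b : ℝ → ℝ → ℝ} {t : ℝ}
    (hb : ∀ x, b x t = pathField n y x t) :
    ∀ᵐ x, deriv (fun z => b z t) x = pathFieldDeriv n y x t := by
  filter_upwards [ae_notMem_nodes n (fun i => y i t)] with x hx
  rw [show (fun z => b z t) = pwLinear n (fun i => y i t) (fun i => deriv (y i) t) 0 from
    funext hb]
  exact (hasDerivAt_pwLinear_space (h.ord t) _ hx).deriv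

/-- The cells of nonzero mass transport `θ` by their mean value. -/
lemma integral_comp_flow_mul_density (h : PathSystem n y E T L C) {m : ℕ → ℝ}
    (hm : ∀ i < n, ∀ t, y (i + 1) t = y i t → m i = 0) {s t : ℝ} (hst : s ≤ t) {θ : ℝ → ℝ}
    (hθ : Continuous θ) :
    ∫ x, θ (pathFlow n y t x s) * pathDensity n y m x s =
      ∑ i ∈ Finset.range n, m i * cellMean y i θ t := by
  refine (integral_mul_stepFun (hθ.comp (h.continuous_flow_space hst)) (h.ord s) _).trans ?_
  refine Finset.sum_congr rfl fun i hi => ?_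
  have hi' := Finset.mem_range.1 hi
  have h1 := integral_cell_comp (h.ord s) (h.collapseCompat hst) 1 hi' (fun _ z => θ z)
  simp only [Function.comp_apply, pathFlow]
  rw [h1]
  rcases eq_or_ne (y (i + 1) s) (y i s) with h0 | h0
  · rw [hm i hi' s h0]; simp
  · rw [← mul_assoc, div_mul_cancel₀ _ (sub_ne_zero.2 h0)]
    rfl

/-- The hypothesis `hm` excludes collapsed cells with mass, which `pathDensity` does not see. -/
lemma integral_mul_density (h : PathSystem n y E T L C) {m : ℕ → ℝ}
    (hm : ∀ i < n, ∀ t, y (i + 1) t = y i t → m i = 0) (t : ℝ) {θ : ℝ → ℝ}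
    (hθ : Continuous θ) :
    ∫ x, θ x * pathDensity n y m x t = ∑ i ∈ Finset.range n, m i * cellMean y i θ t := by
  simpa [h.flow_self] using h.integral_comp_flow_mul_density hm (le_refl t) hθ

/-- The expansion of the field, transported by the flow: each cell contributes the growth rate of its
length times a mean value. -/
lemma integral_comp_flow_mul_fieldDeriv (h : PathSystem n y E T L C) {s t : ℝ} (hst : s ≤ t)
    (hs : s ∉ E) {θ : ℝ → ℝ} (hθ : Continuous θ) :
    ∫ x, θ (pathFlow n y t x s) * pathFieldDeriv n y x s =
      ∑ i ∈ Finset.range n, (deriv (y (i + 1)) s - deriv (y i) s) * cellMean y i θ t := by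
  refine (integral_mul_stepFun (hθ.comp (h.continuous_flow_space hst)) (h.ord s) _).trans ?_
  refine Finset.sum_congr rfl fun i hi => ?_
  have hi' := Finset.mem_range.1 hi
  have h1 := integral_cell_comp (h.ord s) (h.collapseCompat hst) 1 hi' (fun _ z => θ z)
  simp only [Function.comp_apply, pathFlow]
  rw [h1, ← mul_assoc, h.gap_deriv_eq hs hi']
  rfl

lemma hasCompactSupport_comp_flow (h : PathSystem n y E T L C) {θ : ℝ → ℝ}
    (hθ : HasCompactSupport θ) (s t : ℝ) : HasCompactSupport fun x => θ (pathFlow n y t x s) := by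
  obtain ⟨R, hR⟩ := hθ.isBounded.subset_closedBall 0
  refine HasCompactSupport.intro
    (isCompact_closedBall (0 : ℝ) (R + (1 + 2 * n) * (L * |t - s|))) fun x hx => ?_
  by_contra hne
  have h1 := hR (subset_tsupport θ hne)
  rw [mem_closedBall_zero_iff, Real.norm_eq_abs] at h1 hx
  have h2 := h.abs_flow_sub_self_le x s t
  rw [abs_sub_comm] at h2
  have h3 := abs_sub_abs_le_abs_sub x (pathFlow n y t x s)
  exact hx (by linarith)

lemma integrable_comp_flow (h : PathSystem n y E T L C) {θ : ℝ → ℝ} (hc : Continuous θ)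
    (hθ : HasCompactSupport θ) {s t : ℝ} (hst : s ≤ t) :
    Integrable fun x => θ (pathFlow n y t x s) :=
  (hc.comp (h.continuous_flow_space hst)).integrable_of_hasCompactSupport
    (h.hasCompactSupport_comp_flow hθ s t)

/-- Change of variables for the flow. On each cell the Jacobian is the ratio of the lengths of the cell
at the two times, which accounts for the difference of the two integrals. -/
lemma integral_comp_flow (h : PathSystem n y E T L C) {θ : ℝ → ℝ} (hc : Continuous θ)
    (hθ : HasCompactSupport θ) {s t : ℝ} (hst : s ≤ t) :
    ∫ x, θ x = (∫ x, θ (pathFlow n y t x s)) +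
      ∑ i ∈ Finset.range n, ((y (i + 1) t - y i t) - (y (i + 1) s - y i s)) *
        cellMean y i θ t := by
  have h1 := integral_comp_pwLinear (h.ord s) (h.collapseCompat hst)
    (h.integrable_comp_flow hc hθ hst)
  have h2 := integral_comp_pwLinear (h.ord t) (h.collapseCompat le_rfl)
    (h.integrable_comp_flow hc hθ (le_refl t))
  simp only [pwLinear_self (h.ord t)] at h2
  have h3 : ∫ x, θ (pathFlow n y t x s) =
      ∫ x, θ (pwLinear n (fun i => y i s) (fun i => y i t) 1 x) := rfl
  rw [h3, h1, h2]
  simp only [sub_mul (_ - _) (_ - _), Finset.sum_sub_distrib, cellMean]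
  ring

lemma integral_gap_deriv (h : PathSystem n y E T L C) {i : ℕ} (hi : i < n) (s t : ℝ) :
    IntervalIntegrable (fun r => deriv (y (i + 1)) r - deriv (y i) r) volume s t ∧
    ∫ r in s..t, (deriv (y (i + 1)) r - deriv (y i) r) =
      (y (i + 1) t - y i t) - (y (i + 1) s - y i s) := by
  have h1 := (h.lip (i + 1) hi).lipschitzOnWith (s := uIcc s t)
    |>.absolutelyContinuousOnInterval
  have h2 := (h.lip i hi.le).lipschitzOnWith (s := uIcc s t) |>.absolutelyContinuousOnInterval
  refine ⟨h1.intervalIntegrable_deriv.sub h2.intervalIntegrable_deriv, ?_⟩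
  rw [intervalIntegral.integral_sub h1.intervalIntegrable_deriv h2.intervalIntegrable_deriv,
    h1.integral_deriv_eq_sub, h2.integral_deriv_eq_sub]
  ring

/-- The pushforward formula. -/
theorem pushforward (h : PathSystem n y E T L C) {b : ℝ → ℝ → ℝ}
    (hb : ∀ t ∈ Ioo 0 T, t ∉ E → ∀ x, b x t = pathField n y x t) {m : ℕ → ℝ}
    (hm : ∀ i < n, ∀ t, y (i + 1) t = y i t → m i = 0) (k : ℝ) {s t : ℝ} (hs : 0 ≤ s)
    (hst : s ≤ t) (ht : t ≤ T) {θ : ℝ → ℝ} (hc : Continuous θ) (hθ : HasCompactSupport θ) :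
    ∫ x, θ x * (pathDensity n y m x t - k) =
      (∫ x, θ (pathFlow n y t x s) * (pathDensity n y m x s - k)) -
        k * ∫ r in s..t, ∫ x, θ (pathFlow n y t x r) * deriv (fun z => b z r) x := by
  have hint : ∫ r in s..t, ∫ x, θ (pathFlow n y t x r) * deriv (fun z => b z r) x =
      ∑ i ∈ Finset.range n, ((y (i + 1) t - y i t) - (y (i + 1) s - y i s)) *
        cellMean y i θ t := by
    have h1 : ∫ r in s..t, ∫ x, θ (pathFlow n y t x r) * deriv (fun z => b z r) x =
        ∫ r in s..t, ∑ i ∈ Finset.range n,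
          (deriv (y (i + 1)) r - deriv (y i) r) * cellMean y i θ t := by
      rw [intervalIntegral.integral_of_le hst, intervalIntegral.integral_of_le hst,
        integral_Ioc_eq_integral_Ioo, integral_Ioc_eq_integral_Ioo]
      refine integral_congr_ae ((ae_restrict_iff' measurableSet_Ioo).2 ?_)
      filter_upwards [h.ae_notMem] with r hr hrm
      rw [← h.integral_comp_flow_mul_fieldDeriv hrm.2.le hr hc]
      refine integral_congr_ae ?_
      filter_upwards [h.deriv_field_ae
        (hb r ⟨hs.trans_lt hrm.1, hrm.2.trans_le ht⟩ hr)] with x hx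
      rw [hx]
    rw [h1, intervalIntegral.integral_finsetSum fun i hi =>
      (h.integral_gap_deriv (Finset.mem_range.1 hi) s t).1.mul_const _]
    refine Finset.sum_congr rfl fun i hi => ?_
    rw [intervalIntegral.integral_mul_const, (h.integral_gap_deriv (Finset.mem_range.1 hi) s t).2]
  have hi1 : Integrable fun x => θ x * k := (hc.integrable_of_hasCompactSupport hθ).mul_const k
  have hi2 := (h.integrable_comp_flow hc hθ hst).mul_const k
  have hj1 : Integrable fun x => θ x * pathDensity n y m x t := integrable_mul_stepFun hc _ _ _
  have hj2 : Integrable fun x => θ (pathFlow n y t x s) * pathDensity n y m x s :=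
    integrable_mul_stepFun (hc.comp (h.continuous_flow_space hst)) _ _ _
  have e0 := h.integral_comp_flow hc hθ hst
  simp only [mul_sub]
  rw [integral_sub hj1 hi1, integral_sub hj2 hi2, hint, h.integral_mul_density hm t hc,
    h.integral_comp_flow_mul_density hm hst hc, integral_mul_const, integral_mul_const, e0]
  ring

end PathSystem

/-! ### Test functions and integrals depending on a parameter -/

lemma hasDerivAt_integral_of_lipschitz {Ψ : ℝ → ℝ → ℝ} {Ψ' : ℝ → ℝ} {K a b t : ℝ}
    (hc : ∀ τ, Continuous (Ψ τ))
    (hL : ∀ l ∈ uIcc a b, ∀ τ τ', |Ψ τ l - Ψ τ' l| ≤ K * |τ - τ'|) (hc' : Continuous Ψ')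
    (hd : ∀ l, HasDerivAt (fun τ => Ψ τ l) (Ψ' l) t) :
    HasDerivAt (fun τ => ∫ l in a..b, Ψ τ l) (∫ l in a..b, Ψ' l) t := by
  have hK : 0 ≤ K := by
    have := (abs_nonneg _).trans (hL a left_mem_uIcc 1 0)
    simpa using this
  refine (intervalIntegral.hasDerivAt_integral_of_dominated_loc_of_lip (s := univ)
    (bound := fun _ => K) Filter.univ_mem
    (.of_forall fun τ => (hc τ).aestronglyMeasurable) ((hc t).intervalIntegrable _ _)
    hc'.aestronglyMeasurable (.of_forall fun l hl => ?_) intervalIntegrable_const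
    (.of_forall fun l _ => hd l)).2
  refine LipschitzOnWith.of_dist_le_mul fun τ _ τ' _ => ?_
  simpa [Real.dist_eq, abs_of_nonneg hK] using hL l (uIoc_subset_uIcc hl) τ τ'

lemma lipschitzWith_integral_of_lipschitz {Ψ : ℝ → ℝ → ℝ} {K a b : ℝ}
    (hc : ∀ τ, Continuous (Ψ τ))
    (hL : ∀ l ∈ uIcc a b, ∀ τ τ', |Ψ τ l - Ψ τ' l| ≤ K * |τ - τ'|) :
    LipschitzWith (K * |b - a|).toNNReal (fun τ => ∫ l in a..b, Ψ τ l) := by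
  have hK : 0 ≤ K := by
    have := (abs_nonneg _).trans (hL a left_mem_uIcc 1 0)
    simpa using this
  refine LipschitzWith.of_dist_le_mul fun τ τ' => ?_
  rw [Real.dist_eq, ← intervalIntegral.integral_sub ((hc τ).intervalIntegrable _ _)
    ((hc τ').intervalIntegrable _ _), Real.coe_toNNReal _ (by positivity), Real.dist_eq]
  have := intervalIntegral.norm_integral_le_of_norm_le_const (C := K * |τ - τ'|) (a := a) (b := b)
    (f := fun l => Ψ τ l - Ψ τ' l) (fun l hl => hL l (uIoc_subset_uIcc hl) τ τ')
  rw [Real.norm_eq_abs] at this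
  linarith

namespace IsTestFunction

variable {T : ℝ} {φ : ℝ → ℝ → ℝ}

lemma hasFDerivAt (hφ : IsTestFunction T φ) (p : ℝ × ℝ) :
    HasFDerivAt (Function.uncurry φ) (fderiv ℝ (Function.uncurry φ) p) p :=
  (hφ.smooth.differentiable (by simp) p).hasFDerivAt

lemma continuous_fderiv_apply (hφ : IsTestFunction T φ) (v : ℝ × ℝ) :
    Continuous (fun p => fderiv ℝ (Function.uncurry φ) p v) :=
  (hφ.smooth.continuous_fderiv (by simp)).clm_apply continuous_const

/-- The chain rule along a path. -/
lemma hasDerivAt_comp (hφ : IsTestFunction T φ) {γ : ℝ → ℝ} {γ' t : ℝ} (hγ : HasDerivAt γ γ' t) :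
    HasDerivAt (fun τ => φ (γ τ) τ) (fderiv ℝ (Function.uncurry φ) (γ t, t) (0, 1) +
      γ' * fderiv ℝ (Function.uncurry φ) (γ t, t) (1, 0)) t := by
  have h := HasFDerivAt.comp_hasDerivAt (f := fun τ => (γ τ, τ)) t
    (hφ.hasFDerivAt (γ t, t)) (hγ.prodMk (hasDerivAt_id t))
  refine h.congr_deriv ?_
  rw [show ((γ', 1) : ℝ × ℝ) = (0, 1) + γ' • (1, 0) by simp, map_add, map_smul, smul_eq_mul]

lemma deriv_time (hφ : IsTestFunction T φ) (x t : ℝ) :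
    deriv (fun τ => φ x τ) t = fderiv ℝ (Function.uncurry φ) (x, t) (0, 1) := by
  have := hφ.hasDerivAt_comp (hasDerivAt_const t x)
  simpa using this.deriv

lemma hasDerivAt_space (hφ : IsTestFunction T φ) (x t : ℝ) :
    HasDerivAt (fun y => φ y t) (fderiv ℝ (Function.uncurry φ) (x, t) (1, 0)) x :=
  HasFDerivAt.comp_hasDerivAt (f := fun y => (y, t)) x (hφ.hasFDerivAt (x, t)) ((hasDerivAt_id x).prodMk (hasDerivAt_const x t))

lemma continuous_space (hφ : IsTestFunction T φ) (t : ℝ) : Continuous (fun x => φ x t) :=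
  hφ.smooth.continuous.comp (continuous_id.prodMk continuous_const)

lemma exists_lipschitz (hφ : IsTestFunction T φ) :
    ∃ K : ℝ≥0, LipschitzWith K (Function.uncurry φ) :=
  hφ.smooth.lipschitzWith_of_hasCompactSupport hφ.compact (by simp)

lemma eq_zero_of_le (hφ : IsTestFunction T φ) (x : ℝ) {t : ℝ} (ht : T ≤ t) : φ x t = 0 := by
  by_contra hne
  have : t < T := hφ.support (subset_tsupport (Function.uncurry φ)
    (show Function.uncurry φ (x, t) ≠ 0 from hne))
  linarith

lemma exists_radius (hφ : IsTestFunction T φ) :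
    ∃ R : ℝ, ∀ x t, R ≤ |x| → φ x t = 0 ∧
      ∀ v, fderiv ℝ (Function.uncurry φ) (x, t) v = 0 := by
  obtain ⟨R, hR⟩ := hφ.compact.isBounded.subset_closedBall 0
  refine ⟨|R| + 1, fun x t hx => ?_⟩
  have hn : (x, t) ∉ tsupport (Function.uncurry φ) := fun hm => by
    have h1 := hR hm
    rw [mem_closedBall_zero_iff, Prod.norm_def] at h1
    have h2 := (le_max_left ‖x‖ ‖t‖).trans h1
    rw [Real.norm_eq_abs] at h2
    linarith [le_abs_self R]
  refine ⟨image_eq_zero_of_notMem_tsupport (f := Function.uncurry φ) hn, fun v => ?_⟩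
  rw [fderiv_of_notMem_tsupport (𝕜 := ℝ) hn]; rfl

lemma hasCompactSupport_space (hφ : IsTestFunction T φ) (t : ℝ) :
    HasCompactSupport (fun x => φ x t) := by
  obtain ⟨R, hR⟩ := hφ.exists_radius
  refine HasCompactSupport.intro (isCompact_closedBall (0 : ℝ) R) fun x hx => ?_
  rw [mem_closedBall_zero_iff, Real.norm_eq_abs, not_le] at hx
  exact (hR x t hx.le).1

lemma hasCompactSupport_fderiv_space (hφ : IsTestFunction T φ) (t : ℝ) (v : ℝ × ℝ) :
    HasCompactSupport (fun x => fderiv ℝ (Function.uncurry φ) (x, t) v) := by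
  obtain ⟨R, hR⟩ := hφ.exists_radius
  refine HasCompactSupport.intro (isCompact_closedBall (0 : ℝ) R) fun x hx => ?_
  rw [mem_closedBall_zero_iff, Real.norm_eq_abs, not_le] at hx
  exact (hR x t hx.le).2 v

lemma continuous_fderiv_space (hφ : IsTestFunction T φ) (t : ℝ) (v : ℝ × ℝ) :
    Continuous (fun x => fderiv ℝ (Function.uncurry φ) (x, t) v) :=
  (hφ.continuous_fderiv_apply v).comp (continuous_id.prodMk continuous_const)

end IsTestFunction

lemma intervalIntegral_eq_integral_of_radius {g : ℝ → ℝ} {R : ℝ}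
    (hg : ∀ x, R ≤ |x| → g x = 0) : ∫ x in (-R)..R, g x = ∫ x, g x := by
  refine intervalIntegral.integral_eq_integral_of_support_subset fun x hx => ?_
  by_contra hn
  refine hx (hg x ?_)
  by_contra hlt
  have := abs_lt.1 (not_le.1 hlt)
  exact hn ⟨this.1, this.2.le⟩

/-- Integration by parts against a piecewise linear function. -/
lemma integral_pwLinear_mul_deriv {n : ℕ} {p : ℕ → ℝ} (hp : NodesOrdered n p) (z : ℕ → ℝ)
    {g g' : ℝ → ℝ}
    (hg : ∀ x, HasDerivAt g (g' x) x) (hg' : Continuous g') {R : ℝ}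
    (hgR : ∀ x, R ≤ |x| → g x = 0 ∧ g' x = 0) (hcont : Continuous (pwLinear n p z 0)) :
    ∫ x, pwLinear n p z 0 x * g' x =
      - ∫ x, g x * stepFun n p (fun k => (z (k + 1) - z k) / (p (k + 1) - p k)) x := by
  set d := stepFun n p (fun k => (z (k + 1) - z k) / (p (k + 1) - p k)) with hd
  have hgc : Continuous g := continuous_iff_continuousAt.2 fun x => (hg x).continuousAt
  have i1 : IntervalIntegrable (fun x => g x * d x) volume (-R) R :=
    (integrable_mul_stepFun hgc n p _).intervalIntegrable
  have i2 : IntervalIntegrable (fun x => pwLinear n p z 0 x * g' x) volume (-R) R :=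
    (hcont.mul hg').intervalIntegrable _ _
  have key := integral_eq_of_hasDerivAt_off_countable
    (fun x => pwLinear n p z 0 x * g x) (fun x => g x * d x + pwLinear n p z 0 x * g' x)
    (a := -R) (b := R) (s := p '' Iic n) ((finite_Iic n).image p).countable
    (hcont.mul hgc).continuousOn (fun x hx => ?_) (i1.add i2)
  · rw [intervalIntegral.integral_add i1 i2, (hgR R (le_abs_self R)).1,
      (hgR (-R) (by rw [abs_neg]; exact le_abs_self R)).1,
      intervalIntegral_eq_integral_of_radius, intervalIntegral_eq_integral_of_radius] at key
    · linarith
    · intro x hx; rw [(hgR x hx).2, mul_zero]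
    · intro x hx; rw [(hgR x hx).1, zero_mul]
  · have h1 := hasDerivAt_pwLinear_space hp z (x := x) fun i hi he => hx.2 ⟨i, hi, he.symm⟩
    refine (h1.fun_mul (hg x)).congr_deriv ?_
    rw [mul_comm (g x)]

namespace PathSystem

variable {n : ℕ} {y : ℕ → ℝ → ℝ} {E : Set ℝ} {T : ℝ} {L : ℝ≥0} {C : ℝ}

/-! ### The density as a weak solution -/

lemma _root_.continuous_pathField (n : ℕ) (y : ℕ → ℝ → ℝ) (t : ℝ) :
    Continuous (fun x => pathField n y x t) := by
  unfold pathField pwLinear trunc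
  fun_prop

/-- The field is linear in the parameter of a cell, so that points with a fixed parameter move along
the field. -/
lemma field_cell (h : PathSystem n y E T L C) {t : ℝ} (ht : t ∉ E) {i : ℕ} (hi : i < n) {l : ℝ}
    (hl : l ∈ Icc (0 : ℝ) 1) :
    pathField n y (y i t + (y (i + 1) t - y i t) * l) t =
      deriv (y i) t + (deriv (y (i + 1)) t - deriv (y i) t) * l := by
  have hg := h.gap_nonneg hi t
  rw [pathField, pwLinear_cell (h.ord t) (h.collapseCompat_deriv ht) 0 hi (by nlinarith [hl.1])
    (by nlinarith [hl.2]), add_sub_cancel_left, ← mul_assoc, h.gap_deriv_eq ht hi]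

/-- The mean value of a test function over a moving cell is Lipschitz in time, and its derivative is
the mean value of the material derivative. -/
lemma cellMean_test (h : PathSystem n y E T L C) {φ : ℝ → ℝ → ℝ} (hφ : IsTestFunction T φ) {i : ℕ}
    (hi : i < n) :
    (∃ K, LipschitzWith K (fun t => cellMean y i (fun x => φ x t) t)) ∧
    ∀ t ∉ E, HasDerivAt (fun t => cellMean y i (fun x => φ x t) t)
      (cellMean y i (fun x => fderiv ℝ (Function.uncurry φ) (x, t) (0, 1) +
        pathField n y x t * fderiv ℝ (Function.uncurry φ) (x, t) (1, 0)) t) t := by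
  obtain ⟨K, hK⟩ := hφ.exists_lipschitz
  have hc : ∀ τ, Continuous (fun l => φ (y i τ + (y (i + 1) τ - y i τ) * l) τ) := fun τ =>
    (hφ.continuous_space τ).comp (by fun_prop)
  have hL : ∀ l ∈ uIcc (0 : ℝ) 1, ∀ τ τ', |φ (y i τ + (y (i + 1) τ - y i τ) * l) τ -
      φ (y i τ' + (y (i + 1) τ' - y i τ') * l) τ'| ≤ (K * (2 * L + 1)) * |τ - τ'| := by
    intro l hl τ τ'
    rw [uIcc_of_le zero_le_one] at hl
    have h1 := hK.dist_le_mul (y i τ + (y (i + 1) τ - y i τ) * l, τ)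
      (y i τ' + (y (i + 1) τ' - y i τ') * l, τ')
    rw [Prod.dist_eq, Real.dist_eq, Real.dist_eq, Real.dist_eq] at h1
    refine h1.trans ?_
    rw [mul_assoc]
    refine mul_le_mul_of_nonneg_left (max_le ?_ ?_) K.2
    · have a1 := h.abs_sub_le hi.le τ τ'
      have a2 := h.abs_sub_le (show i + 1 ≤ n from hi) τ τ'
      simp only
      rw [show y i τ + (y (i + 1) τ - y i τ) * l - (y i τ' + (y (i + 1) τ' - y i τ') * l) =
        (1 - l) * (y i τ - y i τ') + l * (y (i + 1) τ - y (i + 1) τ') by ring]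
      refine (abs_add_le _ _).trans ?_
      rw [abs_mul, abs_mul, abs_of_nonneg hl.1, abs_of_nonneg (sub_nonneg.2 hl.2)]
      have := abs_nonneg (τ - τ')
      nlinarith [hl.1, hl.2, abs_nonneg (y i τ - y i τ'), abs_nonneg (y (i + 1) τ - y (i + 1) τ'),
        L.2]
    · have := abs_nonneg (τ - τ')
      have : 0 ≤ (L : ℝ) * |τ - τ'| := mul_nonneg L.2 this
      simp only
      linarith
  refine ⟨⟨_, lipschitzWith_integral_of_lipschitz hc hL⟩, fun t ht => ?_⟩
  refine (hasDerivAt_integral_of_lipschitz hc hL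
    (Ψ' := fun l => fderiv ℝ (Function.uncurry φ) (y i t + (y (i + 1) t - y i t) * l, t) (0, 1) +
      (deriv (y i) t + (deriv (y (i + 1)) t - deriv (y i) t) * l) *
      fderiv ℝ (Function.uncurry φ) (y i t + (y (i + 1) t - y i t) * l, t) (1, 0))
    ?_ fun l => ?_).congr_deriv ?_
  · exact ((hφ.continuous_fderiv_space t _).comp (by fun_prop)).add ((by fun_prop : Continuous
      fun l => deriv (y i) t + (deriv (y (i + 1)) t - deriv (y i) t) * l).mul
        ((hφ.continuous_fderiv_space t _).comp (by fun_prop)))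
  · exact hφ.hasDerivAt_comp ((h.diff i hi.le t ht).hasDerivAt.add
      ((h.hasDerivAt_gap hi ht).mul_const l))
  · refine intervalIntegral.integral_congr fun l hl => ?_
    rw [uIcc_of_le zero_le_one] at hl
    simp only
    rw [h.field_cell ht hi hl]

lemma _root_.IsTestFunction.integral_test {φ : ℝ → ℝ → ℝ} (hφ : IsTestFunction T φ) :
    (∃ K, LipschitzWith K (fun t => ∫ x, φ x t)) ∧
    ∀ t, HasDerivAt (fun t => ∫ x, φ x t)
      (∫ x, fderiv ℝ (Function.uncurry φ) (x, t) (0, 1)) t := by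
  obtain ⟨K, hK⟩ := hφ.exists_lipschitz
  obtain ⟨R, hR⟩ := hφ.exists_radius
  have hL : ∀ l ∈ uIcc (-R) R, ∀ τ τ', |φ l τ - φ l τ'| ≤ K * |τ - τ'| := by
    intro l _ τ τ'
    have h1 := hK.dist_le_mul (l, τ) (l, τ')
    rw [Prod.dist_eq, Real.dist_eq, Real.dist_eq, Real.dist_eq] at h1
    simpa using h1
  have e : (fun t => ∫ x, φ x t) = fun t => ∫ x in (-R)..R, φ x t := by
    ext t
    exact (intervalIntegral_eq_integral_of_radius fun x hx => (hR x t hx).1).symm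
  rw [e]
  refine ⟨⟨_, lipschitzWith_integral_of_lipschitz hφ.continuous_space hL⟩, fun t => ?_⟩
  rw [← intervalIntegral_eq_integral_of_radius fun x hx => (hR x t hx).2 (0, 1)]
  refine hasDerivAt_integral_of_lipschitz (Ψ := fun τ x => φ x τ) hφ.continuous_space hL
    (hφ.continuous_fderiv_space t _) fun l => ?_
  simpa using hφ.hasDerivAt_comp (hasDerivAt_const t l)

lemma test_eq (h : PathSystem n y E T L C) {m : ℕ → ℝ}
    (hm : ∀ i < n, ∀ t, y (i + 1) t = y i t → m i = 0) {φ : ℝ → ℝ → ℝ} (hφ : IsTestFunction T φ)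
    (k : ℝ) {t : ℝ} (ht : t ∉ E) :
    ∫ x, (fderiv ℝ (Function.uncurry φ) (x, t) (0, 1) +
        pathField n y x t * fderiv ℝ (Function.uncurry φ) (x, t) (1, 0)) *
        (pathDensity n y m x t - k) =
      (∑ i ∈ Finset.range n, m i *
        cellMean y i (fun x => fderiv ℝ (Function.uncurry φ) (x, t) (0, 1) +
        pathField n y x t * fderiv ℝ (Function.uncurry φ) (x, t) (1, 0)) t) -
      k * (∫ x, fderiv ℝ (Function.uncurry φ) (x, t) (0, 1)) +
      k * ∑ i ∈ Finset.range n, (deriv (y (i + 1)) t - deriv (y i) t) *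
        cellMean y i (fun x => φ x t) t := by
  obtain ⟨R, hR⟩ := hφ.exists_radius
  have c1 := hφ.continuous_fderiv_space t (0, 1)
  have c2 := (continuous_pathField n y t).mul (hφ.continuous_fderiv_space t (1, 0))
  have s1 := c1.integrable_of_hasCompactSupport (μ := volume)
    (hφ.hasCompactSupport_fderiv_space t (0, 1))
  have s2 := c2.integrable_of_hasCompactSupport (μ := volume)
    (hφ.hasCompactSupport_fderiv_space t (1, 0)).mul_left
  have c3 : Continuous fun x => fderiv ℝ (Function.uncurry φ) (x, t) (0, 1) +
      pathField n y x t * fderiv ℝ (Function.uncurry φ) (x, t) (1, 0) := c1.add c2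
  have e1 := h.integral_mul_density hm t c3
  have i1 : Integrable fun x => (fderiv ℝ (Function.uncurry φ) (x, t) (0, 1) +
      pathField n y x t * fderiv ℝ (Function.uncurry φ) (x, t) (1, 0)) *
      pathDensity n y m x t := integrable_mul_stepFun c3 _ _ _
  have i2 : Integrable fun x => (fderiv ℝ (Function.uncurry φ) (x, t) (0, 1) +
      pathField n y x t * fderiv ℝ (Function.uncurry φ) (x, t) (1, 0)) * k :=
    (s1.add s2).mul_const k
  have e4 : ∫ x, (fderiv ℝ (Function.uncurry φ) (x, t) (0, 1) +
      pathField n y x t * fderiv ℝ (Function.uncurry φ) (x, t) (1, 0)) =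
      (∫ x, fderiv ℝ (Function.uncurry φ) (x, t) (0, 1)) +
      ∫ x, pathField n y x t * fderiv ℝ (Function.uncurry φ) (x, t) (1, 0) :=
    integral_add s1 s2
  have e2 := integral_pwLinear_mul_deriv (h.ord t) (fun i => deriv (y i) t)
    (fun x => hφ.hasDerivAt_space x t) (hφ.continuous_fderiv_space t (1, 0))
    (fun x hx => ⟨(hR x t hx).1, (hR x t hx).2 _⟩) (continuous_pathField n y t)
  have e3 := h.integral_comp_flow_mul_fieldDeriv (le_refl t) ht (hφ.continuous_space t)
  simp only [h.flow_self] at e3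
  have e2' : ∫ x, pathField n y x t * fderiv ℝ (Function.uncurry φ) (x, t) (1, 0) =
    - ∫ x, φ x t * pathFieldDeriv n y x t := e2
  simp only [mul_sub]
  rw [integral_sub i1 i2, integral_mul_const, e1, e4, e2', e3]
  ring

/-- The weak formulation is the integral over `[0, T]` of the derivative of
`∑ i, m i * cellMean y i φ - k * ∫ φ`, which vanishes at `T` by the choice of the test functions. -/
theorem weak_formulation (h : PathSystem n y E T L C) {b v : ℝ → ℝ → ℝ}
    (hb : ∀ t ∈ Ioo 0 T, t ∉ E → ∀ x, b x t = pathField n y x t) {m : ℕ → ℝ}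
    (hm : ∀ i < n, ∀ t, y (i + 1) t = y i t → m i = 0)
    (hv : ∀ t ∈ Ioo 0 T, t ∉ E → ∀ x, v x t = pathDensity n y m x t) (k : ℝ)
    {φ : ℝ → ℝ → ℝ} (hφ : IsTestFunction T φ) :
    (∫ t in (0 : ℝ)..T, ∫ x,
        (deriv (fun τ => φ x τ) t + b x t * deriv (fun y => φ y t) x) * (v x t - k)) +
      (∫ t in (0 : ℝ)..T, ∫ x, φ x t * (-k * deriv (fun z => b z t) x)) +
      ∫ x, (pathDensity n y m x 0 - k) * φ x 0 = 0 := by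
  set H : ℝ → ℝ := fun t => (∑ i ∈ Finset.range n, m i * cellMean y i (fun x => φ x t) t) -
    k * ∫ x, φ x t with hH
  set J : ℝ → ℝ := fun t => k * ∑ i ∈ Finset.range n, (deriv (y (i + 1)) t - deriv (y i) t) *
        cellMean y i (fun x => φ x t) t with hJ
  have iJ : IntervalIntegrable J volume 0 T := by
    refine IntervalIntegrable.const_mul ?_ k
    have hsum : IntervalIntegrable (∑ i ∈ Finset.range n, fun t =>
        (deriv (y (i + 1)) t - deriv (y i) t) * cellMean y i (fun x => φ x t) t) volume 0 T := ?_
    · simpa only [Finset.sum_fn] using hsum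
    refine IntervalIntegrable.sum _ fun i hi => ?_
    obtain ⟨K, hK⟩ := (h.cellMean_test hφ (Finset.mem_range.1 hi)).1
    exact (h.integral_gap_deriv (Finset.mem_range.1 hi) 0 T).1.mul_continuousOn
      hK.continuous.continuousOn
  have acH : AbsolutelyContinuousOnInterval H 0 T := by
    obtain ⟨K, hK⟩ := (hφ.integral_test).1
    have hs : ∀ s ⊆ Finset.range n, AbsolutelyContinuousOnInterval
        (fun t => ∑ i ∈ s, m i * cellMean y i (fun x => φ x t) t) 0 T := by
      intro s hs
      induction s using Finset.induction_on with
      | empty =>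
        simpa using ((LipschitzWith.const (0 : ℝ)).lipschitzOnWith
          (s := uIcc 0 T)).absolutelyContinuousOnInterval
      | insert i s his ih =>
        simp only [Finset.sum_insert his]
        obtain ⟨K', hK'⟩ := (h.cellMean_test hφ
          (Finset.mem_range.1 (hs (Finset.mem_insert_self i s)))).1
        exact (hK'.lipschitzOnWith.absolutelyContinuousOnInterval.const_mul (m i)).fun_add
          (ih fun j hj => hs (Finset.mem_insert_of_mem hj))
    exact (hs _ le_rfl).fun_sub
      (hK.lipschitzOnWith.absolutelyContinuousOnInterval.const_mul k)
  have e1 : ∫ t in (0 : ℝ)..T, ∫ x,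
        (deriv (fun τ => φ x τ) t + b x t * deriv (fun y => φ y t) x) * (v x t - k) =
      ∫ t in (0 : ℝ)..T, (deriv H t + J t) := by
    rw [intervalIntegral.integral_of_le h.pos.le, intervalIntegral.integral_of_le h.pos.le,
        integral_Ioc_eq_integral_Ioo, integral_Ioc_eq_integral_Ioo]
    refine integral_congr_ae ((ae_restrict_iff' measurableSet_Ioo).2 ?_)
    filter_upwards [h.ae_notMem] with t ht htm
    simp only [hb t htm ht, hv t htm ht, hφ.deriv_time, (hφ.hasDerivAt_space _ _).deriv]
    rw [h.test_eq hm hφ k ht]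
    congr 1
    have hd := HasDerivAt.fun_sum (u := Finset.range n) (fun i hi =>
      ((h.cellMean_test hφ (Finset.mem_range.1 hi)).2 t ht).const_mul (m i))
    exact (hd.fun_sub (((hφ.integral_test).2 t).const_mul k)).deriv.symm
  have e2 : ∫ t in (0 : ℝ)..T, ∫ x, φ x t * (-k * deriv (fun z => b z t) x) =
      ∫ t in (0 : ℝ)..T, - J t := by
    rw [intervalIntegral.integral_of_le h.pos.le, intervalIntegral.integral_of_le h.pos.le,
        integral_Ioc_eq_integral_Ioo, integral_Ioc_eq_integral_Ioo]
    refine integral_congr_ae ((ae_restrict_iff' measurableSet_Ioo).2 ?_)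
    filter_upwards [h.ae_notMem] with t ht htm
    have e3 := h.integral_comp_flow_mul_fieldDeriv (le_refl t) ht (hφ.continuous_space t)
    simp only [h.flow_self] at e3
    rw [hJ, ← neg_mul, ← e3, ← integral_const_mul]
    refine integral_congr_ae ?_
    filter_upwards [h.deriv_field_ae (hb t htm ht)] with x hx
    rw [hx]; ring
  have e4 : ∫ x, (pathDensity n y m x 0 - k) * φ x 0 = H 0 := by
    simp only [hH, mul_comm _ (φ _ 0), mul_sub]
    have i1 : Integrable fun x => φ x 0 * pathDensity n y m x 0 :=
      integrable_mul_stepFun (hφ.continuous_space 0) _ _ _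
    rw [integral_sub i1
      (((hφ.continuous_space 0).integrable_of_hasCompactSupport
        (hφ.hasCompactSupport_space 0)).mul_const k),
      h.integral_mul_density hm 0 (hφ.continuous_space 0), integral_mul_const, mul_comm k]
  have e5 : H T = 0 := by
    simp [hH, cellMean, hφ.eq_zero_of_le _ le_rfl]
  rw [e1, e2, e4, intervalIntegral.integral_add acH.intervalIntegrable_deriv iJ,
    acH.integral_deriv_eq_sub, intervalIntegral.integral_neg, e5]
  ring

end PathSystem

/-! ### Mollification of Lipschitz functions -/

section Mollify

open Filter Convolution Pointwise

variable {G : Type*} [NormedAddCommGroup G] [NormedSpace ℝ G] [FiniteDimensional ℝ G]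
  [MeasurableSpace G] [BorelSpace G] (μ : Measure G) [μ.IsAddHaarMeasure]

/-- The derivative of the mollification of a Lipschitz function is the mollification of its almost
everywhere derivative. -/
lemma LipschitzWith.fderiv_mollify {Φ : G → ℝ} {K : ℝ≥0} (hΦ : LipschitzWith K Φ)
    (η : ContDiffBump (0 : G)) (p v : G) :
    fderiv ℝ (η.normed μ ⋆[ContinuousLinearMap.lsmul ℝ ℝ, μ] Φ) p v =
      (η.normed μ ⋆[ContinuousLinearMap.lsmul ℝ ℝ, μ] fun q => fderiv ℝ Φ q v) p := by
  have hη : Continuous (η.normed μ) := η.continuous_normed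
  have hηc : HasCompactSupport (η.normed μ) := η.hasCompactSupport_normed
  have hsm : ContDiff ℝ 1 (η.normed μ ⋆[ContinuousLinearMap.lsmul ℝ ℝ, μ] Φ) :=
    hηc.contDiff_convolution_left _ (η.contDiff_normed (n := 1))
      hΦ.continuous.locallyIntegrable
  have h1 : HasDerivAt (fun h : ℝ => (η.normed μ ⋆[ContinuousLinearMap.lsmul ℝ ℝ, μ] Φ) (p + h • v))
      (fderiv ℝ (η.normed μ ⋆[ContinuousLinearMap.lsmul ℝ ℝ, μ] Φ) p v) 0 :=
    ((hsm.differentiable (by simp) p).hasFDerivAt.hasLineDerivAt v)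
  have h2 : HasDerivAt (fun h : ℝ => ∫ q, η.normed μ q * Φ (p + h • v - q) ∂μ)
      (∫ q, η.normed μ q * fderiv ℝ Φ (p - q) v ∂μ) 0 := by
    refine (hasDerivAt_integral_of_dominated_loc_of_lip (s := univ)
      (bound := fun q => η.normed μ q * (K * ‖v‖)) univ_mem
      (.of_forall fun h => ?_) ?_ ?_ (.of_forall fun q => ?_) ?_ ?_).2
    · exact (hη.mul (hΦ.continuous.comp (by fun_prop))).aestronglyMeasurable
    · exact (hη.mul (hΦ.continuous.comp (by fun_prop))).integrable_of_hasCompactSupport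
        hηc.mul_right
    · exact (hη.measurable.mul ((measurable_fderiv_apply_const ℝ Φ v).comp
        (measurable_const.sub measurable_id))).aestronglyMeasurable
    · refine LipschitzOnWith.of_dist_le_mul fun h _ h' _ => ?_
      have h0 := η.nonneg_normed (μ := μ) q
      have hd := hΦ.dist_le_mul (p + h • v - q) (p + h' • v - q)
      rw [dist_sub_right, dist_add_left, dist_eq_norm (h • v), ← sub_smul, norm_smul] at hd
      rw [Real.dist_eq, ← mul_sub, abs_mul, abs_of_nonneg h0, Real.coe_nnabs,
        abs_of_nonneg (mul_nonneg h0 (by positivity)), mul_assoc]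
      refine mul_le_mul_of_nonneg_left ?_ h0
      rw [Real.dist_eq] at hd ⊢
      rw [Real.norm_eq_abs] at hd
      linarith
    · exact (η.integrable_normed (μ := μ)).mul_const _
    · have hq : ∀ᵐ q ∂μ, DifferentiableAt ℝ Φ (p - q) :=
        (Measure.measurePreserving_sub_left μ p).quasiMeasurePreserving.ae hΦ.ae_differentiableAt
      filter_upwards [hq] with q hq
      have h3 : HasDerivAt (fun h : ℝ => Φ (p - q + h • v)) (fderiv ℝ Φ (p - q) v) 0 :=
        hq.hasFDerivAt.hasLineDerivAt v
      have h4 := h3.const_mul (η.normed μ q)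
      refine h4.congr_of_eventuallyEq (.of_forall fun h => ?_)
      simp only
      rw [add_sub_right_comm]
  exact h1.unique h2

/-- A Lipschitz function of compact support is approximated by smooth ones with uniformly bounded and
almost everywhere converging derivatives. -/
theorem LipschitzWith.exists_smooth_approx {Φ : G → ℝ} {K : ℝ≥0} (hΦ : LipschitzWith K Φ)
    (hc : HasCompactSupport Φ) :
    ∃ Ψ : ℕ → G → ℝ, (∀ k, ContDiff ℝ (⊤ : ℕ∞) (Ψ k)) ∧
      (∀ k, tsupport (Ψ k) ⊆ Metric.cthickening (1 / ((k : ℝ) + 1)) (tsupport Φ)) ∧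
      (∀ k p v, |fderiv ℝ (Ψ k) p v| ≤ K * ‖v‖) ∧
      ∀ v, ∀ᵐ p ∂μ, Tendsto (fun k => fderiv ℝ (Ψ k) p v) atTop (𝓝 (fderiv ℝ Φ p v)) := by
  have hpos : ∀ k : ℕ, (0 : ℝ) < 1 / ((k : ℝ) + 1) := fun k => Nat.one_div_pos_of_nat
  set η : ℕ → ContDiffBump (0 : G) := fun k =>
    ⟨1 / ((k : ℝ) + 1) / 2, 1 / ((k : ℝ) + 1), half_pos (hpos k), half_lt_self (hpos k)⟩ with hη
  have hb : ∀ v p, |fderiv ℝ Φ p v| ≤ K * ‖v‖ := fun v p =>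
    ((fderiv ℝ Φ p).le_opNorm v).trans
      (mul_le_mul_of_nonneg_right (norm_fderiv_le_of_lipschitz ℝ hΦ) (norm_nonneg v))
  refine ⟨fun k => (η k).normed μ ⋆[ContinuousLinearMap.lsmul ℝ ℝ, μ] Φ, fun k => ?_, fun k => ?_,
    fun k p v => ?_, fun v => ?_⟩
  · exact (η k).hasCompactSupport_normed.contDiff_convolution_left _
      ((η k).contDiff_normed (n := ⊤)) hΦ.continuous.locallyIntegrable
  · rw [← IsCompact.add_closedBall_zero hc (hpos k).le]
    refine closure_minimal ?_
      (IsCompact.add hc (isCompact_closedBall (0 : G) _)).isClosed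
    refine (support_convolution_subset (ContinuousLinearMap.lsmul ℝ ℝ)).trans ?_
    rw [(η k).support_normed_eq, add_comm (Metric.ball _ _)]
    exact add_subset_add (subset_tsupport Φ) Metric.ball_subset_closedBall
  · rw [hΦ.fderiv_mollify μ, convolution_def]
    have := norm_integral_le_of_norm_le (μ := μ)
      (f := fun q => (η k).normed μ q * fderiv ℝ Φ (p - q) v)
      (g := fun q => (η k).normed μ q * (K * ‖v‖))
      ((η k).integrable_normed.mul_const _) (.of_forall fun q => by
        have h0 := (η k).nonneg_normed (μ := μ) q
        rw [norm_mul, Real.norm_eq_abs, abs_of_nonneg h0, Real.norm_eq_abs]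
        exact mul_le_mul_of_nonneg_left (hb v _) h0)
    rw [integral_mul_const, (η k).integral_normed, one_mul] at this
    exact this
  · have hloc : LocallyIntegrable (fun p => fderiv ℝ Φ p v) μ :=
      MemLp.locallyIntegrable (p := ⊤) (memLp_top_of_bound
        (measurable_fderiv_apply_const ℝ Φ v).aestronglyMeasurable (K * ‖v‖)
        (.of_forall fun p => hb v p)) le_top
    have ht : Tendsto (fun k => (η k).rOut) atTop (𝓝 0) :=
      tendsto_one_div_add_atTop_nhds_zero_nat
    filter_upwards [ContDiffBump.ae_convolution_tendsto_right_of_locallyIntegrable (K := 2) ht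
      (.of_forall fun k => by simp only [hη]; linarith) hloc] with p hp
    simpa only [hΦ.fderiv_mollify μ] using hp

end Mollify

/-! ### The space-time strip -/

lemma stripMeasure_eq_prod (T : ℝ) :
    stripMeasure T = (volume : Measure ℝ).prod (volume.restrict (Ioo 0 T)) := by
  rw [stripMeasure, Measure.volume_eq_prod, ← Measure.prod_restrict, Measure.restrict_univ]

lemma integral_stripMeasure {T : ℝ} (hT : 0 ≤ T) {F : ℝ × ℝ → ℝ}
    (hF : Integrable F (stripMeasure T)) :
    ∫ t in (0 : ℝ)..T, ∫ x, F (x, t) = ∫ p, F p ∂stripMeasure T := by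
  rw [stripMeasure_eq_prod] at hF ⊢
  rw [integral_prod_symm F hF, intervalIntegral.integral_of_le hT, integral_Ioc_eq_integral_Ioo]

lemma ae_stripMeasure_mem (T : ℝ) : ∀ᵐ p ∂stripMeasure T, p.2 ∈ Ioo 0 T := by
  filter_upwards [ae_restrict_mem (μ := (volume : Measure (ℝ × ℝ)))
    (MeasurableSet.univ.prod (measurableSet_Ioo (a := (0 : ℝ)) (b := T)))] with p hp
  exact hp.2

lemma ae_stripMeasure_of_ae {T : ℝ} {P : ℝ × ℝ → Prop} (h : ∀ᵐ p, P p) :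
    ∀ᵐ p ∂stripMeasure T, P p := ae_restrict_of_ae h

lemma ae_stripMeasure_of_ae_time {T : ℝ} {P : ℝ → Prop} (h : ∀ᵐ t, P t) :
    ∀ᵐ p ∂stripMeasure T, P p.2 := by
  refine ae_stripMeasure_of_ae ?_
  rw [Measure.volume_eq_prod]
  exact Measure.quasiMeasurePreserving_snd.ae h

/-- The graph of a path is a null set. -/
lemma ae_ne_path {γ : ℝ → ℝ} (hγ : Continuous γ) : ∀ᵐ p : ℝ × ℝ, p.1 ≠ γ p.2 := by
  have hm : MeasurableSet {q : ℝ × ℝ | q.2 ≠ γ q.1} :=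
    (isClosed_eq continuous_snd (hγ.comp continuous_fst)).measurableSet.compl
  have h : ∀ᵐ q ∂((volume : Measure ℝ).prod (volume : Measure ℝ)), q.2 ≠ γ q.1 := by
    rw [Measure.ae_prod_iff_ae_ae hm]
    refine .of_forall fun t => ?_
    exact (countable_singleton (γ t)).ae_notMem volume
  rw [Measure.volume_eq_prod]
  exact (Measure.measurePreserving_swap (μ := (volume : Measure ℝ))
    (ν := (volume : Measure ℝ))).quasiMeasurePreserving.ae h

lemma measurable_stepFun {n : ℕ} {y c : ℕ → ℝ → ℝ} (hy : ∀ i ≤ n, Measurable (y i))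
    (hc : ∀ i < n, Measurable (c i)) :
    Measurable fun p : ℝ × ℝ => stepFun n (fun i => y i p.2) (fun i => c i p.2) p.1 := by
  unfold stepFun
  refine Finset.measurable_fun_sum _ fun i hi => ?_
  have hi' := Finset.mem_range.1 hi
  have hs : MeasurableSet {p : ℝ × ℝ | p.1 ∈ Ioo (y i p.2) (y (i + 1) p.2)} :=
    (measurableSet_lt ((hy i hi'.le).comp measurable_snd) measurable_fst).inter
      (measurableSet_lt measurable_fst ((hy (i + 1) hi').comp measurable_snd))
  exact ((hc i hi').comp measurable_snd).indicator hs

/-! ### Uniqueness of weak solutions by duality -/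

/-- A weak formulation for test functions extends to Lipschitz functions of compact support. -/
lemma integral_lipschitz_test {T : ℝ} {b : ℝ → ℝ → ℝ} {u : ℝ × ℝ → ℝ}
    (hb : MemLp (Function.uncurry b) ⊤ (stripMeasure T)) (hu : MemLp u ⊤ (stripMeasure T))
    (hw : ∀ φ, IsTestFunction T φ → ∫ p, (fderiv ℝ (Function.uncurry φ) p (0, 1) +
      b p.1 p.2 * fderiv ℝ (Function.uncurry φ) p (1, 0)) * u p ∂stripMeasure T = 0)
    {Φ : ℝ × ℝ → ℝ} {K : ℝ≥0} (hΦ : LipschitzWith K Φ) (hc : HasCompactSupport Φ)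
    (hs : tsupport Φ ⊆ {p | p.2 < T}) :
    ∫ p, (fderiv ℝ Φ p (0, 1) + b p.1 p.2 * fderiv ℝ Φ p (1, 0)) * u p ∂stripMeasure T = 0 := by
  obtain ⟨Ψ, h1, h2, h3, h4⟩ := hΦ.exists_smooth_approx (volume : Measure (ℝ × ℝ)) hc
  set S := Metric.cthickening 1 (tsupport Φ) with hS
  have hSc : IsCompact S := IsCompact.cthickening hc
  have hsub : ∀ k, tsupport (Ψ k) ⊆ S := fun k => (h2 k).trans
    (Metric.cthickening_mono (by
      rw [div_le_one (by positivity)]; linarith [(Nat.cast_nonneg k : (0 : ℝ) ≤ k)]) _)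
  have hmeas : ∀ (F : ℝ × ℝ → ℝ), AEStronglyMeasurable
      (fun p => (fderiv ℝ F p (0, 1) + b p.1 p.2 * fderiv ℝ F p (1, 0)) * u p)
      (stripMeasure T) := fun F =>
    ((measurable_fderiv_apply_const ℝ F (0, 1)).aestronglyMeasurable.add
      (hb.1.mul (measurable_fderiv_apply_const ℝ F (1, 0)).aestronglyMeasurable)).mul hu.1
  have hSi : Integrable (S.indicator fun _ => (K : ℝ)) (stripMeasure T) := by
    refine ((integrable_indicator_iff hSc.measurableSet).2 ?_).mono_measure Measure.restrict_le_self
    exact integrableOn_const hSc.measure_lt_top.ne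
  have hb1 : MemLp (fun p : ℝ × ℝ => 1 + |b p.1 p.2|) ⊤ (stripMeasure T) :=
    (memLp_top_const (1 : ℝ)).add hb.norm
  have hbound : Integrable (fun p => S.indicator (fun _ => (K : ℝ)) p *
      (1 + |b p.1 p.2|) * |u p|) (stripMeasure T) :=
    (hSi.mul_of_top_left hb1).mul_of_top_left hu.norm
  have htend := tendsto_integral_of_dominated_convergence (μ := stripMeasure T)
    (F := fun k p => (fderiv ℝ (Ψ k) p (0, 1) + b p.1 p.2 * fderiv ℝ (Ψ k) p (1, 0)) * u p)
    (f := fun p => (fderiv ℝ Φ p (0, 1) + b p.1 p.2 * fderiv ℝ Φ p (1, 0)) * u p)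
    _ (fun k => hmeas (Ψ k)) hbound (fun k => .of_forall fun p => ?_) ?_
  · obtain ⟨δ, hδ, hδs⟩ := IsCompact.exists_cthickening_subset_open hc
      (isOpen_lt continuous_snd continuous_const) hs
    have hev : ∀ᶠ k : ℕ in Filter.atTop, 1 / ((k : ℝ) + 1) ≤ δ :=
      (tendsto_one_div_add_atTop_nhds_zero_nat (𝕜 := ℝ)).eventually_le_const hδ
    refine tendsto_nhds_unique htend (tendsto_const_nhds.congr' ?_)
    filter_upwards [hev] with k hk
    have ht : IsTestFunction T (Function.curry (Ψ k)) := by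
      refine ⟨?_, ?_, ?_⟩ <;> rw [Function.uncurry_curry]
      · exact h1 k
      · exact hSc.of_isClosed_subset (isClosed_tsupport _) (hsub k)
      · exact (h2 k).trans ((Metric.cthickening_mono hk _).trans hδs)
    have := hw _ ht
    rw [Function.uncurry_curry] at this
    exact this.symm
  · by_cases hp : p ∈ S
    · have n1 : ‖((0, 1) : ℝ × ℝ)‖ = 1 := by simp [Prod.norm_def]
      have n2 : ‖((1, 0) : ℝ × ℝ)‖ = 1 := by simp [Prod.norm_def]
      have a1 := h3 k p (0, 1)
      have a2 := h3 k p (1, 0)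
      rw [n1, mul_one] at a1
      rw [n2, mul_one] at a2
      rw [indicator_of_mem hp, norm_mul, Real.norm_eq_abs, Real.norm_eq_abs]
      refine mul_le_mul_of_nonneg_right ?_ (abs_nonneg _)
      refine (abs_add_le _ _).trans ?_
      rw [abs_mul]
      have := mul_le_mul_of_nonneg_left a2 (abs_nonneg (b p.1 p.2))
      linarith
    · have hp' : p ∉ tsupport (Ψ k) := fun h => hp (hsub k h)
      rw [indicator_of_notMem hp, fderiv_of_notMem_tsupport (𝕜 := ℝ) hp']
      simp
  · filter_upwards [ae_stripMeasure_of_ae (h4 (0, 1)), ae_stripMeasure_of_ae (h4 (1, 0))]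
      with p hp1 hp2
    exact (hp1.add (hp2.const_mul _)).mul_const _

/-- The solution of the backward transport equation `∂ₜψ + A ∂ₓψ = g`, `ψ(T) = 0`, given by
integration of `g` along the flow. -/
noncomputable def dualSolution (n : ℕ) (y : ℕ → ℝ → ℝ) (T : ℝ) (g : ℝ × ℝ → ℝ) (x t : ℝ) : ℝ :=
  ∫ r in T..t, g (pathFlow n y r x t, r)

/-- The extension of the dual solution to all times: constant in time for `t ≤ 0`, cut off between
`t = -1` and `t = -2`, and zero for `t ≥ T`. -/
noncomputable def dualTest (n : ℕ) (y : ℕ → ℝ → ℝ) (T : ℝ) (g : ℝ × ℝ → ℝ) (p : ℝ × ℝ) : ℝ :=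
  trunc 1 (p.2 + 2) * dualSolution n y T g p.1 (trunc T p.2)

namespace PathSystem

variable {n : ℕ} {y : ℕ → ℝ → ℝ} {E : Set ℝ} {T : ℝ} {L : ℝ≥0} {C : ℝ}

section Dual

variable {g : ℝ × ℝ → ℝ}

lemma continuous_along_flow (h : PathSystem n y E T L C) (hg : Continuous g) (x s : ℝ) :
    Continuous fun r => g (pathFlow n y r x s, r) :=
  hg.comp ((h.continuous_flow_time x s).prodMk continuous_id)

/-- The dual solution changes along the flow by the integral of `g`, by the semigroup property. -/
lemma dualSolution_step (h : PathSystem n y E T L C) (hg : Continuous g) (x : ℝ) {s t : ℝ}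
    (hst : s ≤ t) (ht : t ≤ T) :
    dualSolution n y T g x s = dualSolution n y T g (pathFlow n y t x s) t +
      ∫ r in t..s, g (pathFlow n y r x s, r) := by
  have hc := h.continuous_along_flow hg x s
  rw [dualSolution, ← intervalIntegral.integral_add_adjacent_intervals
    (hc.intervalIntegrable T t) (hc.intervalIntegrable t s), dualSolution]
  congr 1
  refine intervalIntegral.integral_congr fun r hr => ?_
  rw [uIcc_of_ge ht] at hr
  rw [h.flow_comp hst hr.1]

lemma _root_.abs_dualSolution_le {M : ℝ} (hM : ∀ p, |g p| ≤ M) (x : ℝ)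
    {t : ℝ} (ht : t ∈ Icc 0 T) : |dualSolution n y T g x t| ≤ M * T := by
  have hM0 : 0 ≤ M := (abs_nonneg _).trans (hM 0)
  have := intervalIntegral.norm_integral_le_of_norm_le_const (a := T) (b := t) (C := M)
    (f := fun r => g (pathFlow n y r x t, r)) (fun r _ => hM _)
  rw [Real.norm_eq_abs] at this
  refine this.trans (mul_le_mul_of_nonneg_left ?_ hM0)
  rw [abs_sub_comm, abs_of_nonneg (by linarith [ht.2])]
  linarith [ht.1]

lemma abs_dualSolution_sub_space (h : PathSystem n y E T L C) {K : ℝ≥0} (hK : LipschitzWith K g)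
    (x x' : ℝ) {t : ℝ} (ht : t ∈ Icc 0 T) :
    |dualSolution n y T g x t - dualSolution n y T g x' t| ≤
      K * (2 + n * Real.exp (C * T)) * T * |x - x'| := by
  have hc := fun z => h.continuous_along_flow hK.continuous z t
  rw [dualSolution, dualSolution, ← intervalIntegral.integral_sub
    ((hc x).intervalIntegrable _ _) ((hc x').intervalIntegrable _ _)]
  have he := (Real.exp_pos (C * T)).le
  have := intervalIntegral.norm_integral_le_of_norm_le_const (a := T) (b := t)
    (C := K * ((2 + n * Real.exp (C * T)) * |x - x'|))
    (f := fun r => g (pathFlow n y r x t, r) - g (pathFlow n y r x' t, r)) (fun r hr => by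
      rw [uIoc_of_ge ht.2] at hr
      have h1 := hK.dist_le_mul (pathFlow n y r x t, r) (pathFlow n y r x' t, r)
      rw [Prod.dist_eq, dist_self, max_eq_left dist_nonneg] at h1
      exact h1.trans (mul_le_mul_of_nonneg_left (h.abs_flow_sub_le hr.1.le x x') K.2))
  rw [Real.norm_eq_abs] at this
  refine this.trans ?_
  rw [abs_sub_comm t, abs_of_nonneg (by linarith [ht.2] : 0 ≤ T - t)]
  have h2 : 0 ≤ K * ((2 + n * Real.exp (C * T)) * |x - x'|) := by positivity
  have := mul_le_mul_of_nonneg_left (show T - t ≤ T by linarith [ht.1]) h2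
  linarith

lemma abs_dualSolution_sub_time (h : PathSystem n y E T L C) {K : ℝ≥0} (hK : LipschitzWith K g)
    {M : ℝ} (hM : ∀ p, |g p| ≤ M) (x : ℝ) {s t : ℝ} (hs : s ∈ Icc 0 T) (ht : t ∈ Icc 0 T) :
    |dualSolution n y T g x s - dualSolution n y T g x t| ≤
      (K * (2 + n * Real.exp (C * T)) * T * ((1 + 2 * n) * L) + M) * |s - t| := by
  wlog hst : s ≤ t generalizing s t
  · rw [abs_sub_comm, abs_sub_comm s]
    exact this ht hs (le_of_not_ge hst)
  have h1 := h.abs_dualSolution_sub_space hK (pathFlow n y t x s) x ht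
  have h2 := h.abs_flow_sub_self_le x s t
  have h3 := intervalIntegral.norm_integral_le_of_norm_le_const (a := t) (b := s) (C := M)
    (f := fun r => g (pathFlow n y r x s, r)) (fun r _ => hM _)
  rw [Real.norm_eq_abs] at h3
  rw [abs_sub_comm t s] at h2
  have he := (Real.exp_pos (C * T)).le
  have hT := h.pos.le
  have h4 := mul_le_mul_of_nonneg_left h2
    (show 0 ≤ K * (2 + n * Real.exp (C * T)) * T by positivity)
  rw [h.dualSolution_step hK.continuous x hst ht.2, add_sub_right_comm]
  refine (abs_add_le _ _).trans ?_
  linarith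

lemma trunc_mem_Icc (h : PathSystem n y E T L C) (t : ℝ) : trunc T t ∈ Icc 0 T :=
  ⟨trunc_nonneg _ _, trunc_le h.pos.le _⟩

lemma dualTest_lipschitz (h : PathSystem n y E T L C) {K : ℝ≥0} (hK : LipschitzWith K g)
    {M : ℝ} (hM : ∀ p, |g p| ≤ M) : ∃ K', LipschitzWith K' (dualTest n y T g) := by
  set A : ℝ := K * (2 + n * Real.exp (C * T)) * T with hA
  set B : ℝ := A * ((1 + 2 * n) * L) + M with hB
  have hM0 : 0 ≤ M := (abs_nonneg _).trans (hM 0)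
  have he := (Real.exp_pos (C * T)).le
  have hT := h.pos.le
  have hA0 : 0 ≤ A := by positivity
  have hB0 : 0 ≤ B := by positivity
  have hK0 : 0 ≤ M * T + A + B := by positivity
  refine ⟨(M * T + A + B).toNNReal, LipschitzWith.of_dist_le_mul fun p q => ?_⟩
  rw [Real.coe_toNNReal _ hK0, Real.dist_eq, Prod.dist_eq, Real.dist_eq, Real.dist_eq]
  set d := max |p.1 - q.1| |p.2 - q.2|
  have d1 : |p.1 - q.1| ≤ d := le_max_left _ _
  have d2 : |p.2 - q.2| ≤ d := le_max_right _ _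
  have c1 := abs_trunc_sub_le 1 (p.2 + 2) (q.2 + 2)
  rw [add_sub_add_right_eq_sub] at c1
  have c2 := abs_dualSolution_le (n := n) (y := y) hM p.1 (h.trunc_mem_Icc p.2)
  have c3 := h.abs_dualSolution_sub_space hK p.1 q.1 (h.trunc_mem_Icc p.2)
  have c4 := h.abs_dualSolution_sub_time hK hM q.1 (h.trunc_mem_Icc p.2) (h.trunc_mem_Icc q.2)
  have c5 := abs_trunc_sub_le T p.2 q.2
  have c6 : |trunc 1 (q.2 + 2)| ≤ 1 := by
    rw [abs_of_nonneg (trunc_nonneg _ _)]; exact trunc_le zero_le_one _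
  have e : dualTest n y T g p - dualTest n y T g q =
      (trunc 1 (p.2 + 2) - trunc 1 (q.2 + 2)) * dualSolution n y T g p.1 (trunc T p.2) +
      trunc 1 (q.2 + 2) *
        ((dualSolution n y T g p.1 (trunc T p.2) - dualSolution n y T g q.1 (trunc T p.2)) +
        (dualSolution n y T g q.1 (trunc T p.2) - dualSolution n y T g q.1 (trunc T q.2))) := by
    simp only [dualTest]; ring
  rw [e]
  refine (abs_add_le _ _).trans ?_
  rw [abs_mul, abs_mul]
  have f1 := mul_le_mul (c1.trans d2) c2 (abs_nonneg _) ((abs_nonneg _).trans d2)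
  have f2 := abs_add_le
    (dualSolution n y T g p.1 (trunc T p.2) - dualSolution n y T g q.1 (trunc T p.2))
    (dualSolution n y T g q.1 (trunc T p.2) - dualSolution n y T g q.1 (trunc T q.2))
  have f3 := mul_le_mul c6 f2 (abs_nonneg _) zero_le_one
  have f4 := mul_le_mul_of_nonneg_left d1 hA0
  have f5 := mul_le_mul_of_nonneg_left (c5.trans d2) hB0
  linarith

/-- The dual solution vanishes near `T` since `g` does, and has compact support since the flow has finite
speed. -/
lemma dualTest_support (h : PathSystem n y E T L C) (hc : HasCompactSupport g)
    (hs : tsupport g ⊆ univ ×ˢ Ioo 0 T) :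
    HasCompactSupport (dualTest n y T g) ∧ tsupport (dualTest n y T g) ⊆ {p | p.2 < T} := by
  obtain ⟨R, hR⟩ := hc.isBounded.subset_closedBall 0
  obtain ⟨T', hT', hT's⟩ : ∃ T' < T, tsupport g ⊆ {p | p.2 ≤ T'} := by
    rcases (tsupport g).eq_empty_or_nonempty with h0 | h0
    · exact ⟨T - 1, by linarith, by rw [h0]; exact empty_subset _⟩
    · obtain ⟨p, hp, hmax⟩ := IsCompact.exists_isMaxOn hc h0 continuous_snd.continuousOn
      exact ⟨p.2, (hs hp).2.2, fun q hq => hmax hq⟩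
  set R' := R + (1 + 2 * n) * (L * T) with hR'
  have hsub : Function.support (dualTest n y T g) ⊆ Icc (-R') R' ×ˢ Icc (-2) T' := by
    intro p hp
    rw [Function.mem_support, dualTest] at hp
    have hp1 := left_ne_zero_of_mul hp
    have hp2 := right_ne_zero_of_mul hp
    have ht2 : -2 ≤ p.2 := by
      by_contra hlt
      exact hp1 (trunc_of_nonpos (by linarith))
    have hm := h.trunc_mem_Icc p.2
    obtain ⟨r, hr, hgr⟩ : ∃ r ∈ Icc (trunc T p.2) T,
        g (pathFlow n y r p.1 (trunc T p.2), r) ≠ 0 := by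
      by_contra! hcon
      refine hp2 ?_
      rw [dualSolution, intervalIntegral.integral_congr (g := fun _ => 0) fun r hr => ?_]
      · simp
      · rw [uIcc_of_ge hm.2] at hr
        exact hcon r hr
    have hmem := subset_tsupport g hgr
    have hr1 : r ≤ T' := hT's hmem
    have hr2 := hR hmem
    rw [mem_closedBall_zero_iff, Prod.norm_def] at hr2
    have hr3 := (le_max_left _ _).trans hr2
    rw [Real.norm_eq_abs] at hr3
    have hx := h.abs_flow_sub_self_le p.1 (trunc T p.2) r
    rw [abs_of_nonneg (sub_nonneg.2 hr.1)] at hx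
    have hx2 : (1 + 2 * (n : ℝ)) * (L * (r - trunc T p.2)) ≤ (1 + 2 * n) * (L * T) := by
      have : r - trunc T p.2 ≤ T := by linarith [hr.2, hm.1]
      gcongr
    rw [abs_sub_comm] at hx
    have hx3 := abs_sub_abs_le_abs_sub p.1 (pathFlow n y r p.1 (trunc T p.2))
    simp only at hr3
    have hx4 : |p.1| ≤ R' := by linarith
    refine ⟨abs_le.1 hx4, ht2, ?_⟩
    have hlt : trunc T p.2 < T := by linarith [hr.1]
    have : p.2 ≤ trunc T p.2 := by
      by_contra! hgt
      rcases le_total T p.2 with h5 | h5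
      · rw [trunc_of_ge h.pos.le h5] at hlt; exact hlt.false
      · have h6 : min p.2 T = p.2 := min_eq_left h5
        rw [trunc, h6] at hgt
        exact absurd (le_max_right 0 p.2) (not_le.2 hgt)
    linarith [hr.1]
  have hK : IsCompact (Icc (-R') R' ×ˢ Icc (-2) T') := isCompact_Icc.prod isCompact_Icc
  have hsub' := closure_minimal hsub hK.isClosed
  exact ⟨hK.of_isClosed_subset (isClosed_tsupport _) hsub',
    fun p hp => lt_of_le_of_lt (hsub' hp).2.2 hT'⟩

/-- The transport equation for the dual solution, at its points of differentiability. -/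
lemma dualTest_transport (h : PathSystem n y E T L C) (hg : Continuous g) {p : ℝ × ℝ}
    (hp : p.2 ∈ Ioo 0 T) (hE : p.2 ∉ E) (hd : DifferentiableAt ℝ (dualTest n y T g) p) :
    fderiv ℝ (dualTest n y T g) p (0, 1) +
      pathField n y p.1 p.2 * fderiv ℝ (dualTest n y T g) p (1, 0) = g p := by
  obtain ⟨x, t⟩ := p
  simp only at hp hE ⊢
  have hx := h.hasDerivAt_flow x (le_refl t) hE
  rw [h.flow_self] at hx
  have h1 : HasDerivAt (fun r => dualTest n y T g (pathFlow n y r x t, r))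
      (fderiv ℝ (dualTest n y T g) (x, t) (pathField n y x t, 1)) t := by
    have hd' : HasFDerivAt (dualTest n y T g) (fderiv ℝ (dualTest n y T g) (x, t))
        (pathFlow n y t x t, t) := by
      rw [h.flow_self]
      exact hd.hasFDerivAt
    exact HasFDerivAt.comp_hasDerivAt (f := fun r => (pathFlow n y r x t, r)) t hd'
      (hx.prodMk (hasDerivAt_id t))
  have h2 : HasDerivAt (fun r => ∫ ρ in T..r, g (pathFlow n y ρ x t, ρ)) (g (x, t)) t := by
    have := (h.continuous_along_flow hg x t).integral_hasStrictDerivAt T t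
    rw [h.flow_self] at this
    exact this.hasDerivAt
  -- along the flow, forward in time, the dual solution is the integral of `g`
  have h3 : HasDerivWithinAt (fun r => dualTest n y T g (pathFlow n y r x t, r)) (g (x, t))
      (Ici t) t := by
    have hev : ∀ r ∈ Ico t T, dualTest n y T g (pathFlow n y r x t, r) =
        ∫ ρ in T..r, g (pathFlow n y ρ x t, ρ) := by
      intro r hr
      have hs := h.dualSolution_step hg x hr.1 hr.2.le
      rw [dualSolution, intervalIntegral.integral_symm] at hs
      have hadj := intervalIntegral.integral_add_adjacent_intervals
        ((h.continuous_along_flow hg x t).intervalIntegrable (μ := volume) T r)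
        ((h.continuous_along_flow hg x t).intervalIntegrable (μ := volume) r t)
      rw [dualTest, trunc_of_ge zero_le_one (by linarith [hr.1, hp.1]),
        trunc_of_mem (by linarith [hr.1, hp.1]) hr.2.le, one_mul]
      simp only
      rw [intervalIntegral.integral_symm t T] at hadj
      linarith
    refine h2.hasDerivWithinAt.congr_of_eventuallyEq ?_ (hev t ⟨le_rfl, hp.2⟩)
    filter_upwards [Ico_mem_nhdsGE hp.2] with r hr
    exact hev r hr
  have h4 := (uniqueDiffWithinAt_Ici t).eq_deriv (Ici t) h1.hasDerivWithinAt h3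
  rw [← h4, show ((pathField n y x t, 1) : ℝ × ℝ) = (0, 1) + pathField n y x t • (1, 0) by simp,
    map_add, map_smul, smul_eq_mul]

end Dual

/-- Bounded weak solutions of the homogeneous equation with zero initial values vanish. -/
theorem eq_zero_of_weak (h : PathSystem n y E T L C) {b : ℝ → ℝ → ℝ}
    (hb : ∀ t ∈ Ioo 0 T, t ∉ E → ∀ x, b x t = pathField n y x t)
    (hbm : MemLp (Function.uncurry b) ⊤ (stripMeasure T)) {u : ℝ × ℝ → ℝ}
    (hu : MemLp u ⊤ (stripMeasure T))
    (hw : ∀ φ, IsTestFunction T φ → ∫ p, (fderiv ℝ (Function.uncurry φ) p (0, 1) +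
      b p.1 p.2 * fderiv ℝ (Function.uncurry φ) p (1, 0)) * u p ∂stripMeasure T = 0) :
    u =ᵐ[stripMeasure T] 0 := by
  set U : Set (ℝ × ℝ) := univ ×ˢ Ioo 0 T with hU
  have hUo : IsOpen U := isOpen_univ.prod isOpen_Ioo
  have hloc : LocallyIntegrable (U.indicator u) :=
    MemLp.locallyIntegrable (p := ⊤) ((memLp_indicator_iff_restrict hUo.measurableSet).2 hu) le_top
  have key := hUo.ae_eq_zero_of_integral_contDiff_smul_eq_zero
    (hloc.locallyIntegrableOn U) (fun g hg hgc hgs => ?_)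
  · refine (ae_restrict_iff' hUo.measurableSet).2 ?_
    filter_upwards [key] with p hp hpU
    have := hp hpU
    rwa [indicator_of_mem hpU] at this
  · obtain ⟨K, hK⟩ := hg.lipschitzWith_of_hasCompactSupport hgc (by simp)
    obtain ⟨M, hM⟩ := hgc.exists_bound_of_continuous hg.continuous
    obtain ⟨K', hK'⟩ := h.dualTest_lipschitz hK (M := M) hM
    obtain ⟨hs1, hs2⟩ := h.dualTest_support hgc hgs
    have h0 := integral_lipschitz_test hbm hu hw hK' hs1 hs2
    rw [← h0, stripMeasure, ← hU, ← integral_indicator hUo.measurableSet]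
    refine integral_congr_ae ?_
    filter_upwards [hK'.ae_differentiableAt (μ := volume),
      Measure.quasiMeasurePreserving_snd (μ := (volume : Measure ℝ)).ae h.ae_notMem] with p hp1 hp2
    by_cases hpU : p ∈ U
    · rw [indicator_of_mem hpU, indicator_of_mem hpU, hb p.2 hpU.2 hp2,
        h.dualTest_transport hg.continuous hpU.2 hp2 hp1, smul_eq_mul]
    · rw [indicator_of_notMem hpU, indicator_of_notMem hpU, smul_zero]

lemma _root_.IsTestFunction.integrable_strip {φ : ℝ → ℝ → ℝ} (hφ : IsTestFunction T φ)
    {b : ℝ → ℝ → ℝ} (hbm : MemLp (Function.uncurry b) ⊤ (stripMeasure T)) {w : ℝ × ℝ → ℝ}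
    (hw : MemLp w ⊤ (stripMeasure T)) :
    Integrable (fun p : ℝ × ℝ => (fderiv ℝ (Function.uncurry φ) p (0, 1) +
      b p.1 p.2 * fderiv ℝ (Function.uncurry φ) p (1, 0)) * w p) (stripMeasure T) := by
  have hi : ∀ v, Integrable (fun p => fderiv ℝ (Function.uncurry φ) p v) (stripMeasure T) :=
    fun v => ((hφ.continuous_fderiv_apply v).integrable_of_hasCompactSupport
      (hφ.compact.fderiv_apply (𝕜 := ℝ) v)).mono_measure Measure.restrict_le_self
  exact ((hi (0, 1)).add ((hi (1, 0)).mul_of_top_right hbm)).mul_of_top_left hw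

/-- Uniqueness of weak solutions. -/
theorem weak_unique (h : PathSystem n y E T L C) {b : ℝ → ℝ → ℝ}
    (hb : ∀ t ∈ Ioo 0 T, t ∉ E → ∀ x, b x t = pathField n y x t) {f : ℝ → ℝ → ℝ} {u₀ : ℝ → ℝ}
    {w v : ℝ → ℝ → ℝ} (hw : IsWeakSolution b f u₀ T w) (hv : IsWeakSolution b f u₀ T v) :
    Function.uncurry w =ᵐ[stripMeasure T] Function.uncurry v := by
  have key := h.eq_zero_of_weak hb hw.velocity_mem (hw.sol_mem.sub hv.sol_mem) fun φ hφ => ?_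
  · filter_upwards [key] with p hp
    exact sub_eq_zero.1 hp
  · have i1 := hφ.integrable_strip hw.velocity_mem hw.sol_mem
    have i2 := hφ.integrable_strip hw.velocity_mem hv.sol_mem
    have e1 := hw.weak φ hφ
    have e2 := hv.weak φ hφ
    simp only [hφ.deriv_time, (hφ.hasDerivAt_space _ _).deriv] at e1 e2
    have e3 := integral_stripMeasure h.pos.le i1
    have e4 := integral_stripMeasure h.pos.le i2
    simp only [Function.uncurry_apply_pair] at e3 e4
    simp only [Pi.sub_apply, mul_sub]
    rw [integral_sub i1 i2, ← e3, ← e4]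
    linarith

/-! ### The function spaces of the data -/

lemma memLp_field (h : PathSystem n y E T L C) {b : ℝ → ℝ → ℝ}
    (hb : ∀ t ∈ Ioo 0 T, t ∉ E → ∀ x, b x t = pathField n y x t) :
    MemLp (Function.uncurry b) ⊤ (stripMeasure T) := by
  have hm : Measurable (Function.uncurry (pathField n y)) := by
    have hy : ∀ i ≤ n, Measurable fun p : ℝ × ℝ => y i p.2 := fun i hi =>
      (h.continuous_path hi).measurable.comp measurable_snd
    have hd : ∀ i, Measurable fun p : ℝ × ℝ => deriv (y i) p.2 := fun i =>
      (measurable_deriv (y i)).comp measurable_snd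
    simp only [Function.uncurry_def, pathField, pwLinear, zero_mul, add_zero]
    refine (hd 0).add (Finset.measurable_fun_sum _ fun i hi => ?_)
    have hi' := Finset.mem_range.1 hi
    have h1 := hy i hi'.le
    have h2 := hy (i + 1) hi'
    exact (((hd (i + 1)).sub (hd i)).div (h2.sub h1)).mul
      (measurable_const.max ((measurable_fst.sub h1).min (h2.sub h1)))
  have hae : Function.uncurry (pathField n y) =ᵐ[stripMeasure T] Function.uncurry b := by
    filter_upwards [ae_stripMeasure_mem T, ae_stripMeasure_of_ae_time h.ae_notMem] with p h1 h2
    exact (hb p.2 h1 h2 p.1).symm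
  exact (memLp_top_of_bound hm.aestronglyMeasurable _
    (.of_forall fun p => h.abs_field_le p.1 p.2)).ae_eq hae

lemma aestronglyMeasurable_deriv_field (h : PathSystem n y E T L C) {b : ℝ → ℝ → ℝ}
    (hb : ∀ t ∈ Ioo 0 T, t ∉ E → ∀ x, b x t = pathField n y x t) :
    AEStronglyMeasurable (fun p : ℝ × ℝ => deriv (fun z => b z p.2) p.1) (stripMeasure T) := by
  have hm : Measurable fun p : ℝ × ℝ => pathFieldDeriv n y p.1 p.2 :=
    measurable_stepFun (c := fun i t =>
      (deriv (y (i + 1)) t - deriv (y i) t) / (y (i + 1) t - y i t))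
      (fun i hi => (h.continuous_path hi).measurable)
      (fun i hi => ((measurable_deriv _).sub (measurable_deriv _)).div
        ((h.continuous_path hi).measurable.sub (h.continuous_path hi.le).measurable))
  refine hm.aestronglyMeasurable.congr ?_
  have hn : ∀ᵐ p ∂stripMeasure T, ∀ i : ℕ, i ≤ n → p.1 ≠ y i p.2 := by
    refine ae_all_iff.2 fun i => ?_
    by_cases hi : i ≤ n
    · filter_upwards [ae_stripMeasure_of_ae (ae_ne_path (h.continuous_path hi))] with p hp _
      exact hp
    · exact .of_forall fun p hi' => absurd hi' hi
  filter_upwards [ae_stripMeasure_mem T, ae_stripMeasure_of_ae_time h.ae_notMem, hn]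
    with p h1 h2 h3
  rw [show (fun z => b z p.2) = pwLinear n (fun i => y i p.2) (fun i => deriv (y i) p.2) 0 from
    funext (hb p.2 h1 h2)]
  exact (hasDerivAt_pwLinear_space (h.ord p.2) (fun i => deriv (y i) p.2) h3).deriv.symm

lemma integrable_deriv_field (h : PathSystem n y E T L C) {b : ℝ → ℝ → ℝ} {t : ℝ} (ht : t ∉ E)
    (hb : ∀ x, b x t = pathField n y x t) :
    Integrable (fun x => deriv (fun z => b z t) x) ∧
      ∫ x, |deriv (fun z => b z t) x| ≤ n * (2 * L) := by
  have hae := h.deriv_field_ae hb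
  refine ⟨(integrable_stepFun n _ _).congr (hae.mono fun x hx => hx.symm), ?_⟩
  have h1 : ∫ x, |deriv (fun z => b z t) x| = ∫ x, |pathFieldDeriv n y x t| :=
    integral_congr_ae (hae.mono fun x hx => by simp only [hx])
  rw [h1]
  refine (integral_mono (integrable_stepFun n _ _).abs (integrable_stepFun n _ _)
    (abs_stepFun_le n _ _)).trans ?_
  rw [integral_stepFun (h.ord t)]
  have hle : ∀ i ∈ Finset.range n,
      |(deriv (y (i + 1)) t - deriv (y i) t) / (y (i + 1) t - y i t)| *
        (y (i + 1) t - y i t) ≤ 2 * L := by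
    intro i hi
    have hi' := Finset.mem_range.1 hi
    rw [← abs_of_nonneg (h.gap_nonneg hi' t), ← abs_mul, abs_of_nonneg (h.gap_nonneg hi' t),
      h.gap_deriv_eq ht hi']
    have h1 := h.abs_deriv_le (show i + 1 ≤ n from hi') t
    have h2 := h.abs_deriv_le hi'.le t
    have := abs_sub (deriv (y (i + 1)) t) (deriv (y i) t)
    linarith
  simpa using Finset.sum_le_card_nsmul _ _ _ hle

lemma abs_density_le {n : ℕ} {y : ℕ → ℝ → ℝ} {m : ℕ → ℝ} {M : ℝ} (hM0 : 0 ≤ M) {t : ℝ}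
    (hM : ∀ i < n, |m i / (y (i + 1) t - y i t)| ≤ M) (x : ℝ) :
    |pathDensity n y m x t| ≤ n * M :=
  (abs_stepFun_le n _ _ x).trans (stepFun_le hM0 hM x)

/-- The shifted density is a weak solution of the continuity equation with source. -/
theorem isWeakSolution (h : PathSystem n y E T L C) {b v : ℝ → ℝ → ℝ}
    (hb : ∀ t ∈ Ioo 0 T, t ∉ E → ∀ x, b x t = pathField n y x t) {m : ℕ → ℝ}
    (hm : ∀ i < n, ∀ t, y (i + 1) t = y i t → m i = 0) {M : ℝ} (hM0 : 0 ≤ M)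
    (hM : ∀ i < n, ∀ t, |m i / (y (i + 1) t - y i t)| ≤ M)
    (hv : ∀ t ∈ Ioo 0 T, t ∉ E → ∀ x, v x t = pathDensity n y m x t) (k : ℝ) :
    IsWeakSolution b (fun x t => -k * deriv (fun z => b z t) x)
      (fun x => pathDensity n y m x 0 - k) T (fun x t => v x t - k) where
  velocity_mem := h.memLp_field hb
  source_meas := (h.aestronglyMeasurable_deriv_field hb).const_mul (-k)
  source_bound := by
    refine ⟨|k| * (n * (2 * L)), ?_⟩
    filter_upwards [h.ae_notMem] with t ht htm
    obtain ⟨h1, h2⟩ := h.integrable_deriv_field ht (hb t htm ht)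
    refine ⟨h1.const_mul _, ?_⟩
    simp only [abs_mul, abs_neg]
    rw [integral_const_mul]
    exact mul_le_mul_of_nonneg_left h2 (abs_nonneg k)
  init_mem := by
    refine MemLp.sub (memLp_top_of_bound
      (integrable_stepFun n _ _).aestronglyMeasurable (n * M)
      (.of_forall fun x => abs_density_le hM0 (fun i hi => hM i hi 0) x)) (memLp_top_const k)
  sol_mem := by
    have hmd : Measurable fun p : ℝ × ℝ => pathDensity n y m p.1 p.2 :=
      measurable_stepFun (c := fun i t => m i / (y (i + 1) t - y i t))
        (fun i hi => (h.continuous_path hi).measurable)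
        (fun i hi => measurable_const.div
          ((h.continuous_path hi).measurable.sub (h.continuous_path hi.le).measurable))
    refine MemLp.sub (f := Function.uncurry v) (MemLp.ae_eq ?_ (memLp_top_of_bound
      hmd.aestronglyMeasurable (n * M)
      (.of_forall fun p => abs_density_le hM0 (fun i hi => hM i hi p.2) p.1))) (memLp_top_const k)
    filter_upwards [ae_stripMeasure_mem T, ae_stripMeasure_of_ae_time h.ae_notMem] with p h1 h2
    exact (hv p.2 h1 h2 p.1).symm
  weak φ hφ := h.weak_formulation hb hm hv k hφ

end PathSystem

/-! ### The particle velocity -/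

section Velocity

variable {f : ℝ → ℝ}

lemma continuous_fluxVelocity {K : ℝ≥0} (hf : LipschitzWith K f) (hf0 : f 0 = 0)
    (hd : DifferentiableAt ℝ f 0) : Continuous (fluxVelocity f) := by
  refine continuous_iff_continuousAt.2 fun v => ?_
  rcases eq_or_ne v 0 with rfl | hv
  · have h := hd.hasDerivAt.tendsto_slope
    rw [← continuousWithinAt_compl_self, ContinuousWithinAt, fluxVelocity, if_pos rfl]
    refine h.congr' ?_
    filter_upwards [self_mem_nhdsWithin] with w hw
    rw [slope_def_field, hf0, fluxVelocity, if_neg (show w ≠ 0 from hw), sub_zero, sub_zero]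
  · have h : ContinuousAt (fun w => f w / w) v :=
      hf.continuous.continuousAt.div continuousAt_id hv
    refine h.congr ?_
    filter_upwards [isOpen_ne.mem_nhds hv] with w hw
    rw [fluxVelocity, if_neg hw]

lemma abs_fluxVelocity_le {K : ℝ≥0} (hf : LipschitzWith K f) (hf0 : f 0 = 0) (v : ℝ) :
    |fluxVelocity f v| ≤ K := by
  rw [fluxVelocity]
  split_ifs with hv
  · simpa using norm_deriv_le_of_lipschitz (x₀ := (0 : ℝ)) hf
  · have := hf.dist_le_mul v 0
    rw [hf0, dist_zero_right, dist_zero_right, Real.norm_eq_abs, Real.norm_eq_abs] at this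
    rw [abs_div]
    exact div_le_of_le_mul₀ (abs_nonneg _) K.2 this

lemma fluxVelocity_image_bdd {K : ℝ≥0} (hf : LipschitzWith K f) (hf0 : f 0 = 0) (s : Set ℝ) :
    BddBelow (fluxVelocity f '' s) ∧ BddAbove (fluxVelocity f '' s) := by
  constructor
  · refine ⟨-K, ?_⟩
    rintro _ ⟨v, _, rfl⟩
    exact (abs_le.1 (abs_fluxVelocity_le hf hf0 v)).1
  · refine ⟨K, ?_⟩
    rintro _ ⟨v, _, rfl⟩
    exact (abs_le.1 (abs_fluxVelocity_le hf hf0 v)).2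

lemma particleVelocity_le {K : ℝ≥0} (hf : LipschitzWith K f) (hf0 : f 0 = 0) {vl vr v : ℝ}
    (h1 : vl ≤ v) (h2 : v ≤ vr) : particleVelocity f vl vr ≤ fluxVelocity f v := by
  rw [particleVelocity, if_pos (h1.trans h2)]
  exact csInf_le (fluxVelocity_image_bdd hf hf0 _).1 (mem_image_of_mem _ ⟨h1, h2⟩)

lemma le_particleVelocity {K : ℝ≥0} (hf : LipschitzWith K f) (hf0 : f 0 = 0) {vl vr v : ℝ}
    (h1 : vr ≤ v) (h2 : v ≤ vl) : fluxVelocity f v ≤ particleVelocity f vl vr := by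
  rw [particleVelocity]
  split_ifs with h
  · have e1 : vl = v := by linarith
    have e2 : vr = v := by linarith
    rw [e1, e2, Icc_self, image_singleton, csInf_singleton]
  · exact le_csSup (fluxVelocity_image_bdd hf hf0 _).2 (mem_image_of_mem _ ⟨h1, h2⟩)

lemma abs_particleVelocity_le {K : ℝ≥0} (hf : LipschitzWith K f) (hf0 : f 0 = 0) (vl vr : ℝ) :
    |particleVelocity f vl vr| ≤ K := by
  rw [particleVelocity]
  split_ifs with h
  · have hne : (fluxVelocity f '' Icc vl vr).Nonempty := (nonempty_Icc.2 h).image _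
    refine abs_le.2 ⟨le_csInf hne ?_, ?_⟩
    · rintro _ ⟨v, _, rfl⟩
      exact (abs_le.1 (abs_fluxVelocity_le hf hf0 v)).1
    · exact (csInf_le (fluxVelocity_image_bdd hf hf0 _).1
        (mem_image_of_mem _ (left_mem_Icc.2 h))).trans
          (abs_le.1 (abs_fluxVelocity_le hf hf0 vl)).2
  · have h' := (not_le.1 h).le
    have hne : (fluxVelocity f '' Icc vr vl).Nonempty := (nonempty_Icc.2 h').image _
    refine abs_le.2 ⟨?_, csSup_le hne ?_⟩
    · exact (abs_le.1 (abs_fluxVelocity_le hf hf0 vr)).1.trans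
        (le_csSup (fluxVelocity_image_bdd hf hf0 _).2 (mem_image_of_mem _ (left_mem_Icc.2 h')))
    · rintro _ ⟨v, _, rfl⟩
      exact (abs_le.1 (abs_fluxVelocity_le hf hf0 v)).2

lemma image_Icc_eq_image_unit (a : ℝ → ℝ) {u v : ℝ} (huv : u ≤ v) :
    a '' Icc u v = (fun l => a (u + l * (v - u))) '' Icc 0 1 := by
  have h : Icc u v = (fun l => u + l * (v - u)) '' Icc 0 1 := by
    rw [← segment_eq_Icc huv, segment_eq_image']
    simp
  rw [h, image_image]

/-- Both branches of the definition are extrema over the segment between `vl` and `vr`, parametrized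
by the unit interval. -/
lemma continuous_particleVelocity {K : ℝ≥0} (hf : LipschitzWith K f) (hf0 : f 0 = 0)
    (hd : DifferentiableAt ℝ f 0) : Continuous fun p : ℝ × ℝ => particleVelocity f p.1 p.2 := by
  have ha := continuous_fluxVelocity hf hf0 hd
  have hI : Continuous fun p : ℝ × ℝ =>
      sInf ((fun l => fluxVelocity f (p.1 + l * (p.2 - p.1))) '' Icc 0 1) :=
    isCompact_Icc.continuous_sInf
      (f := fun (p : ℝ × ℝ) (l : ℝ) => fluxVelocity f (p.1 + l * (p.2 - p.1)))
      (ha.comp (by fun_prop))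
  have hS : Continuous fun p : ℝ × ℝ =>
      sSup ((fun l => fluxVelocity f (p.2 + l * (p.1 - p.2))) '' Icc 0 1) :=
    isCompact_Icc.continuous_sSup
      (f := fun (p : ℝ × ℝ) (l : ℝ) => fluxVelocity f (p.2 + l * (p.1 - p.2)))
      (ha.comp (by fun_prop))
  have h : Continuous fun p : ℝ × ℝ => if p.1 ≤ p.2 then
      sInf ((fun l => fluxVelocity f (p.1 + l * (p.2 - p.1))) '' Icc 0 1) else
      sSup ((fun l => fluxVelocity f (p.2 + l * (p.1 - p.2))) '' Icc 0 1) := by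
    refine hI.if_le hS continuous_fst continuous_snd fun p hp => ?_
    simp [hp]
  refine h.congr fun p => ?_
  rw [particleVelocity]
  split_ifs with h1
  · rw [image_Icc_eq_image_unit _ h1]
  · rw [image_Icc_eq_image_unit _ (not_le.1 h1).le]

end Velocity

/-! ### Calculus lemmas -/

/-- A function which attains its maximum over a left neighbourhood at its end point has a nonnegative
derivative there. -/
lemma HasDerivAt.nonneg_of_left_max {φ : ℝ → ℝ} {φ' a t : ℝ} (h : HasDerivAt φ φ' t) (hat : a < t)
    (hmax : ∀ r ∈ Ioo a t, φ r ≤ φ t) : 0 ≤ φ' := by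
  have h1 : Filter.Tendsto (slope φ t) (𝓝[<] t) (𝓝 φ') :=
    h.tendsto_slope.mono_left (nhdsWithin_mono _ fun r hr => ne_of_lt hr)
  refine ge_of_tendsto h1 ?_
  filter_upwards [Ioo_mem_nhdsLT hat] with r hr
  rw [slope_def_field]
  exact div_nonneg_of_nonpos (by linarith [hmax r hr]) (by linarith [hr.2])

lemma lipschitzWith_of_hasDerivAt_off_finite {φ φ' : ℝ → ℝ} {E : Set ℝ} {K : ℝ≥0}
    (hφ : Continuous φ) (hE : E.Finite) (hd : ∀ t ∉ E, HasDerivAt φ (φ' t) t)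
    (hb : ∀ t ∉ E, |φ' t| ≤ K) : LipschitzWith K φ := by
  have hae : ∀ᵐ t : ℝ, t ∉ E := hE.countable.ae_notMem volume
  have hle : ∀ᵐ t : ℝ, ‖deriv φ t‖ ≤ K := by
    filter_upwards [hae] with t ht
    rw [(hd t ht).deriv]
    exact hb t ht
  refine LipschitzWith.of_dist_le_mul fun s t => ?_
  have hint : IntervalIntegrable (deriv φ) volume t s := by
    refine IntervalIntegrable.mono_fun' (intervalIntegrable_const (c := (K : ℝ)))
      (measurable_deriv φ).aestronglyMeasurable (ae_restrict_of_ae hle)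
  have h := integral_eq_of_hasDerivAt_off_countable φ (deriv φ) hE.countable
    hφ.continuousOn (fun r hr => by rw [(hd r hr.2).deriv]; exact hd r hr.2) hint
  rw [Real.dist_eq, ← h, Real.dist_eq]
  exact intervalIntegral.norm_integral_le_of_norm_le_const_ae (hle.mono fun _ h _ => h)

/-! ### Counting survivors -/

/-- Reindexing of a sum along a sequence of indices which increases by steps of zero or one. -/
lemma sum_range_of_steps {ρ : ℕ → ℕ} {n : ℕ} (h0 : ρ 0 = 1)
    (hstep : ∀ i < n, ρ (i + 1) = ρ i ∨ ρ (i + 1) = ρ i + 1) (F : ℕ → ℝ) (G : ℕ → ℝ)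
    (hdead : ∀ i < n, ρ (i + 1) = ρ i → G i = 0)
    (halive : ∀ i < n, ρ (i + 1) = ρ i + 1 → G i = F (ρ i)) :
    ∑ i ∈ Finset.range n, G i = ∑ k ∈ Finset.Ico 1 (ρ n), F k := by
  have hpos : ∀ i ≤ n, 1 ≤ ρ i := by
    intro i hi
    induction i with
    | zero => omega
    | succ i ih => rcases hstep i (by omega) with h | h <;> have := ih (by omega) <;> omega
  induction n with
  | zero => simp [h0]
  | succ n ih =>
    rw [Finset.sum_range_succ, ih (fun i hi => hstep i (by omega)) (fun i hi => hdead i (by omega))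
      (fun i hi => halive i (by omega)) (fun i hi => hpos i (by omega))]
    rcases hstep n (by omega) with h | h
    · rw [hdead n (by omega) h, h, add_zero]
    · rw [halive n (by omega) h, h, Finset.sum_Ico_succ_top (hpos n (by omega))]

/-- A sequence that increases by steps of zero or one takes all intermediate values, with a step after
each of them. -/
lemma exists_step {ρ : ℕ → ℕ} {n : ℕ} (h0 : ρ 0 = 1)
    (hstep : ∀ i < n, ρ (i + 1) = ρ i ∨ ρ (i + 1) = ρ i + 1) {k : ℕ} (hk : k ∈ Ico 1 (ρ n)) :
    ∃ i < n, ρ i = k ∧ ρ (i + 1) = k + 1 := by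
  induction n with
  | zero => rw [h0] at hk; exact absurd hk.2 (not_lt.2 hk.1)
  | succ n ih =>
    by_cases hlt : k < ρ n
    · obtain ⟨i, hi, h⟩ := ih (fun i hi => hstep i (by omega)) ⟨hk.1, hlt⟩
      exact ⟨i, by omega, h⟩
    · have h2 := hk.2
      rcases hstep n (by omega) with h | h
      · omega
      · exact ⟨n, by omega, by omega, by omega⟩

open Classical in
/-- The position of `i` after the deletion of all `k < i` that do not satisfy `P`. -/
noncomputable def survivorIndex (P : ℕ → Prop) (i : ℕ) : ℕ :=
  1 + ((Finset.Ico 1 i).filter P).card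

lemma survivorIndex_one (P : ℕ → Prop) : survivorIndex P 1 = 1 := by
  simp [survivorIndex]

lemma survivorIndex_succ_of {P : ℕ → Prop} {i : ℕ} (hi : 1 ≤ i) (hP : P i) :
    survivorIndex P (i + 1) = survivorIndex P i + 1 := by
  classical
  have : Finset.Ico 1 (i + 1) = insert i (Finset.Ico 1 i) :=
    (Finset.insert_Ico_right_eq_Ico_add_one hi).symm
  rw [survivorIndex, survivorIndex, this, Finset.filter_insert, if_pos hP,
    Finset.card_insert_of_notMem (by simp)]
  ring

lemma survivorIndex_succ_of_not {P : ℕ → Prop} {i : ℕ} (hi : 1 ≤ i) (hP : ¬ P i) :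
    survivorIndex P (i + 1) = survivorIndex P i := by
  classical
  have : Finset.Ico 1 (i + 1) = insert i (Finset.Ico 1 i) :=
    (Finset.insert_Ico_right_eq_Ico_add_one hi).symm
  rw [survivorIndex, survivorIndex, this, Finset.filter_insert, if_neg hP]

/-- Two increasing enumerations of the set of survivors agree. -/
lemma enumeration_survivorIndex {e e' : ℕ → ℕ} {n m : ℕ} {P : ℕ → Prop}
    (he : StrictMonoOn e (Icc 1 n)) (he' : StrictMonoOn e' (Icc 1 m))
    (himg : e' '' Icc 1 m = e '' {i | i ∈ Icc 1 n ∧ (i < n → P i)}) {i : ℕ} (hi : i ∈ Icc 1 n)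
    (hP : i < n → P i) : survivorIndex P i ∈ Icc 1 m ∧ e' (survivorIndex P i) = e i := by
  classical
  obtain ⟨p, hp, hpe⟩ : e i ∈ e' '' Icc 1 m := by rw [himg]; exact ⟨i, ⟨hi, hP⟩, rfl⟩
  suffices h : survivorIndex P i = p by rw [h]; exact ⟨hp, hpe⟩
  have hset : ((Finset.Ico 1 i).filter P).image e = (Finset.Ico 1 p).image e' := by
    ext q
    simp only [Finset.mem_image, Finset.mem_filter, Finset.mem_Ico]
    constructor
    · rintro ⟨k, ⟨⟨hk1, hk2⟩, hkP⟩, rfl⟩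
      have hkn : k ∈ Icc 1 n := ⟨hk1, hk2.le.trans hi.2⟩
      obtain ⟨r, hr, hre⟩ : e k ∈ e' '' Icc 1 m := by rw [himg]; exact ⟨k, ⟨hkn, fun _ => hkP⟩, rfl⟩
      refine ⟨r, ⟨hr.1, ?_⟩, hre⟩
      rw [← he'.lt_iff_lt hr hp, hre, hpe]
      exact he hkn hi hk2
    · rintro ⟨r, ⟨hr1, hr2⟩, rfl⟩
      have hrm : r ∈ Icc 1 m := ⟨hr1, hr2.le.trans hp.2⟩
      obtain ⟨k, ⟨hk, hkP⟩, hke⟩ : e' r ∈ e '' {i | i ∈ Icc 1 n ∧ (i < n → P i)} := by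
        rw [← himg]; exact ⟨r, hrm, rfl⟩
      have hki : k < i := by
        rw [← he.lt_iff_lt hk hi, hke, ← hpe]
        exact he' hrm hp hr2
      exact ⟨k, ⟨⟨hk.1, hki⟩, hkP (hki.trans_le hi.2)⟩, hke⟩
  have hcard := congrArg Finset.card hset
  rw [Finset.card_image_of_injOn, Finset.card_image_of_injOn, Nat.card_Ico] at hcard
  · rw [survivorIndex, hcard]
    have := hp.1
    omega
  · intro a ha b hb hab
    simp only [Finset.coe_Ico] at ha hb
    exact he'.injOn ⟨ha.1, ha.2.le.trans hp.2⟩ ⟨hb.1, hb.2.le.trans hp.2⟩ hab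
  · intro a ha b hb hab
    simp only [Finset.coe_filter, Finset.mem_Ico] at ha hb
    exact he.injOn ⟨ha.1.1, ha.1.2.le.trans hi.2⟩ ⟨hb.1.1, hb.1.2.le.trans hi.2⟩ hab

/-- The last index survives, and it becomes the last one of the new enumeration. -/
lemma survivorIndex_last {e e' : ℕ → ℕ} {n m : ℕ} {P : ℕ → Prop} (hn : 1 ≤ n)
    (he : StrictMonoOn e (Icc 1 n)) (he' : StrictMonoOn e' (Icc 1 m))
    (himg : e' '' Icc 1 m = e '' {i | i ∈ Icc 1 n ∧ (i < n → P i)}) :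
    survivorIndex P n = m := by
  obtain ⟨h1, h2⟩ := enumeration_survivorIndex he he' himg (i := n) ⟨hn, le_rfl⟩
    (fun h => absurd h (lt_irrefl n))
  have hm : m ∈ Icc 1 m := ⟨h1.1.trans h1.2, le_rfl⟩
  obtain ⟨k, ⟨hk, _⟩, hke⟩ : e' m ∈ e '' {i | i ∈ Icc 1 n ∧ (i < n → P i)} := by
    rw [← himg]; exact ⟨m, hm, rfl⟩
  refine le_antisymm h1.2 ?_
  rw [← he'.le_iff_le hm h1, h2, ← hke]
  exact he.monotoneOn hk ⟨hn, le_rfl⟩ hk.2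

/-! ### The stages of the scheme -/

namespace ParticleData

/-- Particle `i` of stage `j` is not absorbed by its right neighbour at the end of the stage. -/
def Survives (S : ParticleData) (j i : ℕ) : Prop :=
  S.node j i (S.time (j + 1)) ≠ S.node j (i + 1) (S.time (j + 1))

/-- The number, in the enumeration of stage `j`, of the particle that the original particle `i + 1`
follows during this stage. -/
noncomputable def follow (S : ParticleData) : ℕ → ℕ → ℕ
  | 0, i => i + 1
  | j + 1, i => survivorIndex (S.Survives j) (S.follow j i)

/-- Length of the cell to the right of particle `k` of stage `j`. -/
def gap (S : ParticleData) (j k : ℕ) (t : ℝ) : ℝ := S.node j (k + 1) t - S.node j k t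

/-- The path of the original particle `i + 1`, continued after its absorption by the path of the
absorbing particle, and constant outside of `[0, T]`. -/
noncomputable def path (S : ParticleData) (T : ℝ) (i : ℕ) (t : ℝ) : ℝ :=
  S.node (S.stageAt (trunc T t)) (S.follow (S.stageAt (trunc T t)) i) (trunc T t)

end ParticleData

/-- The mass of the initial cell to the right of particle `i + 1`. -/
noncomputable def initialMass (u₀ : ℝ → ℝ) (x₀ : ℕ → ℝ) (i : ℕ) : ℝ :=
  initialDensity u₀ x₀ (i + 1) * (x₀ (i + 2) - x₀ (i + 1))

namespace IsParticlePathScheme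

variable {f u₀ : ℝ → ℝ} {N : ℕ} {x₀ : ℕ → ℝ} {T : ℝ} {S : ParticleData}

section Index

variable (hS : IsParticlePathScheme f u₀ N x₀ T S) (hN : 1 ≤ N)
include hS

lemma time_mono {i j : ℕ} (hij : i ≤ j) (hj : j ≤ S.stages) : S.time i ≤ S.time j := by
  induction j, hij using Nat.le_induction with
  | base => exact le_rfl
  | succ j _ ih => exact (ih (by omega)).trans (hS.time_lt j (by omega)).le

lemma time_nonneg {j : ℕ} (hj : j ≤ S.stages) : 0 ≤ S.time j := by
  rw [← hS.time_zero]; exact hS.time_mono (Nat.zero_le j) hj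

lemma time_le {j : ℕ} (hj : j ≤ S.stages) : S.time j ≤ T := by
  rw [← hS.time_last]; exact hS.time_mono hj le_rfl

lemma Icc_stage_subset {j : ℕ} (hj : j < S.stages) {t : ℝ}
    (ht : t ∈ Icc (S.time j) (S.time (j + 1))) : t ∈ Icc 0 T :=
  ⟨(hS.time_nonneg hj.le).trans ht.1, ht.2.trans (hS.time_le hj)⟩

lemma stageAt_eq {j : ℕ} (hj : j < S.stages) {t : ℝ}
    (ht : t ∈ Ico (S.time j) (S.time (j + 1))) : S.stageAt t = j := by
  rw [ParticleData.stageAt, Nat.findGreatest_eq_iff]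
  refine ⟨by omega, fun _ => ht.1, fun i hi hi' => ?_⟩
  have := hS.time_mono (show j + 1 ≤ i by omega) (by omega)
  exact not_le.2 (ht.2.trans_le this)

lemma stageAt_last : S.stageAt T + 1 = S.stages := by
  have h1 := hS.stages_pos
  have : S.stageAt T = S.stages - 1 := by
    rw [ParticleData.stageAt, Nat.findGreatest_eq_iff]
    exact ⟨le_rfl, fun _ => hS.time_le (by omega), fun i hi hi' => absurd hi' (by omega)⟩
  omega

lemma exists_stage {t : ℝ} (ht : t ∈ Ico 0 T) :
    ∃ j < S.stages, t ∈ Ico (S.time j) (S.time (j + 1)) := by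
  have key : ∀ m ≤ S.stages, t < S.time m → ∃ j < S.stages, t ∈ Ico (S.time j) (S.time (j + 1)) := by
    intro m
    induction m with
    | zero => intro _ h; rw [hS.time_zero] at h; exact absurd ht.1 (not_le.2 h)
    | succ m ih =>
      intro hm h
      rcases lt_or_ge t (S.time m) with h1 | h1
      · exact ih (by omega) h1
      · exact ⟨m, by omega, h1, h⟩
  exact key S.stages le_rfl (by rw [hS.time_last]; exact ht.2)

lemma exists_stage_Icc {t : ℝ} (ht : t ∈ Icc 0 T) :
    ∃ j < S.stages, t ∈ Icc (S.time j) (S.time (j + 1)) ∧ S.stageAt t = j := by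
  rcases ht.2.lt_or_eq with h | rfl
  · obtain ⟨j, hj, hm⟩ := hS.exists_stage ⟨ht.1, h⟩
    exact ⟨j, hj, Ico_subset_Icc_self hm, hS.stageAt_eq hj hm⟩
  · have h1 := hS.stageAt_last
    refine ⟨S.stageAt t, by omega, ⟨hS.time_le (by omega), ?_⟩, rfl⟩
    rw [h1, hS.time_last]

lemma idx_strictMono {j : ℕ} (hj : j < S.stages) : StrictMonoOn (S.idx j) (Icc 1 (S.count j)) := by
  rcases j with - | j
  · intro a ha b hb hab
    rw [hS.count_zero] at ha hb
    rw [hS.idx_zero a ha.2, hS.idx_zero b hb.2]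
    exact hab
  · exact hS.idx_mono j hj

lemma survivors_eq {j : ℕ} (hj : j + 1 < S.stages) :
    S.idx (j + 1) '' Icc 1 (S.count (j + 1)) =
      S.idx j '' {i | i ∈ Icc 1 (S.count j) ∧ (i < S.count j → S.Survives j i)} :=
  hS.survivors j hj

lemma idx_first {j : ℕ} (hj : j < S.stages) : S.idx j 0 = 0 := by
  rcases j with - | j
  · exact hS.idx_zero 0 (Nat.zero_le N)
  · exact hS.idx_left j hj

/-- A particle and the one that it follows in the next stage are at the same place at the collision
time. -/
lemma node_survivorIndex {j : ℕ} (hj : j + 1 < S.stages) {p : ℕ} (hp : p ∈ Icc 1 (S.count j)) :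
    S.node (j + 1) (survivorIndex (S.Survives j) p) (S.time (j + 1)) =
      S.node j p (S.time (j + 1)) := by
  obtain ⟨d, hd⟩ : ∃ d, p + d = S.count j := ⟨S.count j - p, by have := hp.2; omega⟩
  induction d generalizing p with
  | zero =>
    have h := enumeration_survivorIndex (hS.idx_strictMono (show j < S.stages by omega))
      (hS.idx_strictMono hj) (hS.survivors_eq hj) hp (fun h => absurd h (by omega))
    rw [ParticleData.node, h.2, ParticleData.node]
  | succ d ih =>
    by_cases hs : S.Survives j p
    · have h := enumeration_survivorIndex (hS.idx_strictMono (show j < S.stages by omega))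
        (hS.idx_strictMono hj) (hS.survivors_eq hj) hp (fun _ => hs)
      rw [ParticleData.node, h.2, ParticleData.node]
    · have h := ih (p := p + 1) ⟨by omega, by omega⟩ (by omega)
      rw [survivorIndex_succ_of_not hp.1 hs] at h
      rw [h]
      exact (not_not.1 hs).symm

include hN

lemma count_pos_and_idx_last {j : ℕ} (hj : j < S.stages) :
    1 ≤ S.count j ∧ S.idx j (S.count j) = N := by
  induction j with
  | zero => rw [hS.count_zero]; exact ⟨hN, hS.idx_zero N le_rfl⟩
  | succ j ih =>
    obtain ⟨h1, h2⟩ := ih (by omega)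
    have he := hS.idx_strictMono (show j < S.stages by omega)
    have he' := hS.idx_strictMono hj
    have h3 := enumeration_survivorIndex he he' (hS.survivors_eq hj) (i := S.count j) ⟨h1, le_rfl⟩
      (fun h => absurd h (lt_irrefl _))
    rw [survivorIndex_last h1 he he' (hS.survivors_eq hj)] at h3
    exact ⟨h3.1.1, h3.2.trans h2⟩

lemma survivorIndex_count {j : ℕ} (hj : j + 1 < S.stages) :
    survivorIndex (S.Survives j) (S.count j) = S.count (j + 1) :=
  survivorIndex_last (hS.count_pos_and_idx_last hN (by omega)).1
    (hS.idx_strictMono (by omega)) (hS.idx_strictMono hj) (hS.survivors_eq hj)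

/-- The numbers of the followed particles, as the original particle varies, run through the enumeration
of the stage by steps of zero (the two particles have merged) or one. -/
lemma follow_props {j : ℕ} (hj : j < S.stages) :
    S.follow j 0 = 1 ∧ S.follow j (N - 1) = S.count j ∧
    (∀ i < N - 1, S.follow j (i + 1) = S.follow j i ∨ S.follow j (i + 1) = S.follow j i + 1) ∧
    ∀ i, 1 ≤ S.follow j i := by
  induction j with
  | zero =>
    refine ⟨rfl, ?_, fun i _ => .inr rfl, fun i => Nat.le_add_left 1 i⟩
    rw [hS.count_zero, ParticleData.follow]; omega
  | succ j ih =>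
    obtain ⟨h1, h2, h3, h4⟩ := ih (by omega)
    refine ⟨?_, ?_, fun i hi => ?_, fun i => Nat.le_add_right 1 _⟩
    · rw [ParticleData.follow, h1, survivorIndex_one]
    · rw [ParticleData.follow, h2, hS.survivorIndex_count hN hj]
    · rw [ParticleData.follow, ParticleData.follow]
      rcases h3 i hi with h | h
      · exact .inl (by rw [h])
      · rw [h]
        by_cases hs : S.Survives j (S.follow j i)
        · exact .inr (survivorIndex_succ_of (h4 i) hs)
        · exact .inl (survivorIndex_succ_of_not (h4 i) hs)

lemma follow_mono {j : ℕ} (hj : j < S.stages) {i i' : ℕ} (hii : i ≤ i') (hi : i' ≤ N - 1) :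
    S.follow j i ≤ S.follow j i' := by
  induction i', hii using Nat.le_induction with
  | base => exact le_rfl
  | succ m _ ih =>
    have := ih (by omega)
    rcases (hS.follow_props hN hj).2.2.1 m (by omega) with h | h <;> omega

lemma follow_mem {j : ℕ} (hj : j < S.stages) {i : ℕ} (hi : i ≤ N - 1) :
    S.follow j i ∈ Icc 1 (S.count j) := by
  refine ⟨(hS.follow_props hN hj).2.2.2 i, ?_⟩
  rw [← (hS.follow_props hN hj).2.1]
  exact hS.follow_mono hN hj hi le_rfl

lemma follow_mem_Ico {j : ℕ} (hj : j < S.stages) {i : ℕ} (hi : i < N - 1)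
    (ha : S.follow j (i + 1) = S.follow j i + 1) : S.follow j i ∈ Ico 1 (S.count j) := by
  have h1 := hS.follow_mem hN hj hi.le
  have h2 := hS.follow_mem hN hj (show i + 1 ≤ N - 1 from hi)
  exact ⟨h1.1, by have := h2.2; omega⟩

lemma node_follow_succ {j : ℕ} (hj : j + 1 < S.stages) {i : ℕ} (hi : i ≤ N - 1) :
    S.node (j + 1) (S.follow (j + 1) i) (S.time (j + 1)) =
      S.node j (S.follow j i) (S.time (j + 1)) := by
  rw [ParticleData.follow]
  exact hS.node_survivorIndex hj (hS.follow_mem hN (by omega) hi)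

/-- During a stage, the end of the stage included, the path of an original particle is the path of
the particle that it follows. -/
lemma path_eq {j : ℕ} (hj : j < S.stages) {i : ℕ} (hi : i ≤ N - 1) {t : ℝ}
    (ht : t ∈ Icc (S.time j) (S.time (j + 1))) : S.path T i t = S.node j (S.follow j i) t := by
  have ht' := hS.Icc_stage_subset hj ht
  rw [ParticleData.path, trunc_of_mem ht'.1 ht'.2]
  rcases ht.2.lt_or_eq with h | h
  · rw [hS.stageAt_eq hj ⟨ht.1, h⟩]
  · rcases (show j + 1 ≤ S.stages from hj).lt_or_eq with h1 | h1
    · rw [h, hS.stageAt_eq h1 ⟨le_rfl, hS.time_lt _ h1⟩, hS.node_follow_succ hN h1 hi]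
    · have hT : t = T := by rw [h, h1, hS.time_last]
      have := hS.stageAt_last
      rw [hT, show S.stageAt T = j by omega]

end Index

/-! ### The maximum principle for the local densities -/

/-- A cell whose density is maximal does not shrink: both of its end points move at velocities that
are separated by the velocity `a` of the cell. -/
lemma _root_.ParticleData.gap_deriv_nonneg_of_max {K : ℝ≥0}
    (hf : LipschitzWith K f) (hf0 : f 0 = 0) {j k : ℕ} {t : ℝ}
    (hl : S.cellDens j (k - 1) t ≤ S.cellDens j k t)
    (hr : S.cellDens j (k + 1) t ≤ S.cellDens j k t) :
    0 ≤ S.nodeVel f j (k + 1) t - S.nodeVel f j k t := by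
  have h1 := particleVelocity_le hf hf0 hl le_rfl
  have h2 := le_particleVelocity hf hf0 hr le_rfl
  rw [ParticleData.nodeVel, ParticleData.nodeVel, Nat.add_sub_cancel]
  linarith

section MaxPrinciple

variable (hS : IsParticlePathScheme f u₀ N x₀ T S)
include hS

lemma gap_pos {j : ℕ} (hj : j < S.stages) {k : ℕ} (hk : k ∈ Ico 1 (S.count j)) {t : ℝ}
    (ht : t ∈ Ico (S.time j) (S.time (j + 1))) : 0 < S.gap j k t :=
  sub_pos.2 (hS.ordered j hj t ht k hk)

lemma gap_continuousOn {j : ℕ} (hj : j < S.stages) {k : ℕ} (hk : k ∈ Ico 1 (S.count j)) :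
    ContinuousOn (S.gap j k) (Icc (S.time j) (S.time (j + 1))) :=
  (hS.pos_cont j hj (k + 1) ⟨by omega, hk.2⟩).sub (hS.pos_cont j hj k ⟨hk.1, hk.2.le⟩)

lemma gap_nonneg {j : ℕ} (hj : j < S.stages) {k : ℕ} (hk : k ∈ Ico 1 (S.count j)) {t : ℝ}
    (ht : t ∈ Icc (S.time j) (S.time (j + 1))) : 0 ≤ S.gap j k t := by
  have hcl : closure (Ico (S.time j) (S.time (j + 1))) = Icc (S.time j) (S.time (j + 1)) :=
    closure_Ico (hS.time_lt j hj).ne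
  have := hS.gap_continuousOn hj hk
  rw [← hcl] at this ht
  exact le_on_closure (f := fun _ => 0) (fun s hs => (hS.gap_pos hj hk hs).le)
    continuousOn_const this ht

lemma dens_law_gap {j : ℕ} (hj : j < S.stages) {k : ℕ} (hk : k ∈ Ico 1 (S.count j)) {t : ℝ}
    (ht : t ∈ Icc (S.time j) (S.time (j + 1))) :
    S.cellDens j k t = S.gap j k (S.time j) * S.cellDens j k (S.time j) / S.gap j k t := by
  rw [hS.dens_law j hj k hk t ht, ParticleData.gap, ParticleData.gap]
  ring

lemma cellDens_continuousOn {j : ℕ} (hj : j < S.stages) {k : ℕ} (hk : k ∈ Ico 1 (S.count j)) :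
    ContinuousOn (S.cellDens j k) (Ico (S.time j) (S.time (j + 1))) := by
  refine ContinuousOn.congr (f := fun t =>
    S.gap j k (S.time j) * S.cellDens j k (S.time j) / S.gap j k t) ?_
    (fun t ht => hS.dens_law_gap hj hk (Ico_subset_Icc_self ht))
  exact continuousOn_const.div ((hS.gap_continuousOn hj hk).mono Ico_subset_Icc_self)
    (fun t ht => (hS.gap_pos hj hk ht).ne')

lemma hasDerivAt_gap {j : ℕ} (hj : j < S.stages) {k : ℕ} (hk : k ∈ Ico 1 (S.count j)) {t : ℝ}
    (ht : t ∈ Ioo (S.time j) (S.time (j + 1))) :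
    HasDerivAt (S.gap j k) (S.nodeVel f j (k + 1) t - S.nodeVel f j k t) t :=
  (hS.pos_ode j hj (k + 1) ⟨by omega, hk.2⟩ t ht).sub (hS.pos_ode j hj k ⟨hk.1, hk.2.le⟩ t ht)

lemma hasDerivAt_cellDens {j : ℕ} (hj : j < S.stages) {k : ℕ} (hk : k ∈ Ico 1 (S.count j)) {t : ℝ}
    (ht : t ∈ Ioo (S.time j) (S.time (j + 1))) :
    HasDerivAt (S.cellDens j k) (-(S.cellDens j k t *
      (S.nodeVel f j (k + 1) t - S.nodeVel f j k t) / S.gap j k t)) t := by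
  have hg := (hS.gap_pos hj hk (Ioo_subset_Ico_self ht)).ne'
  have h := ((hS.hasDerivAt_gap hj hk ht).fun_inv hg).const_mul
    (S.gap j k (S.time j) * S.cellDens j k (S.time j))
  have h2 := h.congr_of_eventuallyEq (f₁ := S.cellDens j k) (by
    filter_upwards [Ioo_mem_nhds ht.1 ht.2] with s hs
    rw [hS.dens_law_gap hj hk (Ioo_subset_Icc_self hs), div_eq_mul_inv])
  refine h2.congr_deriv ?_
  rw [hS.dens_law_gap hj hk (Ioo_subset_Icc_self ht)]
  field_simp

lemma cellDens_zero (hN : 1 ≤ N) {j : ℕ} (hj : j < S.stages) {t : ℝ} (ht : t ∈ Icc 0 T) :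
    S.cellDens j 0 t = 0 ∧ S.cellDens j (S.count j) t = 0 := by
  rw [ParticleData.cellDens, ParticleData.cellDens, hS.idx_first hj,
    (hS.count_pos_and_idx_last hN hj).2]
  exact ⟨hS.dens_left t ht, hS.dens_right t ht⟩

/-- The maximum principle: an upper bound for the densities persists during a stage. -/
lemma cellDens_le (hN : 1 ≤ N) {K : ℝ≥0} (hf : LipschitzWith K f) (hf0 : f 0 = 0) {j : ℕ}
    (hj : j < S.stages) {M : ℝ} (hM : 0 ≤ M)
    (h1 : ∀ k ∈ Ico 1 (S.count j), S.cellDens j k (S.time j) ≤ M) {k : ℕ}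
    (hk : k ∈ Ico 1 (S.count j)) {t : ℝ} (ht : t ∈ Ico (S.time j) (S.time (j + 1))) :
    S.cellDens j k t ≤ M := by
  set τ := S.time j with hτ
  suffices H : ∀ ε > 0, S.cellDens j k t < M + ε * (1 + (t - τ)) by
    refine le_of_forall_pos_lt_add fun δ hδ => ?_
    have hpos : 0 < 1 + (t - τ) := by linarith [ht.1]
    have := H (δ / (1 + (t - τ))) (div_pos hδ hpos)
    rwa [div_mul_cancel₀ _ hpos.ne'] at this
  intro ε hε
  by_contra hcon
  rw [not_lt] at hcon
  -- the first time at which some density touches the slowly growing barrier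
  set Z : Set ℝ := ⋃ l ∈ Finset.Ico 1 (S.count j),
    {r ∈ Icc τ t | M + ε * (1 + (r - τ)) ≤ S.cellDens j l r} with hZ
  have hsub : Icc τ t ⊆ Ico τ (S.time (j + 1)) := fun r hr => ⟨hr.1, hr.2.trans_lt ht.2⟩
  have hZc : IsClosed Z := by
    refine isClosed_biUnion_finset fun l hl => ?_
    refine isClosed_Icc.isClosed_le (by fun_prop) ?_
    exact (hS.cellDens_continuousOn hj (by simpa using hl)).mono hsub
  have hZne : Z.Nonempty :=
    ⟨t, mem_biUnion (show k ∈ Finset.Ico 1 (S.count j) by simpa using hk) ⟨⟨ht.1, le_rfl⟩, hcon⟩⟩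
  have hZb : BddBelow Z := ⟨τ, by
    intro r hr
    simp only [hZ, mem_iUnion] at hr
    obtain ⟨l, _, hr⟩ := hr
    exact hr.1.1⟩
  have hmem := hZc.csInf_mem hZne hZb
  set s := sInf Z with hs
  rw [hZ] at hmem
  simp only [mem_iUnion] at hmem
  obtain ⟨l, hl, hsm, hsl⟩ := hmem
  have hl' : l ∈ Ico 1 (S.count j) := by simpa using hl
  have hτs : τ < s := by
    rcases hsm.1.lt_or_eq with h | h
    · exact h
    · exfalso
      rw [← h] at hsl
      have := h1 l hl'
      linarith
  have hsI : s ∈ Ioo τ (S.time (j + 1)) := ⟨hτs, (hsub hsm).2⟩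
  have hbefore : ∀ q ∈ Ico 1 (S.count j), ∀ r ∈ Ico τ s,
      S.cellDens j q r < M + ε * (1 + (r - τ)) := by
    intro q hq r hr
    by_contra hge
    have hrZ : r ∈ Z := mem_biUnion (show q ∈ Finset.Ico 1 (S.count j) by simpa using hq)
      ⟨⟨hr.1, hr.2.le.trans hsm.2⟩, not_lt.1 hge⟩
    exact absurd (csInf_le hZb hrZ) (not_le.2 hr.2)
  have hat : ∀ q ∈ Ico 1 (S.count j), S.cellDens j q s ≤ M + ε * (1 + (s - τ)) := by
    intro q hq
    have hc := (hS.cellDens_continuousOn hj hq).mono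
      (show Icc τ s ⊆ Ico τ (S.time (j + 1)) from fun r hr => ⟨hr.1, hr.2.trans_lt hsI.2⟩)
    have hcl : closure (Ico τ s) = Icc τ s := closure_Ico hτs.ne
    rw [← hcl] at hc
    exact le_on_closure (g := fun r => M + ε * (1 + (r - τ)))
      (fun r hr => (hbefore q hq r hr).le) hc (by fun_prop)
      (by rw [hcl]; exact ⟨hτs.le, le_rfl⟩)
  have hBpos : 0 ≤ M + ε * (1 + (s - τ)) := by
    have : 0 ≤ ε * (1 + (s - τ)) := mul_nonneg hε.le (by linarith)
    linarith
  have hsT : s ∈ Icc 0 T := hS.Icc_stage_subset hj (Ioo_subset_Icc_self hsI)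
  have hall : ∀ q ≤ S.count j, S.cellDens j q s ≤ S.cellDens j l s := by
    intro q hq
    refine le_trans ?_ hsl
    rcases Nat.eq_zero_or_pos q with rfl | hq0
    · rw [(hS.cellDens_zero hN hj hsT).1]; exact hBpos
    · rcases hq.lt_or_eq with hq1 | rfl
      · exact hat q ⟨hq0, hq1⟩
      · rw [(hS.cellDens_zero hN hj hsT).2]; exact hBpos
  have hg := ParticleData.gap_deriv_nonneg_of_max hf hf0 (hall (l - 1) (by have := hl'.2; omega))
    (hall (l + 1) hl'.2)
  have hd := (hS.hasDerivAt_cellDens hj hl' hsI).sub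
    ((((hasDerivAt_id s).sub_const τ).const_add 1).const_mul ε |>.const_add M)
  have hnn := hd.nonneg_of_left_max hτs fun r hr => by
    have h3 := hbefore l hl' r ⟨hr.1.le, hr.2⟩
    simp only [Pi.sub_apply, id]
    linarith
  have hdens : 0 ≤ S.cellDens j l s := hBpos.trans hsl
  have h4 : 0 ≤ S.cellDens j l s *
      (S.nodeVel f j (l + 1) s - S.nodeVel f j l s) / S.gap j l s :=
    div_nonneg (mul_nonneg hdens hg) (hS.gap_pos hj hl' (Ioo_subset_Ico_self hsI)).le
  linarith

end MaxPrinciple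

end IsParticlePathScheme

/-! ### Conservation of the cell masses -/

namespace IsParticlePathScheme

variable {f u₀ : ℝ → ℝ} {N : ℕ} {x₀ : ℕ → ℝ} {T : ℝ} {S : ParticleData}

/-- The state of the cells at the beginning of stage `j`: a collapsed cell had zero mass, and the
density of any other cell is its initial mass divided by its length, and lies between `0` and `M`. -/
def MassInvariant (S : ParticleData) (u₀ : ℝ → ℝ) (N : ℕ) (x₀ : ℕ → ℝ) (M : ℝ) (j : ℕ) : Prop :=
  ∀ i < N - 1,
    (S.follow j (i + 1) = S.follow j i → initialMass u₀ x₀ i = 0) ∧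
    (S.follow j (i + 1) = S.follow j i + 1 →
      S.cellDens j (S.follow j i) (S.time j) =
        initialMass u₀ x₀ i / S.gap j (S.follow j i) (S.time j) ∧
      S.cellDens j (S.follow j i) (S.time j) ∈ Icc 0 M)

lemma initialDensity_nonneg (hu : 0 ≤ᵐ[volume] u₀) (hx₀ : StrictMonoOn x₀ (Icc 1 N)) {i : ℕ}
    (hi : i ∈ Ico 1 N) : 0 ≤ initialDensity u₀ x₀ i := by
  have hlt : x₀ i < x₀ (i + 1) := hx₀ ⟨hi.1, hi.2.le⟩ ⟨by omega, hi.2⟩ (Nat.lt_succ_self i)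
  refine div_nonneg (intervalIntegral.integral_nonneg_of_ae hlt.le hu) (sub_pos.2 hlt).le

section Mass

variable (hS : IsParticlePathScheme f u₀ N x₀ T S) (hN : 1 ≤ N) {K : ℝ≥0}
  (hf : LipschitzWith K f) (hf0 : f 0 = 0) {M : ℝ} (hM : 0 ≤ M)
include hS hN

lemma massInvariant_start (hu : 0 ≤ᵐ[volume] u₀) (hx₀ : StrictMonoOn x₀ (Icc 1 N))
    (hM : ∀ i ∈ Ico 1 N, initialDensity u₀ x₀ i ≤ M) : MassInvariant S u₀ N x₀ M 0 := by
  intro i hi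
  refine ⟨fun h => absurd h (by simp [ParticleData.follow]), fun _ => ?_⟩
  have hmem : i + 1 ∈ Ico 1 N := ⟨by omega, by omega⟩
  have hlt : x₀ (i + 1) < x₀ (i + 2) := hx₀ ⟨by omega, by omega⟩ ⟨by omega, by omega⟩ (by omega)
  have hd : S.cellDens 0 (S.follow 0 i) (S.time 0) = initialDensity u₀ x₀ (i + 1) := by
    rw [ParticleData.cellDens, ParticleData.follow, hS.idx_zero _ (by omega), hS.time_zero,
      hS.dens_init _ hmem]
  have hg : S.gap 0 (S.follow 0 i) (S.time 0) = x₀ (i + 2) - x₀ (i + 1) := by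
    rw [ParticleData.gap, ParticleData.node, ParticleData.node, ParticleData.follow,
      hS.idx_zero _ (by omega), hS.idx_zero _ (by omega), hS.time_zero,
      hS.pos_init _ ⟨by omega, by omega⟩, hS.pos_init _ ⟨by omega, by omega⟩]
  rw [hd, hg, initialMass, mul_div_cancel_right₀ _ (sub_pos.2 hlt).ne']
  exact ⟨rfl, initialDensity_nonneg hu hx₀ hmem, hM _ hmem⟩

include hf hf0 hM

/-- During a stage, its end included, the mass of a cell is conserved, and bounded by `M` times the
length of the cell. At the end of the stage the first identity may read `0 = 0` in the form of a
division by zero. -/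
lemma cell_mass {j : ℕ} (hj : j < S.stages) (hI : MassInvariant S u₀ N x₀ M j) {i : ℕ}
    (hi : i < N - 1) (ha : S.follow j (i + 1) = S.follow j i + 1) {t : ℝ}
    (ht : t ∈ Icc (S.time j) (S.time (j + 1))) :
    S.cellDens j (S.follow j i) t = initialMass u₀ x₀ i / S.gap j (S.follow j i) t ∧
      0 ≤ initialMass u₀ x₀ i ∧ initialMass u₀ x₀ i ≤ M * S.gap j (S.follow j i) t := by
  have hp := hS.follow_mem_Ico hN hj hi ha
  obtain ⟨h1, h2⟩ := (hI i hi).2 ha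
  have h0mem : S.time j ∈ Ico (S.time j) (S.time (j + 1)) := ⟨le_rfl, hS.time_lt j hj⟩
  have hg0 := hS.gap_pos hj hp h0mem
  have hmass : S.gap j (S.follow j i) (S.time j) * S.cellDens j (S.follow j i) (S.time j) =
      initialMass u₀ x₀ i := by
    rw [h1, mul_div_cancel₀ _ hg0.ne']
  have hall : ∀ k ∈ Ico 1 (S.count j), S.cellDens j k (S.time j) ≤ M := by
    intro k hk
    have hfp := hS.follow_props hN hj
    rw [← hfp.2.1] at hk
    obtain ⟨q, hq, hq1, hq2⟩ := exists_step hfp.1 hfp.2.2.1 hk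
    have := ((hI q hq).2 (by omega)).2.2
    rwa [hq1] at this
  refine ⟨by rw [hS.dens_law_gap hj hp ht, hmass], ?_, ?_⟩
  · rw [← hmass]; exact mul_nonneg hg0.le h2.1
  · have hcl : closure (Ico (S.time j) (S.time (j + 1))) = Icc (S.time j) (S.time (j + 1)) :=
      closure_Ico (hS.time_lt j hj).ne
    have hc := (hS.gap_continuousOn hj hp).const_mul M
    rw [← hcl] at hc ht
    refine le_on_closure (f := fun _ => initialMass u₀ x₀ i) (fun s hs => ?_)
      continuousOn_const hc ht
    have h3 := hS.cellDens_le hN hf hf0 hj hM hall hp hs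
    rwa [hS.dens_law_gap hj hp (Ico_subset_Icc_self hs), hmass,
      div_le_iff₀ (hS.gap_pos hj hp hs)] at h3

/-- By the maximum principle a cell that collapses has zero mass. -/
lemma massInvariant_succ {j : ℕ} (hj : j + 1 < S.stages) (hI : MassInvariant S u₀ N x₀ M j) :
    MassInvariant S u₀ N x₀ M (j + 1) := by
  have hj' : j < S.stages := by omega
  intro i hi
  have hend : S.time (j + 1) ∈ Icc (S.time j) (S.time (j + 1)) := ⟨(hS.time_lt j hj').le, le_rfl⟩
  rcases (hS.follow_props hN hj').2.2.1 i hi with hd | ha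
  · refine ⟨fun _ => (hI i hi).1 hd, fun h => absurd h ?_⟩
    rw [ParticleData.follow, ParticleData.follow, hd]
    omega
  · obtain ⟨h1, h2, h3⟩ := hS.cell_mass hN hf hf0 hM hj' hI hi ha hend
    have hp := hS.follow_mem_Ico hN hj' hi ha
    by_cases hs : S.Survives j (S.follow j i)
    · have hsucc : S.follow (j + 1) (i + 1) = S.follow (j + 1) i + 1 := by
        rw [ParticleData.follow, ParticleData.follow, ha]
        exact survivorIndex_succ_of hp.1 hs
      refine ⟨fun h => absurd h (by omega), fun _ => ?_⟩
      have hidx := (enumeration_survivorIndex (hS.idx_strictMono hj') (hS.idx_strictMono hj)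
        (hS.survivors_eq hj) ⟨hp.1, hp.2.le⟩ (fun _ => hs)).2
      have hdens : S.cellDens (j + 1) (S.follow (j + 1) i) (S.time (j + 1)) =
          S.cellDens j (S.follow j i) (S.time (j + 1)) := by
        rw [ParticleData.cellDens, ParticleData.cellDens, ParticleData.follow, hidx]
      have hgap : S.gap (j + 1) (S.follow (j + 1) i) (S.time (j + 1)) =
          S.gap j (S.follow j i) (S.time (j + 1)) := by
        rw [ParticleData.gap, ParticleData.gap, ← hsucc, ← ha, hS.node_follow_succ hN hj hi.le,
          hS.node_follow_succ hN hj hi]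
      have hgn := hS.gap_nonneg hj' hp hend
      rw [hdens, hgap, h1]
      exact ⟨rfl, div_nonneg h2 hgn, div_le_of_le_mul₀ hgn hM h3⟩
    · have hz : S.gap j (S.follow j i) (S.time (j + 1)) = 0 := by
        rw [ParticleData.gap, sub_eq_zero]
        exact (not_not.1 hs).symm
      rw [hz, mul_zero] at h3
      refine ⟨fun _ => le_antisymm h3 h2, fun h => absurd h ?_⟩
      rw [ParticleData.follow, ParticleData.follow, ha, survivorIndex_succ_of_not hp.1 hs]
      omega

lemma massInvariant (hu : 0 ≤ᵐ[volume] u₀) (hx₀ : StrictMonoOn x₀ (Icc 1 N))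
    (hM' : ∀ i ∈ Ico 1 N, initialDensity u₀ x₀ i ≤ M) {j : ℕ} (hj : j < S.stages) :
    MassInvariant S u₀ N x₀ M j := by
  induction j with
  | zero => exact hS.massInvariant_start hN hu hx₀ hM'
  | succ j ih => exact hS.massInvariant_succ hN hf hf0 hM hj (ih (by omega))

end Mass

/-! ### The particle paths form a path system -/

lemma _root_.ParticleData.path_trunc (S : ParticleData) {T : ℝ} (hT : 0 ≤ T) (i : ℕ) (t : ℝ) : S.path T i (trunc T t) = S.path T i t := by
  rw [ParticleData.path, ParticleData.path, trunc_of_mem (trunc_nonneg T t) (trunc_le hT t)]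

section Paths

variable (hS : IsParticlePathScheme f u₀ N x₀ T S) (hN : 1 ≤ N)
include hS

lemma exists_stage_Ioo {t : ℝ} (ht : t ∈ Ioo 0 T) (hE : t ∉ S.time '' Iic S.stages) :
    ∃ j < S.stages, t ∈ Ioo (S.time j) (S.time (j + 1)) := by
  obtain ⟨j, hj, hm⟩ := hS.exists_stage (Ioo_subset_Ico_self ht)
  refine ⟨j, hj, lt_of_le_of_ne hm.1 fun h => hE ⟨j, hj.le, h⟩, hm.2⟩

/-- Off the collision times the paths are constant or follow a particle. -/
lemma path_deriv_cases (hT : 0 ≤ T) {t : ℝ} (hE : t ∉ S.time '' Iic S.stages) :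
    (∀ i, HasDerivAt (S.path T i) 0 t) ∨
      ∃ j < S.stages, t ∈ Ioo (S.time j) (S.time (j + 1)) := by
  have hne0 : t ≠ 0 := fun h => hE ⟨0, Nat.zero_le _, by rw [hS.time_zero, h]⟩
  have hneT : t ≠ T := fun h => hE ⟨S.stages, mem_Iic.2 le_rfl, by rw [hS.time_last, h]⟩
  rcases lt_or_gt_of_ne hne0 with h0 | h0
  · left
    intro i
    refine (hasDerivAt_const t (S.path T i 0)).congr_of_eventuallyEq ?_
    filter_upwards [Iio_mem_nhds h0] with s hs
    rw [← S.path_trunc hT i s, trunc_of_nonpos (le_of_lt hs)]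
  · rcases lt_or_gt_of_ne hneT with h1 | h1
    · exact .inr (hS.exists_stage_Ioo ⟨h0, h1⟩ hE)
    · left
      intro i
      refine (hasDerivAt_const t (S.path T i T)).congr_of_eventuallyEq ?_
      filter_upwards [Ioi_mem_nhds h1] with s hs
      rw [← S.path_trunc hT i s, trunc_of_ge hT (le_of_lt hs)]

include hN

lemma path_succ_sub {j : ℕ} (hj : j < S.stages) {i : ℕ} (hi : i < N - 1)
    (ha : S.follow j (i + 1) = S.follow j i + 1) {t : ℝ}
    (ht : t ∈ Icc (S.time j) (S.time (j + 1))) :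
    S.path T (i + 1) t - S.path T i t = S.gap j (S.follow j i) t := by
  rw [hS.path_eq hN hj hi.le ht, hS.path_eq hN hj hi ht, ha, ParticleData.gap]

lemma path_succ_eq {j : ℕ} (hj : j < S.stages) {i : ℕ} (hi : i < N - 1)
    (hd : S.follow j (i + 1) = S.follow j i) {t : ℝ}
    (ht : t ∈ Icc (S.time j) (S.time (j + 1))) : S.path T (i + 1) t = S.path T i t := by
  rw [hS.path_eq hN hj hi.le ht, hS.path_eq hN hj hi ht, hd]

lemma path_start {i : ℕ} (hi : i ≤ N - 1) : S.path T i 0 = x₀ (i + 1) := by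
  have h0 : (0 : ℝ) ∈ Icc (S.time 0) (S.time (0 + 1)) := by
    rw [← hS.time_zero]; exact ⟨le_rfl, (hS.time_lt 0 hS.stages_pos).le⟩
  rw [hS.path_eq hN hS.stages_pos hi h0, ParticleData.follow, ParticleData.node, hS.idx_zero _ (by omega),
    hS.pos_init _ ⟨by omega, by omega⟩]

lemma continuous_path (hT : 0 ≤ T) {i : ℕ} (hi : i ≤ N - 1) : Continuous (S.path T i) := by
  have key : ∀ m ≤ S.stages, ContinuousOn (S.path T i) (Icc 0 (S.time m)) := by
    intro m
    induction m with
    | zero => intro _; rw [hS.time_zero, Icc_self]; exact continuousOn_singleton _ _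
    | succ m ih =>
      intro hm
      rw [← Icc_union_Icc_eq_Icc (hS.time_nonneg (show m ≤ S.stages by omega))
        (hS.time_lt m hm).le]
      refine (ih (by omega)).union_of_isClosed ?_ isClosed_Icc isClosed_Icc
      exact (hS.pos_cont m hm _ (hS.follow_mem hN hm hi)).congr
        fun t ht => hS.path_eq hN hm hi ht
  have h := key S.stages le_rfl
  rw [hS.time_last] at h
  have hc : Continuous (trunc T) := by unfold trunc; fun_prop
  exact (h.comp_continuous hc fun t => ⟨trunc_nonneg T t, trunc_le hT t⟩).congr
    fun t => S.path_trunc hT i t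

lemma hasDerivAt_path {j : ℕ} (hj : j < S.stages) {i : ℕ} (hi : i ≤ N - 1) {t : ℝ}
    (ht : t ∈ Ioo (S.time j) (S.time (j + 1))) :
    HasDerivAt (S.path T i) (S.nodeVel f j (S.follow j i) t) t := by
  refine (hS.pos_ode j hj _ (hS.follow_mem hN hj hi) t ht).congr_of_eventuallyEq ?_
  filter_upwards [Ioo_mem_nhds ht.1 ht.2] with s hs
  exact hS.path_eq hN hj hi (Ioo_subset_Icc_self hs)

variable {K : ℝ≥0} (hf : LipschitzWith K f) (hf0 : f 0 = 0) {M : ℝ} (hM : 0 ≤ M)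
  (hI : ∀ j < S.stages, MassInvariant S u₀ N x₀ M j)
include hf hf0

lemma lipschitzWith_path (hT : 0 ≤ T) {i : ℕ} (hi : i ≤ N - 1) : LipschitzWith K (S.path T i) := by
  refine lipschitzWith_of_hasDerivAt_off_finite (φ' := deriv (S.path T i))
    (hS.continuous_path hN hT hi) ((finite_Iic S.stages).image S.time) (fun t ht => ?_)
    fun t ht => ?_
  · rcases hS.path_deriv_cases hT ht with h | ⟨j, hj, hm⟩
    · exact (h i).differentiableAt.hasDerivAt
    · exact (hS.hasDerivAt_path hN hj hi hm).differentiableAt.hasDerivAt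
  · rcases hS.path_deriv_cases hT ht with h | ⟨j, hj, hm⟩
    · rw [(h i).deriv, abs_zero]; exact K.2
    · rw [(hS.hasDerivAt_path hN hj hi hm).deriv]
      exact abs_particleVelocity_le hf hf0 _ _

include hM hI

/-- The upper density bound in a form that includes collapsed cells, which therefore have no mass. -/
lemma mass_le_path {t : ℝ} (hT : 0 ≤ T) {i : ℕ} (hi : i < N - 1) :
    S.path T i t ≤ S.path T (i + 1) t ∧ 0 ≤ initialMass u₀ x₀ i ∧
      initialMass u₀ x₀ i ≤ M * (S.path T (i + 1) t - S.path T i t) := by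
  rw [← S.path_trunc hT i t, ← S.path_trunc hT (i + 1) t]
  obtain ⟨j, hj, hm, _⟩ := hS.exists_stage_Icc ⟨trunc_nonneg T t, trunc_le hT t⟩
  rcases (hS.follow_props hN hj).2.2.1 i hi with hd | ha
  · rw [hS.path_succ_eq hN hj hi hd hm, ((hI j hj) i hi).1 hd]
    simp
  · have hg := hS.path_succ_sub hN hj hi ha hm
    obtain ⟨-, h2, h3⟩ := hS.cell_mass hN hf hf0 hM hj (hI j hj) hi ha hm
    have h4 := hS.gap_nonneg hj (hS.follow_mem_Ico hN hj hi ha) hm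
    rw [hg]
    exact ⟨by linarith, h2, h3⟩

lemma cellDens_nonneg {j : ℕ} (hj : j < S.stages) {k : ℕ} (hk : k ≤ S.count j) {t : ℝ}
    (ht : t ∈ Icc (S.time j) (S.time (j + 1))) : 0 ≤ S.cellDens j k t := by
  have h0 := hS.cellDens_zero hN hj (hS.Icc_stage_subset hj ht)
  rcases Nat.eq_zero_or_pos k with rfl | hk0
  · exact h0.1.ge
  · rcases hk.lt_or_eq with hk1 | rfl
    · have hfp := hS.follow_props hN hj
      obtain ⟨q, hq, hq1, hq2⟩ := exists_step hfp.1 hfp.2.2.1 (k := k) ⟨hk0, by rwa [hfp.2.1]⟩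
      have ha : S.follow j (q + 1) = S.follow j q + 1 := by omega
      obtain ⟨h1, h2, -⟩ := hS.cell_mass hN hf hf0 hM hj (hI j hj) hq ha ht
      rw [← hq1, h1]
      exact div_nonneg h2 (hS.gap_nonneg hj (hS.follow_mem_Ico hN hj hq ha) ht)
    · exact h0.2.ge

/-- A cell without mass does not grow: its end points are separated by the velocity `a(0)`. The
length of a cell with mass is bounded below, and its rate of change is bounded. -/
lemma gap_growth {j : ℕ} (hj : j < S.stages) {i : ℕ} (hi : i < N - 1) {t : ℝ}
    (ht : t ∈ Ioo (S.time j) (S.time (j + 1))) :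
    S.nodeVel f j (S.follow j (i + 1)) t - S.nodeVel f j (S.follow j i) t ≤
      (∑ l ∈ Finset.range (N - 1), 2 * K * (M / initialMass u₀ x₀ l)) *
        (S.path T (i + 1) t - S.path T i t) := by
  have ht' := Ioo_subset_Icc_self ht
  have hT : 0 ≤ T := (hS.Icc_stage_subset hj ht').1.trans (hS.Icc_stage_subset hj ht').2
  have hsum : ∀ l ∈ Finset.range (N - 1), 0 ≤ 2 * (K : ℝ) * (M / initialMass u₀ x₀ l) := by
    intro l hl
    have := (hS.mass_le_path hN hf hf0 hM hI (t := t) hT (Finset.mem_range.1 hl)).2.1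
    positivity
  obtain ⟨hord, hm0, hmle⟩ := hS.mass_le_path hN hf hf0 hM hI (t := t) hT hi
  rcases (hS.follow_props hN hj).2.2.1 i hi with hd | ha
  · rw [hd, sub_self]
    exact mul_nonneg (Finset.sum_nonneg hsum) (sub_nonneg.2 hord)
  · have hp := hS.follow_mem_Ico hN hj hi ha
    rcases hm0.eq_or_lt with hz | hpos
    · have h1 := (hS.cell_mass hN hf hf0 hM hj (hI j hj) hi ha ht').1
      rw [← hz, zero_div] at h1
      have hl := hS.cellDens_nonneg hN hf hf0 hM hI hj (k := S.follow j i - 1)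
        (by have := hp.2; omega) ht'
      have hr := hS.cellDens_nonneg hN hf hf0 hM hI hj (k := S.follow j i + 1) hp.2 ht'
      have e1 : S.nodeVel f j (S.follow j (i + 1)) t ≤ fluxVelocity f 0 := by
        rw [ha, ParticleData.nodeVel, Nat.add_sub_cancel, h1]
        exact particleVelocity_le hf hf0 le_rfl hr
      have e2 : fluxVelocity f 0 ≤ S.nodeVel f j (S.follow j i) t := by
        rw [ParticleData.nodeVel, h1]
        exact le_particleVelocity hf hf0 le_rfl hl
      have := mul_nonneg (Finset.sum_nonneg hsum) (sub_nonneg.2 hord)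
      linarith
    · have e1 := abs_le.1 (abs_particleVelocity_le hf hf0
        (S.cellDens j (S.follow j (i + 1) - 1) t) (S.cellDens j (S.follow j (i + 1)) t))
      have e2 := abs_le.1 (abs_particleVelocity_le hf hf0
        (S.cellDens j (S.follow j i - 1) t) (S.cellDens j (S.follow j i) t))
      have h3 := Finset.single_le_sum hsum (Finset.mem_range.2 hi)
      have h4 := mul_le_mul_of_nonneg_right h3 (sub_nonneg.2 hord)
      have h5 : 2 * (K : ℝ) ≤ 2 * K * (M / initialMass u₀ x₀ i) *
          (S.path T (i + 1) t - S.path T i t) := by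
        have : 1 ≤ M / initialMass u₀ x₀ i * (S.path T (i + 1) t - S.path T i t) := by
          rw [div_mul_eq_mul_div, one_le_div hpos]; exact hmle
        have := mul_le_mul_of_nonneg_left this (show (0 : ℝ) ≤ 2 * K by positivity)
        linarith
      rw [ParticleData.nodeVel, ParticleData.nodeVel]
      linarith [e1.2, e2.1]

/-- The paths of the particles of a run form a system of coalescing paths. -/
theorem pathSystem (hT : 0 < T) :
    PathSystem (N - 1) (S.path T) (S.time '' Iic S.stages) T K
      (∑ l ∈ Finset.range (N - 1), 2 * K * (M / initialMass u₀ x₀ l)) where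
  pos := hT
  lip i hi := hS.lipschitzWith_path hN hf hf0 hT.le hi
  ord t i hi := (hS.mass_le_path hN hf hf0 hM hI hT.le hi).1
  const_left i _ t ht := by
    rw [← S.path_trunc hT.le i t, trunc_of_nonpos ht]
  const_right i _ t ht := by
    rw [← S.path_trunc hT.le i t, trunc_of_ge hT.le ht]
  finite := (finite_Iic S.stages).image S.time
  diff i hi t ht := by
    rcases hS.path_deriv_cases hT.le ht with h | ⟨j, hj, hm⟩
    · exact (h i).differentiableAt
    · exact (hS.hasDerivAt_path hN hj hi hm).differentiableAt
  growth_nonneg := Finset.sum_nonneg fun l hl => by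
    have := (hS.mass_le_path hN hf hf0 hM hI (t := 0) hT.le (Finset.mem_range.1 hl)).2.1
    positivity
  growth i hi t ht := by
    rcases hS.path_deriv_cases hT.le ht with h | ⟨j, hj, hm⟩
    · obtain ⟨hord, -, -⟩ := hS.mass_le_path hN hf hf0 hM hI (t := t) hT.le hi
      rw [(h i).deriv, (h (i + 1)).deriv, sub_self]
      refine mul_nonneg (Finset.sum_nonneg fun l hl => ?_) (sub_nonneg.2 hord)
      have := (hS.mass_le_path hN hf hf0 hM hI (t := 0) hT.le (Finset.mem_range.1 hl)).2.1
      positivity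
    · rw [(hS.hasDerivAt_path hN hj hi.le hm).deriv, (hS.hasDerivAt_path hN hj hi hm).deriv]
      exact hS.gap_growth hN hf hf0 hM hI hj hi hm

/-! ### Identification of the velocity field and of the density -/

/-- Off the collision times the two interpolations agree, also at the nodes. -/
lemma velocity_eq_pathField (hT : 0 < T) {t : ℝ} (ht : t ∈ Ioo 0 T)
    (hE : t ∉ S.time '' Iic S.stages) (x : ℝ) :
    S.velocity f x t = pathField (N - 1) (S.path T) x t := by
  have hP := hS.pathSystem hN hf hf0 hM hI hT
  obtain ⟨j, hj, hm⟩ := hS.exists_stage_Ioo ht hE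
  have hm' := Ioo_subset_Icc_self hm
  have hcol := hP.collapseCompat_deriv hE
  have hfp := hS.follow_props hN hj
  have hy : ∀ {i}, i ≤ N - 1 → S.path T i t = S.node j (S.follow j i) t := fun hi =>
    hS.path_eq hN hj hi hm'
  have hdy : ∀ {i}, i ≤ N - 1 → deriv (S.path T i) t = S.nodeVel f j (S.follow j i) t :=
    fun hi => (hS.hasDerivAt_path hN hj hi hm).deriv
  have hy0 := hy (Nat.zero_le _)
  have hyn := hy le_rfl
  have hd0 := hdy (Nat.zero_le _)
  have hdn := hdy le_rfl
  rw [hfp.1] at hy0 hd0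
  rw [hfp.2.1] at hyn hdn
  rw [ParticleData.velocity, hS.stageAt_eq hj (Ioo_subset_Ico_self hm), pathField]
  split_ifs with h1 h2
  · rw [pwLinear_left (hP.ord t) 0 (by simp only [hy0]; exact h1.le), hd0]; ring
  · rw [pwLinear_right (hP.ord t) hcol 0 (by simp only [hyn]; exact h2), hdn]; ring
  · rw [not_lt, ← hy0] at h1
    rw [not_le, ← hyn] at h2
    -- the last path that is not to the right of `x`
    obtain ⟨i, hi, hxi, hxi'⟩ : ∃ i < N - 1, S.path T i t ≤ x ∧ x < S.path T (i + 1) t := by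
      by_contra hcon
      push Not at hcon
      have : ∀ i ≤ N - 1, S.path T i t ≤ x := by
        intro i
        induction i with
        | zero => exact fun _ => h1
        | succ i ih => exact fun hi => hcon i hi (ih (by omega))
      exact absurd (this _ le_rfl) (not_le.2 h2)
    have ha : S.follow j (i + 1) = S.follow j i + 1 := by
      rcases hfp.2.2.1 i hi with hd | ha
      · rw [hS.path_succ_eq hN hj hi hd hm'] at hxi'
        exact absurd hxi (not_le.2 hxi')
      · exact ha
    have hp := hS.follow_mem_Ico hN hj hi ha
    have hyi := hy hi.le
    have hyi' := hy (show i + 1 ≤ N - 1 from hi)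
    have hdi := hdy hi.le
    have hdi' := hdy (show i + 1 ≤ N - 1 from hi)
    rw [ha] at hyi' hdi'
    rw [pwLinear_cell (hP.ord t) hcol 0 hi hxi hxi'.le, Finset.sum_eq_single (S.follow j i)]
    · rw [indicator_of_mem (by rw [← hyi, ← hyi']; exact ⟨hxi, hxi'⟩), ParticleData.interpVel,
        ← hyi, ← hyi', hdi, hdi']
      have hne : S.path T (i + 1) t - S.path T i t ≠ 0 := by linarith
      field_simp
      ring
    · intro k hk hki
      rw [Finset.mem_Ico, ← hfp.2.1] at hk
      obtain ⟨q, hq, hq1, hq2⟩ := exists_step hfp.1 hfp.2.2.1 hk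
      refine indicator_of_notMem ?_ _
      rw [← hq2, ← hq1, ← hy hq.le, ← hy (show q + 1 ≤ N - 1 from hq)]
      rintro ⟨h3, h4⟩
      rcases lt_trichotomy q i with h | h | h
      · have := (hP.ord t).le (show q + 1 ≤ i from h) hi.le
        linarith
      · exact hki (by rw [← hq1, h])
      · have := (hP.ord t).le (show i + 1 ≤ q from h) hq.le
        linarith
    · intro h
      exact absurd (Finset.mem_Ico.2 hp) h

/-- Cells between merged paths are empty intervals and do not contribute. -/
lemma approx_eq_pathDensity {t : ℝ} (ht : t ∈ Icc 0 T) (x : ℝ) :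
    S.approx x t = pathDensity (N - 1) (S.path T) (initialMass u₀ x₀) x t := by
  obtain ⟨j, hj, hm, hst⟩ := hS.exists_stage_Icc ht
  have hfp := hS.follow_props hN hj
  rw [ParticleData.approx, hst, pathDensity, stepFun, ← hfp.2.1]
  symm
  refine sum_range_of_steps hfp.1 hfp.2.2.1
    (fun k => (Ioo (S.node j k t) (S.node j (k + 1) t)).indicator (fun _ => S.cellDens j k t) x)
    _ (fun i hi hd => ?_) (fun i hi ha => ?_)
  · rw [hS.path_succ_eq hN hj hi hd hm, Ioo_self, indicator_empty]
  · rw [hS.path_succ_sub hN hj hi ha hm,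
      (hS.cell_mass hN hf hf0 hM hj (hI j hj) hi ha hm).1, hS.path_eq hN hj hi.le hm,
      hS.path_eq hN hj hi hm, ha]

omit hf hf0 hM hI in
lemma initialApprox_eq_pathDensity (hx₀ : StrictMonoOn x₀ (Icc 1 N)) (x : ℝ) :
    initialApprox u₀ N x₀ x = pathDensity (N - 1) (S.path T) (initialMass u₀ x₀) x 0 := by
  rw [initialApprox, pathDensity, stepFun, Finset.sum_Ico_eq_sum_range]
  refine Finset.sum_congr rfl fun i hi => ?_
  have hi' := Finset.mem_range.1 hi
  have hlt : x₀ (i + 1) < x₀ (i + 2) := hx₀ ⟨by omega, by omega⟩ ⟨by omega, by omega⟩ (by omega)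
  rw [hS.path_start hN hi'.le, hS.path_start hN hi', initialMass,
    mul_div_cancel_right₀ _ (sub_pos.2 hlt).ne', add_comm 1 i]

omit hM hI in
/-- Between collision times the densities are continuous, hence so are the particle velocities. -/
lemma continuousOn_deriv_path (hd : DifferentiableAt ℝ f 0) {j : ℕ} (hj : j < S.stages) {i : ℕ}
    (hi : i ≤ N - 1) : ContinuousOn (deriv (S.path T i)) (Ioo (S.time j) (S.time (j + 1))) := by
  have hdens : ∀ k ≤ S.count j, ContinuousOn (S.cellDens j k) (Ioo (S.time j) (S.time (j + 1))) := by
    intro k hk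
    rcases Nat.eq_zero_or_pos k with rfl | hk0
    · exact (continuousOn_const (c := (0 : ℝ))).congr fun t ht =>
        (hS.cellDens_zero hN hj (hS.Icc_stage_subset hj (Ioo_subset_Icc_self ht))).1
    · rcases hk.lt_or_eq with hk1 | rfl
      · exact (hS.cellDens_continuousOn hj ⟨hk0, hk1⟩).mono Ioo_subset_Ico_self
      · exact (continuousOn_const (c := (0 : ℝ))).congr fun t ht =>
          (hS.cellDens_zero hN hj (hS.Icc_stage_subset hj (Ioo_subset_Icc_self ht))).2
  have hp := hS.follow_mem hN hj hi
  refine ContinuousOn.congr (f := fun t => S.nodeVel f j (S.follow j i) t) ?_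
    fun t ht => (hS.hasDerivAt_path hN hj hi ht).deriv
  exact (continuous_particleVelocity hf hf0 hd).comp_continuousOn
    ((hdens _ (by have := hp.2; omega)).prodMk (hdens _ hp.2))

end Paths

end IsParticlePathScheme

theorem proposition5p4
    (f : ℝ → ℝ) (hf_lip : ∃ K, LipschitzWith K f) (hf_zero : f 0 = 0)
    (hf_diff : DifferentiableAt ℝ f 0)
    (u₀ : ℝ → ℝ) (hu_nonneg : 0 ≤ᵐ[volume] u₀) (hu_int : Integrable u₀)
    (hu_bv : EssBoundedVariation u₀)
    (T : ℝ) (hT : 0 < T) (N : ℕ) (hN : 1 ≤ N)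
    (x₀ : ℕ → ℝ) (hx₀ : StrictMonoOn x₀ (Icc 1 N))
    (S : ParticleData) (hS : IsParticlePathScheme f u₀ N x₀ T S) :
    ∃ X : ℝ → ℝ → ℝ → ℝ,
      -- the ODE generates a forward Lipschitz flow,
      IsForwardLipschitzFlow (S.velocity f) T X ∧
      -- which is unique,
      (∀ Y, IsForwardLipschitzFlow (S.velocity f) T Y →
        ∀ x s t, 0 ≤ s → s ≤ t → t ≤ T → Y t x s = X t x s) ∧
      -- and whose paths are continuously differentiable between collision times;
      (∀ x, ∀ s ∈ Icc 0 T, ∀ j < S.stages,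
        ContDiffOn ℝ 1 (fun t => X t x s) (Ioo s T ∩ Ioo (S.time j) (S.time (j + 1)))) ∧
      ∀ k : ℝ,
        -- the shifted approximation is a weak solution,
        IsWeakSolution (S.velocity f) (fun x t => -k * S.velocityDeriv f x t)
          (fun x => initialApprox u₀ N x₀ x - k) T (fun x t => S.approx x t - k) ∧
        -- the only one up to null sets,
        (∀ w : ℝ → ℝ → ℝ,
          IsWeakSolution (S.velocity f) (fun x t => -k * S.velocityDeriv f x t)
            (fun x => initialApprox u₀ N x₀ x - k) T w →
          Function.uncurry w =ᵐ[stripMeasure T] fun p => S.approx p.1 p.2 - k) ∧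
        -- and it is given by the pushforward formula, tested against functions in `C_c(ℝ)`.
        ∀ s ∈ Icc 0 T, ∀ t ∈ Icc s T, ∀ θ : ℝ → ℝ, Continuous θ → HasCompactSupport θ →
          ∫ x, θ x * (S.approx x t - k) =
            (∫ x, θ (X t x s) * (S.approx x s - k)) -
              k * ∫ r in s..t, ∫ x, θ (X t x r) * S.velocityDeriv f x r := by
  obtain ⟨K, hf⟩ := hf_lip
  -- an upper bound for the initial densities
  set M : ℝ := ∑ i ∈ Finset.Ico 1 N, initialDensity u₀ x₀ i with hMdef
  have hdn : ∀ i ∈ Finset.Ico 1 N, 0 ≤ initialDensity u₀ x₀ i := fun i hi =>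
    IsParticlePathScheme.initialDensity_nonneg hu_nonneg hx₀ (by simpa using hi)
  have hM : 0 ≤ M := Finset.sum_nonneg hdn
  have hM' : ∀ i ∈ Ico 1 N, initialDensity u₀ x₀ i ≤ M := fun i hi =>
    Finset.single_le_sum hdn (by simpa using hi)
  have hI : ∀ j < S.stages, IsParticlePathScheme.MassInvariant S u₀ N x₀ M j := fun j hj =>
    hS.massInvariant hN hf hf_zero hM hu_nonneg hx₀ hM' hj
  have hP := hS.pathSystem hN hf hf_zero hM hI hT
  have hb : ∀ t ∈ Ioo 0 T, t ∉ S.time '' Iic S.stages → ∀ x,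
      S.velocity f x t = pathField (N - 1) (S.path T) x t := fun t ht hE x =>
    hS.velocity_eq_pathField hN hf hf_zero hM hI hT ht hE x
  have hv : ∀ t ∈ Icc 0 T, ∀ x,
      S.approx x t = pathDensity (N - 1) (S.path T) (initialMass u₀ x₀) x t := fun t ht x =>
    hS.approx_eq_pathDensity hN hf hf_zero hM hI ht x
  have hmass := fun {i : ℕ} (hi : i < N - 1) (t : ℝ) =>
    hS.mass_le_path hN hf hf_zero hM hI (t := t) hT.le hi
  have hm : ∀ i < N - 1, ∀ t, S.path T (i + 1) t = S.path T i t → initialMass u₀ x₀ i = 0 := by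
    intro i hi t h
    obtain ⟨-, h1, h2⟩ := hmass hi t
    rw [h, sub_self, mul_zero] at h2
    exact le_antisymm h2 h1
  have hMb : ∀ i < N - 1, ∀ t,
      |initialMass u₀ x₀ i / (S.path T (i + 1) t - S.path T i t)| ≤ M := by
    intro i hi t
    obtain ⟨h0, h1, h2⟩ := hmass hi t
    rw [abs_of_nonneg (div_nonneg h1 (sub_nonneg.2 h0))]
    exact div_le_of_le_mul₀ (sub_nonneg.2 h0) hM h2
  have hflow := hP.isForwardLipschitzFlow hb
  have hweak : ∀ k : ℝ, IsWeakSolution (S.velocity f) (fun x t => -k * S.velocityDeriv f x t)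
      (fun x => initialApprox u₀ N x₀ x - k) T (fun x t => S.approx x t - k) := by
    intro k
    simp only [hS.initialApprox_eq_pathDensity hN hx₀]
    exact hP.isWeakSolution hb hm hM hMb (fun t ht _ => hv t (Ioo_subset_Icc_self ht)) k
  refine ⟨pathFlow (N - 1) (S.path T), hflow, ?_, ?_, fun k => ⟨hweak k, ?_, ?_⟩⟩
  · intro Y hY x s t hs hst ht
    exact hflow.unique x s ⟨hs, hst.trans ht⟩ _ (hY.solution x s ⟨hs, hst.trans ht⟩) ⟨hst, ht⟩
  · intro x s _ j hj
    refine (hP.contDiffOn_flow x s (fun t ht => ?_) fun i hi =>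
      hS.continuousOn_deriv_path hN hf hf_zero hf_diff hj hi).mono inter_subset_right
    rintro ⟨l, hl, rfl⟩
    rcases Nat.lt_or_ge j l with h | h
    · exact absurd (hS.time_mono h hl) (not_le.2 ht.2)
    · exact absurd (hS.time_mono h hj.le) (not_le.2 ht.1)
  · intro w hw
    exact hP.weak_unique hb hw (hweak k)
  · intro s hs t ht θ hθ hθc
    have h := hP.pushforward hb hm k hs.1 ht.1 ht.2 hθ hθc
    simp only [hv t ⟨hs.1.trans ht.1, ht.2⟩, hv s hs]
    exact h
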